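/- **Setting.** Let $N\ge 1$ and let $p_i,q_i,m_i,n_i$ ($1\le i\le N$) be real numbers with $1<p_i\le q_i$, $m_i>0$, $n_i>0$. Put $$m=\min_i\min(m_i,n_i),\quad q=\max_i q_i,\quad \lambda_i=m_i(p_i-1),\quad \Lambda_i=n_i(q_i-1),\quad \Lambda=\max_i\Lambda_i,$$ $$\frac1p=\frac1N\sum_{i=1}^N\frac1{p_i},\qquad \Big|\frac{\lambda}{p}\Big|=\frac1N\sum_{i=1}^N\frac{\lambda_i}{p_i},$$ and assume $\lambda_i\le\Lambda_i$ for all $i$ and $p<N$. Put $$\mathcal L=\max(1,\Lambda),\qquad \mathcal M=p\Big|\frac{\lambda}{p}\Big|+(m+1)\frac pN .$$ For $y\in\mathbb R^N$, $\vec r\in(0,\infty)^N$, $\eta>0$, $\tau\in\mathbb R$ let $K_{\vec r}(y)=\{x:|x_i-y_i|<r_i\ \forall i\}$ and $Q_{\vec r,\eta}(y,\tau)=K_{\vec r}(y)\times(\tau-\eta,\tau)$. Let $\Omega\subset\mathbb R^N$ be open and bounded, $T>0$, $\Omega_T=\Omega\times(0,T]$, and $C>0$. **The class.** A function $u:\Omega_T\to[0,\infty)$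 belongs to $\mathcal{PDG}^+(\Omega_T,C)$ if it is measurable, $u\in C_{loc}(0,T;L^{1+m}_{loc}(\Omega))$; for all $i$ the functions $u^{(\lambda_i+m)/p_i}$, $u^{(\Lambda_i+m)/p_i}$ and the weak derivative $D_i\big(u^{(\lambda_i+m)/p_i}\big)$ lie in $L^{p_i}(0,T;L^{p_i}_{loc}(\Omega))$; and for every $k>0$, every cylinder with $Q_{8\vec r,8\eta}(y,\tau)\subset\Omega_T$ and every piecewise smooth $\zeta$ with $0\le\zeta\le1$ on the closure of $Q_{\vec r,\eta}(y,\tau)$, vanishing on $\partial K_{\vec r}(y)\times[\tau-\eta,\tau]$, $$\begin{aligned}&\sup_{\tau-\eta\le t\le\tau}\int_{K_{\vec r}(y)}g(u^m,k^m)\zeta^q\,dx+\frac1C\sum_{i=1}^N\iint_{Q_{\vec r,\eta}(y,\tau)}u^{(m_i-m)(p_i-1)}|D_i(u^m-k^m)_+|^{p_i}\zeta^q\,dx\,dt\\ &\le\int_{K_{\vec r}(y)\times\{\tau-\eta\}}g(u^m,k^m)\zeta^q\,dx+C\iint_{Q_{\vec r,\eta}(y,\tau)}g(u^m,k^m)|\zeta_t|\,dx\,dt\\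 &\quad+C\sum_{i=1}^N\iint_{Q_{\vec r,\eta}(y,\tau)}\Big(u^{(m_i-m)(p_i-1)}(u^m-k^m)_+^{p_i}|D_i\zeta|^{p_i}+u^{(n_i-m)(q_i-1)}(u^m-k^m)_+^{q_i}|D_i\zeta|^{q_i}\Big)dx\,dt,\end{aligned}$$ where $g(u^m,k^m)=\frac1m\int_{k^m}^{u^m}z^{\frac1m-1}(z-k^m)_+\,dz$ and $D_i(u^m-k^m)_+$ is the weak derivative. **The functions $\mathcal H$ and $\mathcal R$.** For $\theta>0$, $\vec\rho\in(0,\infty)^N$ let $$\mathcal H(\theta,\vec\rho)=\begin{cases}\frac1\theta,&\Lambda<1,\\[2pt] \frac1\theta+\sum_{i:\lambda_i=1}\rho_i^{-p_i}+\sum_{i:\Lambda_i=1}\rho_i^{-q_i},&\Lambda=1,\\[2pt] \sum_{i:\lambda_i=\Lambda}\rho_i^{-p_i}+\sum_{i:\Lambda_i=\Lambda}\rho_i^{-q_i},&\Lambda>1.\end{cases}$$ Let $S=\sum_{l:\Lambda_l=\Lambda}\rho_l^{q_l}$, and let $S'=\sum_{l:\lambda_l=\Lambda}\rho_l^{p_l}$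 if some $\lambda_l=\Lambda$, and $S'=S$ otherwise. Let $$\mathcal R(\theta,\vec\rho)=\begin{cases}\sum_{i}\big(\theta\rho_i^{-p_i}\big)^{\frac1{1-\lambda_i}}+\sum_{i}\big(\theta\rho_i^{-q_i}\big)^{\frac1{1-\Lambda_i}},&\Lambda<1,\\[4pt] \sum_{i:\lambda_i<1}\big(\theta\rho_i^{-p_i}\big)^{\frac1{1-\lambda_i}}+\sum_{i:\Lambda_i<1}\big(\theta\rho_i^{-q_i}\big)^{\frac1{1-\Lambda_i}},&\Lambda=1,\\[4pt] \sum_{i:\lambda_i=\Lambda}\big(\rho_i^{p_i}/\theta\big)^{\frac1{\Lambda-1}}+\sum_{i:\Lambda_i=\Lambda}\big(\rho_i^{q_i}/\theta\big)^{\frac1{\Lambda-1}}+\sum_{i:\lambda_i<\Lambda}\big(\rho_i^{-p_i}S'\big)^{\frac1{\Lambda-\lambda_i}}+\sum_{i:\Lambda_i<\Lambda}\big(\rho_i^{-q_i}S\big)^{\frac1{\Lambda-\Lambda_i}},&\Lambda>1.\end{cases}$$ **Theorem 1.1.** Let $\mathcal L\le\mathcal M$. Then every $u\in\mathcal{PDG}^+(\Omega_T,C)$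 is locally (essentially) bounded in $\Omega_T$, that is, on every compact subset of $\Omega\times(0,T]$. If moreover $\mathcal L<\mathcal M$, there is a constant $\gamma>0$, depending only on $C$, $N$ and the exponents $p_i,q_i,m_i,n_i$, such that for every such $\Omega$, $T$ and $u$ and every cylinder with $Q_{8\vec\rho,8\theta}(x_0,t_0)\subset\Omega_T$, the function $u^{m+\mathcal L}$ is integrable on $Q_{\vec\rho,\theta}(x_0,t_0)$ and $$\operatorname*{ess\,sup}_{Q_{\vec\rho/2,\theta/2}(x_0,t_0)}u\le\gamma\bigg(\mathcal H(\theta,\vec\rho)^{\frac{N+p}{p}}\iint_{Q_{\vec\rho,\theta}(x_0,t_0)}u^{m+\mathcal L}\,dx\,dt\bigg)^{\frac{p}{(\mathcal M-\mathcal L)N}}+\mathcal R(\theta,\vec\rho).$$ -/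

import Mathlib

open MeasureTheory Set Filter Topology
open scoped ENNReal ContDiff

noncomputable section

namespace PDG

/-- Points `(x, t)` of space-time, `x ∈ ℝᴺ`, `t ∈ ℝ`, with Lebesgue measure. -/
abbrev SpaceTime (N : ℕ) : Type := (Fin N → ℝ) × ℝ

/-- The four families of growth exponents. -/
structure Exponents (N : ℕ) where
  p : Fin N → ℝ
  q : Fin N → ℝ
  m : Fin N → ℝ
  n : Fin N → ℝ

namespace Exponents

variable {N : ℕ} (d : Exponents N)

/-- `m = min (m₁, …, m_N, n₁, …, n_N)`. -/
def mMin : ℝ := ⨅ i, min (d.m i) (d.n i)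

/-- `q = max (q₁, …, q_N)`. -/
def qMax : ℝ := ⨆ i, d.q i

/-- `λᵢ = mᵢ (pᵢ - 1)`. -/
def lam (i : Fin N) : ℝ := d.m i * (d.p i - 1)

/-- `Λᵢ = nᵢ (qᵢ - 1)`. -/
def Lam (i : Fin N) : ℝ := d.n i * (d.q i - 1)

/-- `Λ = max (Λ₁, …, Λ_N)`. -/
def LamMax : ℝ := ⨆ i, d.Lam i

/-- The harmonic mean `p` of the `pᵢ`: `1/p = (1/N) ∑ 1/pᵢ`. -/
def pMean : ℝ := ((1 / (N : ℝ)) * ∑ i, 1 / d.p i)⁻¹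

/-- `|λ/p| = (1/N) ∑ λᵢ/pᵢ`. -/
def lamOverP : ℝ := (1 / (N : ℝ)) * ∑ i, d.lam i / d.p i

/-- `𝓛 = max (1, Λ)`. -/
def calL : ℝ := max 1 d.LamMax

/-- `𝓜 = p |λ/p| + (m + 1) p / N`. -/
def calM : ℝ := d.pMean * d.lamOverP + (d.mMin + 1) * d.pMean / N

/-- Standing assumptions on the exponents. -/
structure Admissible : Prop where
  one_lt_p : ∀ i, 1 < d.p i
  p_le_q : ∀ i, d.p i ≤ d.q i
  m_pos : ∀ i, 0 < d.m i
  n_pos : ∀ i, 0 < d.n i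
  lam_le_Lam : ∀ i, d.lam i ≤ d.Lam i
  pMean_lt : d.pMean < N

/-- The quantity `𝓗(θ, ρ)`. -/
def calH (θ : ℝ) (ρ : Fin N → ℝ) : ℝ :=
  if d.LamMax < 1 then 1 / θ
  else if d.LamMax = 1 then
    1 / θ + (∑ i with d.lam i = 1, 1 / ρ i ^ d.p i) + ∑ i with d.Lam i = 1, 1 / ρ i ^ d.q i
  else
    (∑ i with d.lam i = d.LamMax, 1 / ρ i ^ d.p i) +
      ∑ i with d.Lam i = d.LamMax, 1 / ρ i ^ d.q i

/-- `∑_{l : Λ_l = Λ} ρ_l ^ q_l`. -/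
def topLam (ρ : Fin N → ℝ) : ℝ := ∑ l with d.Lam l = d.LamMax, ρ l ^ d.q l

/-- `∑_{l : λ_l = Λ} ρ_l ^ p_l`, replaced by `∑_{l : Λ_l = Λ} ρ_l ^ q_l` when no index `l`
satisfies `λ_l = Λ`. -/
def topLamP (ρ : Fin N → ℝ) : ℝ :=
  if ∃ l, d.lam l = d.LamMax then ∑ l with d.lam l = d.LamMax, ρ l ^ d.p l
  else d.topLam ρ

/-- The quantity `𝓡(θ, ρ)`. -/
def calR (θ : ℝ) (ρ : Fin N → ℝ) : ℝ :=
  if d.LamMax < 1 then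
    (∑ i, (θ / ρ i ^ d.p i) ^ (1 / (1 - d.lam i))) +
      ∑ i, (θ / ρ i ^ d.q i) ^ (1 / (1 - d.Lam i))
  else if d.LamMax = 1 then
    (∑ i with d.lam i < 1, (θ / ρ i ^ d.p i) ^ (1 / (1 - d.lam i))) +
      ∑ i with d.Lam i < 1, (θ / ρ i ^ d.q i) ^ (1 / (1 - d.Lam i))
  else
    (∑ i with d.lam i = d.LamMax, (ρ i ^ d.p i / θ) ^ (1 / (d.LamMax - 1))) +
      (∑ i with d.Lam i = d.LamMax, (ρ i ^ d.q i / θ) ^ (1 / (d.LamMax - 1))) +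
      (∑ i with d.lam i < d.LamMax,
        (1 / ρ i ^ d.p i * d.topLamP ρ) ^ (1 / (d.LamMax - d.lam i))) +
      ∑ i with d.Lam i < d.LamMax,
        (1 / ρ i ^ d.q i * d.topLam ρ) ^ (1 / (d.LamMax - d.Lam i))

end Exponents

section Geometry

variable {N : ℕ}

/-- The box `K_r(y) = {x : |xᵢ - yᵢ| < rᵢ for all i}`. -/
def box (r : Fin N → ℝ) (y : Fin N → ℝ) : Set (Fin N → ℝ) := {x | ∀ i, |x i - y i| < r i}

/-- The backward cylinder `Q_{r,η}(y, τ) = K_r(y) × (τ - η, τ)`. -/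
def cyl (r : Fin N → ℝ) (η : ℝ) (y : Fin N → ℝ) (τ : ℝ) : Set (SpaceTime N) :=
  box r y ×ˢ Ioo (τ - η) τ

/-- `Ω_T = Ω × (0, T]`. -/
def parCyl (Ω : Set (Fin N → ℝ)) (T : ℝ) : Set (SpaceTime N) := Ω ×ˢ Ioc 0 T

/-- The classical spatial partial derivative `D_i φ`. -/
def spaceDeriv (i : Fin N) (φ : SpaceTime N → ℝ) (z : SpaceTime N) : ℝ :=
  fderiv ℝ φ z (Pi.single i 1, 0)

/-- The classical time derivative `φ_t`. -/
def timeDeriv (φ : SpaceTime N → ℝ) (z : SpaceTime N) : ℝ := fderiv ℝ φ z (0, 1)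

/-- `v` is the weak partial derivative `D_i f` on the open set `U`. -/
def HasWeakSpaceDeriv (U : Set (SpaceTime N)) (i : Fin N) (f v : SpaceTime N → ℝ) : Prop :=
  LocallyIntegrableOn f U ∧ LocallyIntegrableOn v U ∧
    ∀ φ : SpaceTime N → ℝ, ContDiff ℝ ∞ φ → HasCompactSupport φ → tsupport φ ⊆ U →
      ∫ z in U, f z * spaceDeriv i φ z = -∫ z in U, v z * φ z

/-- `ζ` is piecewise smooth on `S`: finitely many closed sets cover `S`, and on each of them
`ζ` coincides (within `S`) with a smooth function. In particular `ζ` is continuous on `S`. -/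
def PiecewiseSmoothOn (S : Set (SpaceTime N)) (ζ : SpaceTime N → ℝ) : Prop :=
  ∃ (M : ℕ) (P : Fin M → Set (SpaceTime N)) (φ : Fin M → SpaceTime N → ℝ),
    (∀ j, IsClosed (P j)) ∧ S ⊆ ⋃ j, P j ∧ (∀ j, ContDiff ℝ ∞ (φ j)) ∧
      ∀ j, ∀ z ∈ S ∩ P j, ζ z = φ j z

/-- Piecewise smooth cutoff functions on the closed cylinder, with values in `[0, 1]` and
vanishing on the lateral boundary `∂K_r(y) × [τ - η, τ]`. -/
structure IsCutoff (r : Fin N → ℝ) (η : ℝ) (y : Fin N → ℝ) (τ : ℝ)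
    (ζ : SpaceTime N → ℝ) : Prop where
  piecewiseSmooth : PiecewiseSmoothOn (closure (box r y) ×ˢ Icc (τ - η) τ) ζ
  mem_Icc : ∀ z ∈ closure (box r y) ×ˢ Icc (τ - η) τ, ζ z ∈ Icc (0 : ℝ) 1
  lateral : ∀ z ∈ frontier (box r y) ×ˢ Icc (τ - η) τ, ζ z = 0

end Geometry

/-- `g_m(a, b) = (1/m) ∫_b^a z^{1/m - 1} (z - b)_+ dz`. -/
def gFun (m a b : ℝ) : ℝ := (1 / m) * ∫ z in b..a, z ^ (1 / m - 1) * max (z - b) 0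

section Classes

variable {N : ℕ}

/-- `u ∈ C_loc(0, T; L^s_loc(Ω))`. -/
def MemCLoc (s : ℝ) (Ω : Set (Fin N → ℝ)) (T : ℝ) (u : SpaceTime N → ℝ) : Prop :=
  ∀ K : Set (Fin N → ℝ), IsCompact K → K ⊆ Ω → ∀ t ∈ Ioo 0 T,
    MemLp (fun x => u (x, t)) (ENNReal.ofReal s) (volume.restrict K) ∧
    Tendsto (fun t' => eLpNorm (fun x => u (x, t') - u (x, t)) (ENNReal.ofReal s)
      (volume.restrict K)) (𝓝 t) (𝓝 0)

/-- `f ∈ L^s(0, T; L^s_loc(Ω))`. -/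
def MemLpLoc (s : ℝ) (Ω : Set (Fin N → ℝ)) (T : ℝ) (f : SpaceTime N → ℝ) : Prop :=
  ∀ K : Set (Fin N → ℝ), IsCompact K → K ⊆ Ω →
    MemLp f (ENNReal.ofReal s) (volume.restrict (K ×ˢ Ioo 0 T))

/-- The anisotropic parabolic energy space `𝓥_loc(Ω_T)` (for nonnegative `u`). -/
structure MemVLoc (d : Exponents N) (Ω : Set (Fin N → ℝ)) (T : ℝ) (u : SpaceTime N → ℝ) :
    Prop where
  aemeasurable : AEMeasurable u (volume.restrict (parCyl Ω T))
  memLp_lam : ∀ i, MemLpLoc (d.p i) Ω T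
    (fun z => u z ^ ((d.m i * (d.p i - 1) + d.mMin) / d.p i))
  memLp_Lam : ∀ i, MemLpLoc (d.p i) Ω T
    (fun z => u z ^ ((d.n i * (d.q i - 1) + d.mMin) / d.p i))
  weakDeriv : ∀ i, ∃ w : SpaceTime N → ℝ,
    HasWeakSpaceDeriv (Ω ×ˢ Ioo 0 T) i
      (fun z => u z ^ ((d.m i * (d.p i - 1) + d.mMin) / d.p i)) w ∧
    MemLpLoc (d.p i) Ω T w

/-- The energy inequality at level `k` on `Q_{r,η}(y, τ)` with cutoff `ζ`; here `v i` stands for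
`D_i (u^m - k^m)_+`. All integrands are nonnegative, and the integrals are
`[0, ∞]`-valued. -/
def EnergyIneq (d : Exponents N) (C : ℝ) (u : SpaceTime N → ℝ) (k : ℝ)
    (v : Fin N → SpaceTime N → ℝ) (r : Fin N → ℝ) (η : ℝ) (y : Fin N → ℝ) (τ : ℝ)
    (ζ : SpaceTime N → ℝ) : Prop :=
  (⨆ t ∈ Icc (τ - η) τ, ∫⁻ x in box r y,
      ENNReal.ofReal (gFun d.mMin (u (x, t) ^ d.mMin) (k ^ d.mMin) * ζ (x, t) ^ d.qMax)) +
    ENNReal.ofReal (1 / C) * ∑ i, ∫⁻ z in cyl r η y τ,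
      ENNReal.ofReal
        (u z ^ ((d.m i - d.mMin) * (d.p i - 1)) * |v i z| ^ d.p i * ζ z ^ d.qMax)
  ≤ (∫⁻ x in box r y,
      ENNReal.ofReal (gFun d.mMin (u (x, τ - η) ^ d.mMin) (k ^ d.mMin) *
        ζ (x, τ - η) ^ d.qMax)) +
    ENNReal.ofReal C * (∫⁻ z in cyl r η y τ,
      ENNReal.ofReal (gFun d.mMin (u z ^ d.mMin) (k ^ d.mMin) * |timeDeriv ζ z|)) +
    ENNReal.ofReal C * (∑ i, ∫⁻ z in cyl r η y τ,
      ENNReal.ofReal (u z ^ ((d.m i - d.mMin) * (d.p i - 1)) *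
        max (u z ^ d.mMin - k ^ d.mMin) 0 ^ d.p i * |spaceDeriv i ζ z| ^ d.p i)) +
    ENNReal.ofReal C * (∑ i, ∫⁻ z in cyl r η y τ,
      ENNReal.ofReal (u z ^ ((d.n i - d.mMin) * (d.q i - 1)) *
        max (u z ^ d.mMin - k ^ d.mMin) 0 ^ d.q i * |spaceDeriv i ζ z| ^ d.q i))

/-- The parabolic De Giorgi class `PDG⁺(Ω_T, C)`. -/
structure MemPDG (d : Exponents N) (C : ℝ) (Ω : Set (Fin N → ℝ)) (T : ℝ)
    (u : SpaceTime N → ℝ) : Prop where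
  nonneg : ∀ z ∈ parCyl Ω T, 0 ≤ u z
  memCLoc : MemCLoc (1 + d.mMin) Ω T u
  memVLoc : MemVLoc d Ω T u
  energy : ∀ k : ℝ, 0 < k → ∃ v : Fin N → SpaceTime N → ℝ,
    (∀ i, HasWeakSpaceDeriv (Ω ×ˢ Ioo 0 T) i
      (fun z => max (u z ^ d.mMin - k ^ d.mMin) 0) (v i)) ∧
    ∀ (r : Fin N → ℝ) (η : ℝ) (y : Fin N → ℝ) (τ : ℝ), (∀ i, 0 < r i) → 0 < η →
      cyl (fun i => 8 * r i) (8 * η) y τ ⊆ parCyl Ω T →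
      ∀ ζ : SpaceTime N → ℝ, IsCutoff r η y τ ζ → EnergyIneq d C u k v r η y τ ζ

/-- `u` is (essentially) locally bounded in `Ω_T`. -/
def LocallyBounded (Ω : Set (Fin N → ℝ)) (T : ℝ) (u : SpaceTime N → ℝ) : Prop :=
  ∀ K : Set (SpaceTime N), IsCompact K → K ⊆ parCyl Ω T →
    ∃ B : ℝ, ∀ᵐ z ∂(volume.restrict K), |u z| ≤ B

end Classes

end PDG

end

/-! The proof is a De Giorgi iteration on the truncations `w = (u^m - k^m)_+`. The energy inequality
controls the supremum in time of the integral of `g(u^m, k^m)` and the weighted gradients `u^((m_i -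
m)(p_i - 1)) |D_i w|^(p_i)`. Since `w ≤ u^m` and `m ≤ m_i`, the weight dominates `w^((a_i - 1) p_i)`
with `a_i = aExp d i`. Hence, up to constants, the derivative of `w^(a_i)` in direction `i` lies in
`L^(p_i)`: each direction comes with its own power of `w`.

For such functions a Sobolev inequality holds with exponent `σ = p (∑ a_i) / (N - p)`
(`sobolev_of_lines`, `sobolev_slices`). A power of `w` is bounded along each coordinate line by the
integral of its derivative; the bounds are multiplied over the directions and integrated by the
Loomis–Whitney inequality (`lintegral_prod_lintegral_pow_le'`), and Hölder's inequality leaves a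
smaller power of the left side, which is absorbed. The powers are truncated first, so that the
absorbed quantity is finite.

Above the raised level `k + εK` one has `u^m ≲ w/ε` and `u^(m+1) ≲ g/ε²`, so `u^(m+𝓜)` is bounded by
`(w^σ)^((N-p)/N) g^(p/N)`, which is the origin of `𝓜`. Hölder's inequality in space and then in time
bounds the integral of `u^(m+𝓜)` by the power `1 + p/N` of the right side of the energy inequality
(`lintegral_interp_le`). That right side contains only the growth exponents `1`, `λ_i`, `Λ_i`, all
at most `𝓛`; for `k ≥ K/2` it is at most a multiple of `coefSum d K θ ρ` times the integral of
`u^(m+𝓛)` over `{u > k}` (`energyRight_le`). Because `𝓛 ≤ 𝓜`, the left side returns to the power `m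
+ 𝓛` at the price `K^(𝓛-𝓜)` (`MemPDG.step`). The recursion `Y (n+1) ≤ A b^n (Y n)^(1+p/N)` on
shrinking cylinders with levels rising to `K` yields `u ≤ K` under a smallness condition
(`MemPDG.ae_le_of_small`).

The condition is used twice. As `K → ∞` the tail of the integral of `u^(m+𝓛)` tends to zero while
the other factors stay bounded, also when `𝓛 = 𝓜`; this gives local boundedness. If `𝓛 < 𝓜`, every
level `K ≥ 𝓡` satisfies `coefSum ≤ (1 + 2N) 𝓗`, and solving the condition for `K` gives the stated
estimate. -/

noncomputable section

namespace PDG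

/-! ### Weak derivatives and integration along lines -/

section Line

/-- Chain rule for the primitive of an integrable function. -/
theorem integral_comp_primitive {v γ : ℝ → ℝ} {a b : ℝ} (hv : IntervalIntegrable v volume a b)
    (hγ : Continuous γ) :
    ∫ y in (0 : ℝ)..∫ s in a..b, v s, γ y
      = ∫ x in a..b, γ (∫ s in a..x, v s) * v x := by
  set W : ℝ → ℝ := fun x => ∫ s in a..x, v s with hW
  set Γ : ℝ → ℝ := fun y => ∫ t in (0 : ℝ)..y, γ t with hΓ
  have hWac : AbsolutelyContinuousOnInterval W a b :=
    hv.absolutelyContinuousOnInterval_intervalIntegral left_mem_uIcc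
  have hΓd : ∀ y, HasDerivAt Γ (γ y) y := fun y =>
    intervalIntegral.integral_hasDerivAt_right (hγ.intervalIntegrable _ _)
      hγ.aestronglyMeasurable.stronglyMeasurableAtFilter hγ.continuousAt
  have hΓ1 : ContDiff ℝ 1 Γ := by
    rw [contDiff_one_iff_deriv]
    exact ⟨fun y => (hΓd y).differentiableAt, by
      have : deriv Γ = γ := funext fun y => (hΓd y).deriv
      rwa [this]⟩
  -- `W` has bounded range and `Γ` is Lipschitz on bounded sets, so `Γ ∘ W` is absolutely continuous
  -- and the fundamental theorem of calculus applies to it.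
  obtain ⟨R, hR⟩ := hWac.exists_bound
  obtain ⟨K, hK⟩ := (hΓ1.contDiffOn (s := Icc (-R) R)).exists_lipschitzOnWith (by decide)
    (convex_Icc _ _) isCompact_Icc
  have hmem : ∀ x ∈ uIcc a b, W x ∈ Icc (-R) R := fun x hx => by
    have := hR x hx
    rw [Real.norm_eq_abs] at this
    exact abs_le.1 this
  have hcomp : AbsolutelyContinuousOnInterval (fun x => Γ (W x)) a b := by
    rw [absolutelyContinuousOnInterval_iff] at hWac ⊢
    intro ε hε
    obtain ⟨δ, hδ, h⟩ := hWac (ε / (K + 1)) (by positivity)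
    refine ⟨δ, hδ, fun E hE hlt => ?_⟩
    have h1 := h E hE hlt
    calc ∑ i ∈ Finset.range E.1, dist (Γ (W (E.2 i).1)) (Γ (W (E.2 i).2))
        ≤ ∑ i ∈ Finset.range E.1, K * dist (W (E.2 i).1) (W (E.2 i).2) :=
          Finset.sum_le_sum fun i hi =>
            hK.dist_le_mul _ (hmem _ (hE.1 i hi).1) _ (hmem _ (hE.1 i hi).2)
      _ = K * ∑ i ∈ Finset.range E.1, dist (W (E.2 i).1) (W (E.2 i).2) :=
          (Finset.mul_sum _ _ _).symm
      _ ≤ K * (ε / (K + 1)) := by gcongr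
      _ < (K + 1) * (ε / (K + 1)) := by gcongr; linarith
      _ = ε := by field
  have hW0 : W a = 0 := by simp [hW]
  have hftc := hcomp.integral_deriv_eq_sub
  have hΓ0 : Γ 0 = 0 := by simp [hΓ]
  rw [hW0, hΓ0, sub_zero] at hftc
  change Γ (W b) = _
  rw [← hftc]
  apply intervalIntegral.integral_congr_ae
  filter_upwards [hv.ae_hasDerivAt_integral] with x hx hxm
  exact ((hΓd (W x)).comp x (hx (uIoc_subset_uIcc hxm) a left_mem_uIcc)).deriv

/-- A function on the line which is a.e. the primitive of `v`. -/
theorem ofReal_integral_le_of_primitive {v f γ : ℝ → ℝ} {A : ℝ} (hA : 0 ≤ A)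
    (hv : IntervalIntegrable v volume (-A) 0) (hγ : Continuous γ) (hγ0 : ∀ y, 0 ≤ γ y)
    (hf : ∀ᵐ s, s ∈ Ioo (-A) 0 → f s = ∫ x in (-A)..s, v x)
    (hf0 : f 0 = ∫ x in (-A)..0, v x) :
    ENNReal.ofReal (∫ y in (0 : ℝ)..f 0, γ y)
      ≤ ∫⁻ s, ENNReal.ofReal (γ (f s) * |v s|) := by
  rw [hf0, integral_comp_primitive hv hγ, intervalIntegral.integral_of_le (by linarith)]
  refine le_trans (ENNReal.ofReal_le_ofReal (le_abs_self _)) ?_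
  rw [← Real.norm_eq_abs, ofReal_norm]
  refine le_trans (enorm_integral_le_lintegral_enorm _) ?_
  rw [← restrict_Ioo_eq_restrict_Ioc]
  refine le_trans (le_of_eq ?_) (setLIntegral_le_lintegral (Ioo (-A) 0) _)
  apply lintegral_congr_ae
  filter_upwards [ae_restrict_of_ae hf, ae_restrict_mem measurableSet_Ioo] with s hs hsm
  rw [hs hsm, ← ofReal_norm, norm_mul, Real.norm_eq_abs, Real.norm_eq_abs, abs_of_nonneg (hγ0 _)]

variable {V : Type*} [NormedAddCommGroup V] [NormedSpace ℝ V] [MeasurableSpace V] [BorelSpace V]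
  [FiniteDimensional ℝ V] {μ : Measure V} [μ.IsAddHaarMeasure]

/-- Each fibre map is a translation, which preserves Haar measure. Combined with Fubini, the shear
transfers statements about almost every point to almost every line in direction `e`. -/
theorem measurePreserving_shear (ν : Measure ℝ) [SFinite ν] (e : V) :
    MeasurePreserving (fun q : ℝ × V => (q.1, q.2 + q.1 • e)) (ν.prod μ) (ν.prod μ) := by
  refine MeasurePreserving.skew_product (g := fun s z => z + s • e) (MeasurePreserving.id ν)
    ?_ (Eventually.of_forall fun s => ?_)
  · exact (Continuous.measurable (by fun_prop))
  · exact (measurePreserving_add_right μ (s • e)).map_eq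

theorem ae_ae_line {P : V → Prop} (hP : ∀ᵐ z ∂μ, P z) (e : V) :
    ∀ᵐ z ∂μ, ∀ᵐ s : ℝ, P (z + s • e) := by
  have h1 : ∀ᵐ q ∂((volume : Measure ℝ).prod μ), P q.2 :=
    Measure.quasiMeasurePreserving_snd.ae hP
  have h2 := (measurePreserving_shear (μ := μ) volume e).quasiMeasurePreserving.ae h1
  have h3 := (Measure.measurePreserving_swap (μ := μ) (ν := volume)).quasiMeasurePreserving.ae h2
  exact Measure.ae_ae_of_ae_prod h3

/-- `D` is the weak derivative of `F` in direction `e` on the whole space. -/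
def HasGlobalWeakDeriv (μ : Measure V) (e : V) (F D : V → ℝ) : Prop :=
  ∀ φ : V → ℝ, ContDiff ℝ ∞ φ → HasCompactSupport φ →
    ∫ z, F z * fderiv ℝ φ z e ∂μ = -∫ z, D z * φ z ∂μ

/-- Both sides are tested against `φ`. Moving the translation to `φ` produces `φ (z + h e) - φ z`,
the integral over `0 ≤ s ≤ h` of the directional derivative of the translates `φ (· + s e)`; for
each `s` the definition of the weak derivative applies, and Fubini concludes. -/
theorem sub_translate_eq {e : V} {F D : V → ℝ} (hF : Integrable F μ) (hD : Integrable D μ)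
    (hFD : HasGlobalWeakDeriv μ e F D) {h : ℝ} (hh : 0 ≤ h) :
    ∀ᵐ z ∂μ, F z - F (z - h • e) = ∫ s in (0 : ℝ)..h, D (z - s • e) := by
  set ν : Measure ℝ := volume.restrict (Ioc 0 h)
  have hDs : Integrable (fun q : ℝ × V => D (q.2 - q.1 • e)) (ν.prod μ) := by
    have h1 : Integrable (fun q : ℝ × V => D q.2) (ν.prod μ) := hD.comp_snd ν
    have := (measurePreserving_shear (μ := μ) ν (-e)).integrable_comp_of_integrable h1
    simpa [Function.comp_def, sub_eq_add_neg] using this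
  have hT : Integrable (fun z => F (z - h • e)) μ := hF.comp_sub_right _
  have hR : Integrable (fun z => ∫ s in (0 : ℝ)..h, D (z - s • e)) μ := by
    simp_rw [intervalIntegral.integral_of_le hh]
    exact hDs.integral_prod_right
  refine ae_eq_of_integral_contDiff_smul_eq (hF.sub hT).locallyIntegrable hR.locallyIntegrable ?_
  intro φ hφ hφc
  have hφcont : Continuous φ := hφ.continuous
  obtain ⟨M, hM⟩ := hφc.exists_bound_of_continuous hφcont
  have hdφ : Continuous (fun z => fderiv ℝ φ z e) :=
    (hφ.continuous_fderiv (by simp)).clm_apply continuous_const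
  have hdφc : HasCompactSupport (fun z => fderiv ℝ φ z e) :=
    (hφc.fderiv ℝ).comp_left (g := fun (l : V →L[ℝ] ℝ) => l e) (by simp)
  obtain ⟨M', hM'⟩ := hdφc.exists_bound_of_continuous hdφ
  have hFφ : ∀ c : V, Integrable (fun z => F z * φ (z + c)) μ := fun c =>
    hF.mul_bdd (c := M) (by fun_prop : Continuous fun z => φ (z + c)).aestronglyMeasurable
      (Eventually.of_forall fun z => hM _)
  simp only [smul_eq_mul]
  -- left side
  have hL : ∫ z, φ z * (F z - F (z - h • e)) ∂μ
      = -∫ z, F z * (φ (z + h • e) - φ z) ∂μ := by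
    have e1 : ∫ z, F (z - h • e) * φ z ∂μ = ∫ z, F z * φ (z + h • e) ∂μ := by
      rw [← integral_sub_right_eq_self (fun z => F z * φ (z + h • e)) (h • e)]
      simp
    have i1 : Integrable (fun z => F z * φ z) μ := by simpa using hFφ 0
    have i2 : Integrable (fun z => F (z - h • e) * φ z) μ :=
      hT.mul_bdd (c := M) hφcont.aestronglyMeasurable (Eventually.of_forall hM)
    have : ∀ z, φ z * (F z - F (z - h • e)) = F z * φ z - F (z - h • e) * φ z := fun z => by ring
    simp_rw [this]
    rw [integral_sub i1 i2, e1]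
    simp_rw [mul_sub]
    rw [integral_sub (hFφ _) i1]
    ring
  have hftc : ∀ z, φ (z + h • e) - φ z = ∫ s in (0 : ℝ)..h, fderiv ℝ φ (z + s • e) e := by
    intro z
    have hd : ∀ s ∈ uIcc 0 h, HasDerivAt (fun s : ℝ => φ (z + s • e))
        (fderiv ℝ φ (z + s • e) e) s := by
      intro s _
      have h1 : HasFDerivAt φ (fderiv ℝ φ (z + s • e)) (z + s • e) :=
        (hφ.differentiable (by simp)).differentiableAt.hasFDerivAt
      have h2 : HasDerivAt (fun s : ℝ => z + s • e) e s := by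
        simpa using ((hasDerivAt_id s).smul_const e).const_add z
      exact h1.comp_hasDerivAt s h2
    rw [intervalIntegral.integral_eq_sub_of_hasDerivAt hd
      ((by fun_prop : Continuous fun s : ℝ => fderiv ℝ φ (z + s • e) e).intervalIntegrable _ _)]
    simp
  have hIntF : Integrable (fun q : V × ℝ => F q.1 * fderiv ℝ φ (q.1 + q.2 • e) e) (μ.prod ν) :=
    (hF.comp_fst ν).mul_bdd (c := M')
      (by fun_prop : Continuous fun q : V × ℝ =>
        fderiv ℝ φ (q.1 + q.2 • e) e).aestronglyMeasurable
      (Eventually.of_forall fun z => hM' _)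
  have hIntD : Integrable (fun q : ℝ × V => φ q.2 * D (q.2 - q.1 • e)) (ν.prod μ) :=
    hDs.bdd_mul (c := M) (hφcont.comp continuous_snd).aestronglyMeasurable
      (Eventually.of_forall fun q => hM _)
  rw [hL]
  simp_rw [hftc, intervalIntegral.integral_of_le hh, ← integral_const_mul]
  rw [integral_integral_swap hIntF, integral_integral_swap (f := fun z s => φ z * D (z - s • e))
    hIntD.swap, ← integral_neg]
  refine integral_congr_ae (Eventually.of_forall fun s => ?_)
  have hφs : ContDiff ℝ ∞ (fun z => φ (z + s • e)) := by fun_prop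
  have hφsc : HasCompactSupport (fun z => φ (z + s • e)) :=
    hφc.comp_homeomorph (Homeomorph.addRight (s • e))
  have := hFD _ hφs hφsc
  simp only [fderiv_comp_add_right] at this
  simp only
  rw [this, neg_neg, ← integral_sub_right_eq_self (fun z => D z * φ (z + s • e)) (s • e)]
  simp [mul_comm]

theorem ae_intervalIntegrable_line {D : V → ℝ} (hD : Integrable D μ) (e : V) :
    ∀ᵐ z ∂μ, ∀ n : ℕ, IntervalIntegrable (fun s : ℝ => D (z + s • e)) volume (-n) n := by
  rw [ae_all_iff]
  intro n
  have h1 : Integrable (fun q : ℝ × V => D q.2) ((volume.restrict (Ioc (-n : ℝ) n)).prod μ) :=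
    hD.comp_snd _
  have h2 := (measurePreserving_shear (μ := μ) (volume.restrict (Ioc (-n : ℝ) n))
    e).integrable_comp_of_integrable h1
  filter_upwards [h2.prod_left_ae] with z hz
  rw [intervalIntegrable_iff_integrableOn_Ioc_of_le (by linarith [n.cast_nonneg (α := ℝ)])]
  exact hz

/-- An integrable function of bounded support is a.e. the integral of its weak derivative along
lines. -/
theorem ae_eq_integral_line {e : V} (he : e ≠ 0) {F D : V → ℝ} (hF : Integrable F μ)
    (hD : Integrable D μ) (hFD : HasGlobalWeakDeriv μ e F D) {R : ℝ}
    (hFR : ∀ z, R < ‖z‖ → F z = 0) (hDR : ∀ z, R < ‖z‖ → D z = 0) :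
    ∀ᵐ z ∂μ, F z = ∫ s in Ioi (0 : ℝ), D (z - s • e) := by
  have h1 : ∀ᵐ z ∂μ, ∀ n : ℕ, F z - F (z - (n : ℝ) • e) = ∫ s in (0 : ℝ)..n, D (z - s • e) :=
    ae_all_iff.2 fun n => sub_translate_eq hF hD hFD n.cast_nonneg
  filter_upwards [h1] with z hz
  have he' : 0 < ‖e‖ := norm_pos_iff.2 he
  -- A shift by `n e` with this `n` leaves the ball of radius `R`, so the shifted value of `F` drops
  -- out and the integral over `(0, n)` equals that over the half-line.
  obtain ⟨n, hn⟩ := exists_nat_gt ((R + ‖z‖) / ‖e‖)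
  have hfar : ∀ s : ℝ, (n : ℝ) ≤ s → R < ‖z - s • e‖ := by
    intro s hs
    have h2 : R + ‖z‖ < s * ‖e‖ := by
      rw [div_lt_iff₀ he'] at hn
      exact hn.trans_le (by gcongr)
    have h3 : ‖s • e‖ ≤ ‖z‖ + ‖z - s • e‖ := by
      have := norm_sub_le z (z - s • e)
      simpa using this
    rw [norm_smul, Real.norm_eq_abs, abs_of_nonneg (n.cast_nonneg.trans hs)] at h3
    linarith
  have h4 := hz n
  rw [hFR _ (hfar n le_rfl), sub_zero, intervalIntegral.integral_of_le n.cast_nonneg] at h4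
  rw [h4]
  symm
  refine setIntegral_eq_of_subset_of_forall_sdiff_eq_zero measurableSet_Ioi
    (fun x hx => hx.1) fun s hs => hDR _ (hfar s ?_)
  by_contra hlt
  exact hs.2 ⟨hs.1, (not_le.1 hlt).le⟩

/-- Bound along lines for the composition of a weakly differentiable function with a primitive. -/
theorem ae_line_bound {e : V} (he : e ≠ 0) {F D : V → ℝ} (hF : Integrable F μ)
    (hD : Integrable D μ) (hFD : HasGlobalWeakDeriv μ e F D) {R : ℝ}
    (hFR : ∀ z, R < ‖z‖ → F z = 0) (hDR : ∀ z, R < ‖z‖ → D z = 0)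
    {γ : ℝ → ℝ} (hγ : Continuous γ) (hγ0 : ∀ y, 0 ≤ γ y) :
    ∀ᵐ z ∂μ, ENNReal.ofReal (∫ y in (0 : ℝ)..F z, γ y)
      ≤ ∫⁻ s : ℝ, ENNReal.ofReal (γ (F (z + s • e)) * |D (z + s • e)|) := by
  have h1 := ae_eq_integral_line he hF hD hFD hFR hDR
  filter_upwards [h1, ae_ae_line h1 e, ae_intervalIntegrable_line hD e] with z hz hz' hzi
  have he' : 0 < ‖e‖ := norm_pos_iff.2 he
  obtain ⟨n, hn⟩ := exists_nat_gt ((R + ‖z‖) / ‖e‖)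
  have hfar : ∀ s : ℝ, s ≤ -n → D (z + s • e) = 0 := by
    intro s hs
    apply hDR
    have h2 : R + ‖z‖ < (-s) * ‖e‖ := by
      rw [div_lt_iff₀ he'] at hn
      exact hn.trans_le (by gcongr; linarith)
    have h3 : ‖s • e‖ ≤ ‖z + s • e‖ + ‖z‖ := by
      have := norm_sub_le (z + s • e) z
      simpa using this
    rw [norm_smul, Real.norm_eq_abs, abs_of_nonpos (hs.trans (by simp))] at h3
    linarith
  have hprim : ∀ s : ℝ, (-n : ℝ) ≤ s → F (z + s • e) = ∫ σ in Ioi (0 : ℝ), D (z + s • e - σ • e) →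
      F (z + s • e) = ∫ x in (-n : ℝ)..s, D (z + x • e) := by
    intro s hs hFs
    rw [hFs, intervalIntegral.integral_of_le hs]
    have h5 : ∀ σ : ℝ, D (z + s • e - σ • e) = (fun x => D (z + x • e)) (s - σ) := fun σ => by
      simp only [sub_smul]
      congr 1
      abel
    simp_rw [h5]
    -- The reflection `σ ↦ s - σ` turns the half-line integral into one over `(-∞, s)`, whose part
    -- below `-n` vanishes.
    have h6 := integral_sub_left_eq_self ((Iio s).indicator fun x => D (z + x • e))
      (volume : Measure ℝ) s
    have h7 : (fun σ => (Iio s).indicator (fun x => D (z + x • e)) (s - σ))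
        = (Ioi (0 : ℝ)).indicator (fun σ => (fun x => D (z + x • e)) (s - σ)) := by
      funext σ
      by_cases hσ : 0 < σ <;> simp [indicator, hσ]
    rw [h7, integral_indicator measurableSet_Ioi, integral_indicator measurableSet_Iio] at h6
    rw [h6, ← integral_Iic_eq_integral_Iio]
    exact setIntegral_eq_of_subset_of_forall_sdiff_eq_zero measurableSet_Iic (fun x hx => hx.2)
      fun x hx => hfar x (not_lt.1 fun hlt => hx.2 ⟨hlt, hx.1⟩)
  -- The representation for almost every `s` says nothing about the single parameter `s = 0`; there
  -- it is supplied by `hz`.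
  have h8 := ofReal_integral_le_of_primitive (v := fun s => D (z + s • e))
    (f := fun s => F (z + s • e)) (A := n) n.cast_nonneg
    ((hzi n).mono_set (by
      rw [uIcc_of_le (by simp), uIcc_of_le (by linarith [n.cast_nonneg (α := ℝ)])]
      exact Icc_subset_Icc_right n.cast_nonneg)) hγ hγ0
    (hz'.mono fun s hs hsm => hprim s hsm.1.le hs)
    (hprim 0 (by simp) (by simpa using hz))
  simpa using h8

end Line

/-! ### The Loomis–Whitney inequality -/

section LoomisWhitney

variable {N : ℕ}

/-- The grid-lines inequality for a single function is applied to `g = ∑ f_j / B_j`, which has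
integral at most `N` and satisfies `f_i ≤ B_i g`. This accounts for the factor `N^(N/(N-1))`. -/
theorem lintegral_prod_lintegral_pow_le_of_pos (hN : 2 ≤ N)
    {f : Fin N → (Fin N → ℝ) → ℝ≥0∞} (hf : ∀ i, Measurable (f i)) {B : Fin N → ℝ≥0∞}
    (hB0 : ∀ i, B i ≠ 0) (hB : ∀ i, B i ≠ ⊤) (hfB : ∀ i, ∫⁻ x, f i x ≤ B i) :
    ∫⁻ x, ∏ i, (∫⁻ s, f i (Function.update x i s)) ^ (1 / ((N : ℝ) - 1))
      ≤ (N : ℝ≥0∞) ^ ((N : ℝ) / (N - 1)) * ∏ i, B i ^ (1 / ((N : ℝ) - 1)) := by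
  have hN1 : (1 : ℝ) < N := by exact_mod_cast hN
  have hr : 0 ≤ 1 / ((N : ℝ) - 1) := by
    have : (0 : ℝ) < N - 1 := by linarith
    positivity
  set g : (Fin N → ℝ) → ℝ≥0∞ := fun x => ∑ j, (B j)⁻¹ * f j x with hg
  have hgm : Measurable g := Finset.measurable_sum _ fun j _ => (hf j).const_mul _
  have hfg : ∀ i x, f i x ≤ B i * g x := by
    intro i x
    calc f i x = B i * ((B i)⁻¹ * f i x) := by
          rw [← mul_assoc, ENNReal.mul_inv_cancel (hB0 i) (hB i), one_mul]
      _ ≤ B i * g x := by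
          gcongr
          exact Finset.single_le_sum (f := fun j => (B j)⁻¹ * f j x) (fun _ _ => zero_le)
            (Finset.mem_univ i)
  have hgi : ∫⁻ x, g x ≤ N := by
    rw [hg, lintegral_finsetSum _ fun j _ => (hf j).const_mul _]
    calc ∑ j, ∫⁻ x, (B j)⁻¹ * f j x ≤ ∑ _j : Fin N, (1 : ℝ≥0∞) := by
          refine Finset.sum_le_sum fun j _ => ?_
          rw [lintegral_const_mul _ (hf j)]
          calc (B j)⁻¹ * ∫⁻ x, f j x ≤ (B j)⁻¹ * B j := by gcongr; exact hfB j
            _ = 1 := ENNReal.inv_mul_cancel (hB0 j) (hB j)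
      _ = N := by simp
  have hconj : Real.HolderConjugate (Fintype.card (Fin N)) ((N : ℝ) / (N - 1)) := by
    rw [Fintype.card_fin, Real.holderConjugate_iff]
    refine ⟨hN1, ?_⟩
    have : (N : ℝ) - 1 ≠ 0 := by linarith
    field_simp
    ring
  have hGN := lintegral_prod_lintegral_pow_le (fun _ : Fin N => (volume : Measure ℝ)) hconj hgm
  rw [Fintype.card_fin, ← volume_pi] at hGN
  calc ∫⁻ x, ∏ i, (∫⁻ s, f i (Function.update x i s)) ^ (1 / ((N : ℝ) - 1))
      ≤ ∫⁻ x, (∏ i, B i ^ (1 / ((N : ℝ) - 1))) *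
          ∏ i, (∫⁻ s, g (Function.update x i s)) ^ (1 / ((N : ℝ) - 1)) := by
        refine lintegral_mono fun x => ?_
        rw [← Finset.prod_mul_distrib]
        refine Finset.prod_le_prod' fun i _ => ?_
        rw [← ENNReal.mul_rpow_of_nonneg _ _ hr]
        gcongr
        rw [← lintegral_const_mul' _ _ (hB i)]
        exact lintegral_mono fun s => hfg i _
    _ = (∏ i, B i ^ (1 / ((N : ℝ) - 1))) *
          ∫⁻ x, ∏ i, (∫⁻ s, g (Function.update x i s)) ^ (1 / ((N : ℝ) - 1)) := by
        rw [lintegral_const_mul']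
        exact ENNReal.prod_ne_top fun i _ => ENNReal.rpow_ne_top_of_nonneg hr (hB i)
    _ ≤ (∏ i, B i ^ (1 / ((N : ℝ) - 1))) * (N : ℝ≥0∞) ^ ((N : ℝ) / (N - 1)) := by
        gcongr
        refine hGN.trans ?_
        gcongr
    _ = _ := mul_comm _ _

/-- The **Loomis–Whitney inequality** along grid lines, with one function for each direction. -/
theorem lintegral_prod_lintegral_pow_le' (hN : 2 ≤ N)
    {f : Fin N → (Fin N → ℝ) → ℝ≥0∞} (hf : ∀ i, Measurable (f i))
    {B : Fin N → ℝ≥0∞} (hB : ∀ i, B i ≠ ⊤) (hfB : ∀ i, ∫⁻ x, f i x ≤ B i) :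
    ∫⁻ x, ∏ i, (∫⁻ s, f i (Function.update x i s)) ^ (1 / ((N : ℝ) - 1))
      ≤ (N : ℝ≥0∞) ^ ((N : ℝ) / (N - 1)) * ∏ i, B i ^ (1 / ((N : ℝ) - 1)) := by
  have hN1 : (1 : ℝ) < N := by exact_mod_cast hN
  have hN2 : (0 : ℝ) < N - 1 := by linarith
  have hr : 0 ≤ 1 / ((N : ℝ) - 1) := by positivity
  -- Bounds `B i` equal to zero are admitted by adding `1/(n+1)` and letting `n → ∞`.
  have hstep : ∀ n : ℕ, ∫⁻ x, ∏ i, (∫⁻ s, f i (Function.update x i s)) ^ (1 / ((N : ℝ) - 1))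
      ≤ (N : ℝ≥0∞) ^ ((N : ℝ) / (N - 1)) *
        ∏ i, (B i + ((n : ℝ≥0∞) + 1)⁻¹) ^ (1 / ((N : ℝ) - 1)) := fun n =>
    lintegral_prod_lintegral_pow_le_of_pos hN hf (fun i => by simp)
      (fun i => by simp [hB i]) fun i => (hfB i).trans le_self_add
  refine ge_of_tendsto' (x := atTop) ?_ hstep
  have h0 : Tendsto (fun n : ℕ => ((n : ℝ≥0∞) + 1)⁻¹) atTop (𝓝 0) := by
    have := (tendsto_add_atTop_iff_nat 1).2 ENNReal.tendsto_inv_nat_nhds_zero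
    simpa using this
  refine ENNReal.Tendsto.const_mul ?_ (Or.inr ?_)
  · refine ENNReal.tendsto_finsetProd_of_ne_top _ (fun i _ => ?_) fun i _ =>
      ENNReal.rpow_ne_top_of_nonneg hr (hB i)
    refine (ENNReal.continuous_rpow_const.tendsto _).comp ?_
    simpa using tendsto_const_nhds.add h0
  · exact ENNReal.rpow_ne_top_of_nonneg (by positivity) (by simp)

end LoomisWhitney

/-! ### The anisotropic Sobolev inequality with direction-dependent powers -/

section Sobolev

variable {N : ℕ}

theorem rpow_sum_of_nonneg {ι : Type*} (s : Finset ι) {x : ℝ≥0∞} {e : ι → ℝ}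
    (he : ∀ i ∈ s, 0 ≤ e i) : x ^ ∑ i ∈ s, e i = ∏ i ∈ s, x ^ e i := by
  classical
  induction s using Finset.induction with
  | empty => simp
  | insert j s hj ih =>
    rw [Finset.sum_insert hj, Finset.prod_insert hj, ENNReal.rpow_add_of_nonneg _ _
      (he j (Finset.mem_insert_self _ _))
      (Finset.sum_nonneg fun i hi => he i (Finset.mem_insert_of_mem hi)),
      ih fun i hi => he i (Finset.mem_insert_of_mem hi)]

/-- The truncated power `|y|^(a - 1) min(|y|, L)^b`. -/
def truncPow (a b L : ℝ) (y : ℝ) : ℝ := |y| ^ (a - 1) * min |y| L ^ b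

theorem truncPow_nonneg {a b L : ℝ} (hL : 0 ≤ L) (y : ℝ) : 0 ≤ truncPow a b L y := by
  unfold truncPow
  have : 0 ≤ min |y| L := le_min (abs_nonneg _) hL
  positivity

theorem continuous_truncPow {a b L : ℝ} (ha : 1 ≤ a) (hb : 0 ≤ b) :
    Continuous (truncPow a b L) := by
  unfold truncPow
  refine Continuous.mul ?_ ?_
  · exact continuous_abs.rpow_const fun x => Or.inr (by linarith)
  · exact (continuous_abs.min continuous_const).rpow_const fun x => Or.inr hb

/-- Up to `min y L` the integrand is the pure power `t^(a+b-1)`; beyond that point it is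
nonnegative. -/
theorem rpow_min_le_integral_truncPow {a b L y : ℝ} (ha : 1 ≤ a) (hb : 0 ≤ b) (hL : 0 ≤ L)
    (hy : 0 ≤ y) :
    min y L ^ (a + b) / (a + b) ≤ ∫ t in (0 : ℝ)..y, truncPow a b L t := by
  have hm : 0 ≤ min y L := le_min hy hL
  have hc := continuous_truncPow (L := L) ha hb
  have h1 : ∫ t in (0 : ℝ)..min y L, truncPow a b L t = min y L ^ (a + b) / (a + b) := by
    have : ∫ t in (0 : ℝ)..min y L, truncPow a b L t
        = ∫ t in (0 : ℝ)..min y L, t ^ (a + b - 1) := by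
      apply intervalIntegral.integral_congr_ae
      refine Eventually.of_forall fun t ht => ?_
      rw [uIoc_of_le hm] at ht
      have ht0 : 0 < t := ht.1
      rw [truncPow, abs_of_pos ht0, min_eq_left (ht.2.trans (min_le_right _ _)),
        ← Real.rpow_add ht0]
      congr 1
      ring
    rw [this, integral_rpow (Or.inl (by linarith)), Real.zero_rpow (by linarith)]
    simp
  rw [← h1, ← intervalIntegral.integral_add_adjacent_intervals
    (hc.intervalIntegrable 0 (min y L)) (hc.intervalIntegrable (min y L) y)]
  have : 0 ≤ ∫ t in min y L..y, truncPow a b L t :=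
    intervalIntegral.integral_nonneg (min_le_left _ _) fun t _ => truncPow_nonneg hL t
  linarith

/-- The exponent of the anisotropic Sobolev embedding. -/
def sobExp (a : Fin N → ℝ) (P : ℝ) : ℝ := P * (∑ i, a i) / (N - P)

/-- Truncated form of the anisotropic Sobolev inequality. -/
theorem sobolev_trunc (hN : 2 ≤ N) {p a : Fin N → ℝ} {P : ℝ} (hp : ∀ i, 1 < p i)
    (ha : ∀ i, 1 ≤ a i) (hP0 : 0 < P) (hPN : P < N) (hP : ∑ i, 1 / p i = N / P)
    {f : (Fin N → ℝ) → ℝ} {D : Fin N → (Fin N → ℝ) → ℝ} (hf : Measurable f) (hf0 : ∀ x, 0 ≤ f x)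
    (hD : ∀ i, Measurable (D i)) {S : Set (Fin N → ℝ)} (hS : volume S ≠ ⊤)
    (hfS : ∀ x, x ∉ S → f x = 0) {L : ℝ} (hL : 0 ≤ L)
    (hline : ∀ i, ∀ᵐ x, ENNReal.ofReal
        (∫ y in (0 : ℝ)..f x, truncPow (a i) (sobExp a P * (1 - 1 / p i)) L y)
      ≤ ∫⁻ s, ENNReal.ofReal (truncPow (a i) (sobExp a P * (1 - 1 / p i)) L
          (f (Function.update x i s)) * |D i (Function.update x i s)|))
    (hE : ∀ i, ∫⁻ x, ENNReal.ofReal (f x ^ (a i - 1) * |D i x|) ^ p i ≠ ⊤) :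
    (∫⁻ x, ENNReal.ofReal (min (f x) L) ^ sobExp a P) ^ (((N : ℝ) - P) / N)
      ≤ ((∏ i, ENNReal.ofReal (a i + sobExp a P * (1 - 1 / p i)) ^ (1 / ((N : ℝ) - 1))) *
          (N : ℝ≥0∞) ^ ((N : ℝ) / (N - 1))) ^ (((N : ℝ) - 1) * P / N) *
        ∏ i, (∫⁻ x, ENNReal.ofReal (f x ^ (a i - 1) * |D i x|) ^ p i) ^ (P / (N * p i)) := by
  have hN1 : (1 : ℝ) < N := by exact_mod_cast hN
  have hN2 : (0 : ℝ) < N - 1 := by linarith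
  have hNP : 0 < (N : ℝ) - P := by linarith
  have hr : 0 ≤ 1 / ((N : ℝ) - 1) := by positivity
  have hsum : 0 < ∑ i, a i :=
    Finset.sum_pos (fun i _ => lt_of_lt_of_le one_pos (ha i)) ⟨⟨0, by omega⟩, Finset.mem_univ _⟩
  set σ := sobExp a P with hσ
  have hσ0 : 0 < σ := by rw [hσ, sobExp]; positivity
  have hσeq : σ * (N - P) = P * ∑ i, a i := by rw [hσ, sobExp]; field_simp
  set b : Fin N → ℝ := fun i => σ * (1 - 1 / p i) with hb
  have hp0 : ∀ i, 0 < p i := fun i => by linarith [hp i]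
  have hp1 : ∀ i, 0 < 1 - 1 / p i := fun i => by
    have := hp i
    rw [sub_pos, div_lt_one (hp0 i)]; exact this
  have hb0 : ∀ i, 0 < b i := fun i => mul_pos hσ0 (hp1 i)
  have hab : ∀ i, 0 < a i + b i := fun i => by linarith [hb0 i, ha i]
  set E : Fin N → ℝ≥0∞ := fun i => ∫⁻ x, ENNReal.ofReal (f x ^ (a i - 1) * |D i x|) ^ p i with hEdef
  set X : ℝ≥0∞ := ∫⁻ x, ENNReal.ofReal (min (f x) L) ^ σ with hX
  have hm0 : ∀ x, 0 ≤ min (f x) L := fun x => le_min (hf0 x) hL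
  -- Finiteness comes from the truncation at `L` and the finite measure of `S`; without it the power
  -- of `X` on the right could not be divided off below.
  have hXtop : X ≠ ⊤ := by
    have h1 : X ≤ ∫⁻ x, (toMeasurable volume S).indicator (fun _ => ENNReal.ofReal L ^ σ) x := by
      refine lintegral_mono fun x => ?_
      by_cases hx : x ∈ toMeasurable volume S
      · simp only [indicator_of_mem hx]
        gcongr
        exact min_le_right _ _
      · have : f x = 0 := hfS x fun h => hx (subset_toMeasurable _ _ h)
        simp [this, hL, hσ0, hx]
    refine ne_top_of_le_ne_top ?_ h1
    rw [lintegral_indicator (measurableSet_toMeasurable _ _), setLIntegral_const,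
      measure_toMeasurable]
    exact ENNReal.mul_ne_top (by simp [hσ0.le]) hS
  -- Hölder's inequality in each direction
  set B : Fin N → ℝ≥0∞ := fun i => E i ^ (1 / p i) * X ^ (1 - 1 / p i) with hB
  have hBtop : ∀ i, B i ≠ ⊤ := fun i =>
    ENNReal.mul_ne_top (ENNReal.rpow_ne_top_of_nonneg (by have := hp0 i; positivity) (hE i))
      (ENNReal.rpow_ne_top_of_nonneg (hp1 i).le hXtop)
  have hfm : Measurable fun x => min (f x) L := hf.min measurable_const
  have hhold : ∀ i, ∫⁻ x, ENNReal.ofReal (truncPow (a i) (b i) L (f x) * |D i x|) ≤ B i := by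
    intro i
    have hconj : (p i).HolderConjugate (1 - 1 / p i)⁻¹ := by
      rw [Real.holderConjugate_iff]
      refine ⟨hp i, ?_⟩
      rw [inv_inv]
      ring
    have := ENNReal.lintegral_mul_le_Lp_mul_Lq volume hconj
      (f := fun x => ENNReal.ofReal (f x ^ (a i - 1) * |D i x|))
      (g := fun x => ENNReal.ofReal (min (f x) L ^ b i))
      (by have := hD i; fun_prop) (by fun_prop)
    refine le_trans (le_of_eq ?_) (this.trans (le_of_eq ?_))
    · refine lintegral_congr fun x => ?_
      simp only [Pi.mul_apply]
      rw [← ENNReal.ofReal_mul (by have := hf0 x; positivity), truncPow, abs_of_nonneg (hf0 x)]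
      congr 1
      ring
    · rw [hB]
      simp only
      congr 1
      rw [one_div (1 - 1 / p i)⁻¹, inv_inv]
      congr 1
      refine lintegral_congr fun x => ?_
      rw [← ENNReal.ofReal_rpow_of_nonneg (hm0 x) (hb0 i).le, ← ENNReal.rpow_mul]
      congr 1
      rw [hb]
      have := (hp1 i).ne'
      field_simp
  have hfDm : ∀ i, Measurable fun x => ENNReal.ofReal (truncPow (a i) (b i) L (f x) * |D i x|) :=
    fun i => by
      have h1 := (continuous_truncPow (L := L) (ha i) (hb0 i).le).measurable.comp hf
      have := hD i
      simp only [Function.comp_def] at h1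
      fun_prop
  have hLW := lintegral_prod_lintegral_pow_le' hN hfDm hBtop hhold
  -- pointwise lower bound
  set c : ℝ≥0∞ := ∏ i, ENNReal.ofReal (a i + b i) ^ (1 / ((N : ℝ) - 1)) with hc
  -- `σ` is the fixed point of this identity: since `∑ a_i = σ (N - P)/P` and `∑ b_i = σ (N - N/P)`,
  -- the sum of `a_i + b_i` is `σ (N - 1)`. The product of the line bounds therefore controls
  -- exactly the integrand of `X`.
  have hexp : ∑ i, (a i + b i) * (1 / ((N : ℝ) - 1)) = σ := by
    rw [← Finset.sum_mul, Finset.sum_add_distrib, hb, ← Finset.mul_sum, Finset.sum_sub_distrib, hP]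
    have h2 : ∑ i, a i = σ * (N - P) / P := by rw [hσeq]; field_simp
    rw [h2]
    simp
    field_simp
    ring
  have hpt : ∀ᵐ x, ENNReal.ofReal (min (f x) L) ^ σ ≤ c * ∏ i, (∫⁻ s, ENNReal.ofReal
      (truncPow (a i) (b i) L (f (Function.update x i s)) * |D i (Function.update x i s)|)) ^
        (1 / ((N : ℝ) - 1)) := by
    filter_upwards [ae_all_iff.2 hline] with x hx
    rw [hc, ← Finset.prod_mul_distrib, ← hexp,
      rpow_sum_of_nonneg _ fun i _ => mul_nonneg (hab i).le hr]
    refine Finset.prod_le_prod' fun i _ => ?_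
    rw [← ENNReal.mul_rpow_of_nonneg _ _ hr, ENNReal.rpow_mul]
    gcongr
    refine le_trans ?_ (mul_le_mul_right (hx i) _)
    rw [ENNReal.ofReal_rpow_of_nonneg (hm0 x) (hab i).le, ← ENNReal.ofReal_mul (hab i).le]
    refine ENNReal.ofReal_le_ofReal ?_
    have := rpow_min_le_integral_truncPow (ha i) (hb0 i).le hL (hf0 x)
    rw [div_le_iff₀ (hab i)] at this
    linarith
  have hctop : c ≠ ⊤ := ENNReal.prod_ne_top fun i _ =>
    ENNReal.rpow_ne_top_of_nonneg hr ENNReal.ofReal_ne_top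
  set K : ℝ≥0∞ := c * (N : ℝ≥0∞) ^ ((N : ℝ) / (N - 1)) with hK
  have hX1 : X ≤ K * ((∏ i, E i ^ (1 / (p i * ((N : ℝ) - 1)))) *
      X ^ (((N : ℝ) - N / P) / (N - 1))) := by
    calc X ≤ ∫⁻ x, c * ∏ i, (∫⁻ s, ENNReal.ofReal
      (truncPow (a i) (b i) L (f (Function.update x i s)) * |D i (Function.update x i s)|)) ^
        (1 / ((N : ℝ) - 1)) := lintegral_mono_ae hpt
      _ ≤ c * ((N : ℝ≥0∞) ^ ((N : ℝ) / (N - 1)) * ∏ i, B i ^ (1 / ((N : ℝ) - 1))) := by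
        rw [lintegral_const_mul' _ _ hctop]
        gcongr
      _ = _ := by
        rw [hK, mul_assoc]
        congr 2
        have h3 : ((N : ℝ) - N / P) / (N - 1) = ∑ i, (1 - 1 / p i) * (1 / ((N : ℝ) - 1)) := by
          rw [← Finset.sum_mul, Finset.sum_sub_distrib, hP]
          simp
          ring
        rw [h3, rpow_sum_of_nonneg _ fun i _ => mul_nonneg (hp1 i).le hr,
          ← Finset.prod_mul_distrib]
        refine Finset.prod_congr rfl fun i _ => ?_
        rw [hB]
        simp only
        rw [ENNReal.mul_rpow_of_nonneg _ _ hr, ← ENNReal.rpow_mul, ← ENNReal.rpow_mul]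
        congr 2
        have := (hp0 i).ne'
        field_simp
  by_cases hX0 : X = 0
  · rw [hX0, ENNReal.zero_rpow_of_pos (by have : (0:ℝ) < N := by linarith
                                          positivity)]
    exact zero_le
  -- Because `P < N`, the power of `X` on the right of `hX1` is less than one and can be absorbed.
  have hX2 : X ^ (((N : ℝ) / P - 1) / (N - 1)) ≤ K * ∏ i, E i ^ (1 / (p i * ((N : ℝ) - 1))) := by
    have h4 : ((N : ℝ) / P - 1) / (N - 1) = 1 - ((N : ℝ) - N / P) / (N - 1) := by
      field_simp
      ring
    rw [h4, ENNReal.rpow_sub _ _ hX0 hXtop, ENNReal.rpow_one]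
    refine ENNReal.div_le_of_le_mul ?_
    rwa [mul_assoc]
  have hN0 : (0 : ℝ) < N := by linarith
  have hpow : 0 ≤ ((N : ℝ) - 1) * P / N := by positivity
  have hX3 := ENNReal.rpow_le_rpow hX2 hpow
  rw [← ENNReal.rpow_mul, ENNReal.mul_rpow_of_nonneg _ _ hpow,
    ← ENNReal.prod_rpow_of_nonneg hpow] at hX3
  convert hX3 using 2
  · field_simp
  · refine Finset.prod_congr rfl fun i _ => ?_
    rw [← ENNReal.rpow_mul]
    congr 1
    have := (hp0 i).ne'
    field_simp

/-- The constant in the anisotropic Sobolev inequality. -/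
def sobConst (p a : Fin N → ℝ) (P : ℝ) : ℝ≥0∞ :=
  ((∏ i, ENNReal.ofReal (a i + sobExp a P * (1 - 1 / p i)) ^ (1 / ((N : ℝ) - 1))) *
    (N : ℝ≥0∞) ^ ((N : ℝ) / (N - 1))) ^ (((N : ℝ) - 1) * P / N)

theorem sobConst_ne_top (hN : 2 ≤ N) (p a : Fin N → ℝ) {P : ℝ} (hP0 : 0 < P) :
    sobConst p a P ≠ ⊤ := by
  have hN1 : (1 : ℝ) < N := by exact_mod_cast hN
  have hN2 : (0 : ℝ) < N - 1 := by linarith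
  refine ENNReal.rpow_ne_top_of_nonneg (by positivity) (ENNReal.mul_ne_top ?_ ?_)
  · exact ENNReal.prod_ne_top fun i _ =>
      ENNReal.rpow_ne_top_of_nonneg (by positivity) ENNReal.ofReal_ne_top
  · exact ENNReal.rpow_ne_top_of_nonneg (by positivity) (by simp)

/-- The anisotropic Sobolev inequality with different powers of the function in the different
directions, for functions controlled along lines. -/
theorem sobolev_of_lines (hN : 2 ≤ N) {p a : Fin N → ℝ} {P : ℝ} (hp : ∀ i, 1 < p i)
    (ha : ∀ i, 1 ≤ a i) (hP0 : 0 < P) (hPN : P < N) (hP : ∑ i, 1 / p i = N / P)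
    {f : (Fin N → ℝ) → ℝ} {D : Fin N → (Fin N → ℝ) → ℝ} (hf : Measurable f) (hf0 : ∀ x, 0 ≤ f x)
    (hD : ∀ i, Measurable (D i)) {S : Set (Fin N → ℝ)} (hS : volume S ≠ ⊤)
    (hfS : ∀ x, x ∉ S → f x = 0)
    (hline : ∀ L : ℕ, ∀ i, ∀ᵐ x, ENNReal.ofReal
        (∫ y in (0 : ℝ)..f x, truncPow (a i) (sobExp a P * (1 - 1 / p i)) L y)
      ≤ ∫⁻ s, ENNReal.ofReal (truncPow (a i) (sobExp a P * (1 - 1 / p i)) L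
          (f (Function.update x i s)) * |D i (Function.update x i s)|))
    (hE : ∀ i, ∫⁻ x, ENNReal.ofReal (f x ^ (a i - 1) * |D i x|) ^ p i ≠ ⊤) :
    (∫⁻ x, ENNReal.ofReal (f x) ^ sobExp a P) ^ (((N : ℝ) - P) / N)
      ≤ sobConst p a P *
        ∏ i, (∫⁻ x, ENNReal.ofReal (f x ^ (a i - 1) * |D i x|) ^ p i) ^ (P / (N * p i)) := by
  have hNP : 0 < (N : ℝ) - P := by linarith
  have hσ0 : 0 ≤ sobExp a P := by
    have : 0 ≤ ∑ i, a i := Finset.sum_nonneg fun i _ => by linarith [ha i]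
    rw [sobExp]
    positivity
  have hstep : ∀ L : ℕ, _ := fun L =>
    sobolev_trunc hN hp ha hP0 hPN hP hf hf0 hD hS hfS L.cast_nonneg (hline L) hE
  refine le_of_tendsto' (x := atTop) ?_ hstep
  -- The constant does not depend on the truncation, so monotone convergence removes it.
  refine (ENNReal.continuous_rpow_const.tendsto _).comp ?_
  refine lintegral_tendsto_of_tendsto_of_monotone
    (fun L => by fun_prop) (Eventually.of_forall fun x => ?_)
    (Eventually.of_forall fun x => ?_)
  · intro L L' hL
    have : (L : ℝ) ≤ L' := by exact_mod_cast hL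
    simp only
    gcongr
  · refine tendsto_const_nhds.congr' ?_
    obtain ⟨n, hn⟩ := exists_nat_ge (f x)
    filter_upwards [eventually_ge_atTop n] with L hL
    rw [min_eq_left]
    exact hn.trans (by exact_mod_cast hL)

end Sobolev

/-! ### The Sobolev inequality on almost every time slice -/

section Slices

variable {N : ℕ}

/-- The space-time direction of the `i`-th space coordinate. -/
def spaceDir (i : Fin N) : SpaceTime N := (Pi.single i 1, 0)

theorem spaceDir_ne_zero (i : Fin N) : spaceDir i ≠ 0 := by
  intro h
  have := congrFun (congrArg Prod.fst h) i
  simp [spaceDir] at this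

instance : (volume : Measure (SpaceTime N)).IsAddHaarMeasure :=
  inferInstanceAs (Measure.IsAddHaarMeasure
    ((volume : Measure (Fin N → ℝ)).prod (volume : Measure ℝ)))

theorem lintegral_line_eq_update (g : SpaceTime N → ℝ≥0∞) (x : Fin N → ℝ) (t : ℝ) (i : Fin N) :
    ∫⁻ s : ℝ, g ((x, t) + s • spaceDir i) = ∫⁻ s : ℝ, g (Function.update x i s, t) := by
  rw [← lintegral_add_right_eq_self (fun s => g (Function.update x i s, t)) (x i)]
  refine lintegral_congr fun s => ?_
  congr 1
  ext j
  · by_cases h : j = i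
    · subst h
      simp [spaceDir, add_comm]
    · simp [spaceDir, h]
  · simp [spaceDir]

theorem ae_swap {P : SpaceTime N → Prop} (h : ∀ᵐ z, P z) :
    ∀ᵐ t : ℝ, ∀ᵐ x : Fin N → ℝ, P (x, t) := by
  have h2 := (Measure.measurePreserving_swap (μ := (volume : Measure ℝ))
    (ν := (volume : Measure (Fin N → ℝ)))).quasiMeasurePreserving.ae h
  exact Measure.ae_ae_of_ae_prod h2

/-- Lines in spatial directions remain inside a time slice, so the line bound at almost every
space-time point yields, for almost every `t`, the hypothesis of `sobolev_of_lines` on the slice.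
Truncation levels run over the natural numbers so that one null set of times serves them all. -/
theorem sobolev_slices_global (hN : 2 ≤ N) {p a : Fin N → ℝ} {P : ℝ} (hp : ∀ i, 1 < p i)
    (ha : ∀ i, 1 ≤ a i) (hP0 : 0 < P) (hPN : P < N) (hP : ∑ i, 1 / p i = N / P)
    {F : SpaceTime N → ℝ} {D : Fin N → SpaceTime N → ℝ} (hFm : Measurable F) (hF0 : ∀ z, 0 ≤ F z)
    (hDm : ∀ i, Measurable (D i)) (hF : Integrable F) (hD : ∀ i, Integrable (D i))
    (hFD : ∀ i, HasGlobalWeakDeriv volume (spaceDir i) F (D i)) {R : ℝ}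
    (hFR : ∀ z, R < ‖z‖ → F z = 0) (hDR : ∀ i z, R < ‖z‖ → D i z = 0) :
    ∀ᵐ t : ℝ, (∀ i, ∫⁻ x, ENNReal.ofReal (F (x, t) ^ (a i - 1) * |D i (x, t)|) ^ p i ≠ ⊤) →
      (∫⁻ x, ENNReal.ofReal (F (x, t)) ^ sobExp a P) ^ (((N : ℝ) - P) / N)
        ≤ sobConst p a P *
          ∏ i, (∫⁻ x, ENNReal.ofReal (F (x, t) ^ (a i - 1) * |D i (x, t)|) ^ p i)
            ^ (P / (N * p i)) := by
  have hNP : 0 < (N : ℝ) - P := by linarith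
  have hσ0 : 0 ≤ sobExp a P := by
    have : 0 ≤ ∑ i, a i := Finset.sum_nonneg fun i _ => by linarith [ha i]
    rw [sobExp]
    positivity
  have hb : ∀ i, 0 ≤ sobExp a P * (1 - 1 / p i) := fun i => by
    have h1 := hp i
    have : 1 / p i ≤ 1 := by rw [div_le_one (by linarith)]; exact h1.le
    exact mul_nonneg hσ0 (by linarith)
  have hl : ∀ᵐ t : ℝ, ∀ L : ℕ, ∀ i, ∀ᵐ x : Fin N → ℝ, ENNReal.ofReal
        (∫ y in (0 : ℝ)..F (x, t), truncPow (a i) (sobExp a P * (1 - 1 / p i)) L y)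
      ≤ ∫⁻ s, ENNReal.ofReal (truncPow (a i) (sobExp a P * (1 - 1 / p i)) L
          (F (Function.update x i s, t)) * |D i (Function.update x i s, t)|) := by
    rw [ae_all_iff]
    intro L
    rw [ae_all_iff]
    intro i
    have := ae_line_bound (spaceDir_ne_zero i) hF (hD i) (hFD i) hFR (hDR i)
      (continuous_truncPow (L := L) (ha i) (hb i)) (truncPow_nonneg L.cast_nonneg)
    filter_upwards [ae_swap this] with t ht
    filter_upwards [ht] with x hx
    refine hx.trans (le_of_eq ?_)
    exact lintegral_line_eq_update (fun z => ENNReal.ofReal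
      (truncPow (a i) (sobExp a P * (1 - 1 / p i)) L (F z) * |D i z|)) x t i
  filter_upwards [hl] with t ht hE
  refine sobolev_of_lines hN hp ha hP0 hPN hP (f := fun x => F (x, t))
    (D := fun i x => D i (x, t)) (by fun_prop) (fun x => hF0 _)
    (fun i => by have := hDm i; fun_prop) (S := Metric.closedBall 0 R)
    (measure_closedBall_lt_top).ne (fun x hx => hFR _ ?_) ht hE
  rw [mem_closedBall_zero_iff, not_le] at hx
  exact hx.trans_le (norm_fst_le (x, t))

/-- Product rule for the weak derivative of a localized function. -/
theorem HasWeakSpaceDeriv.localize {U : Set (SpaceTime N)} {i : Fin N}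
    {f v f' v' ψ : SpaceTime N → ℝ} (h : HasWeakSpaceDeriv U i f v)
    (hf : f' =ᵐ[volume.restrict U] f) (hv : v' =ᵐ[volume.restrict U] v) (hU : MeasurableSet U)
    (hψ : ContDiff ℝ ∞ ψ) (hψc : HasCompactSupport ψ) (hψU : tsupport ψ ⊆ U) :
    Integrable (fun z => ψ z * f' z) ∧
    Integrable (fun z => ψ z * v' z + spaceDeriv i ψ z * f' z) ∧
    HasGlobalWeakDeriv volume (spaceDir i) (fun z => ψ z * f' z)
      (fun z => ψ z * v' z + spaceDeriv i ψ z * f' z) := by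
  obtain ⟨hfl, hvl, hw⟩ := h
  have hdψ : Continuous (spaceDeriv i ψ) :=
    (hψ.continuous_fderiv (by simp)).clm_apply continuous_const
  have hdψs : ∀ z, z ∉ tsupport ψ → spaceDeriv i ψ z = 0 := by
    intro z hz
    have : fderiv ℝ ψ z = 0 := by
      by_contra hne
      exact hz (support_fderiv_subset ℝ hne)
    simp [spaceDeriv, this]
  have hψs : ∀ z, z ∉ tsupport ψ → ψ z = 0 := fun z hz => image_eq_zero_of_notMem_tsupport hz
  have hint : ∀ {g η : SpaceTime N → ℝ}, LocallyIntegrableOn g U → Continuous η →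
      (∀ z, z ∉ tsupport ψ → η z = 0) → Integrable (fun z => η z * g z) := by
    intro g η hg hη hηs
    have h1 : IntegrableOn g (tsupport ψ) := hg.integrableOn_compact_subset hψU hψc
    have h2 : IntegrableOn (fun z => η z * g z) (tsupport ψ) :=
      h1.continuousOn_mul hη.continuousOn hψc
    exact h2.integrable_of_forall_notMem_eq_zero fun z hz => by simp [hηs z hz]
  have hcongr : ∀ {g g' η : SpaceTime N → ℝ}, g' =ᵐ[volume.restrict U] g →
      (∀ z, z ∉ tsupport ψ → η z = 0) → (fun z => η z * g z) =ᵐ[volume] fun z => η z * g' z := by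
    intro g g' η hg hηs
    filter_upwards [(ae_restrict_iff' hU).1 hg] with z hz
    by_cases hzU : z ∈ U
    · rw [hz hzU]
    · simp [hηs z fun h => hzU (hψU h)]
  have c1 := hcongr hf hψs
  have c2 := hcongr hv hψs
  have c3 := hcongr hf hdψs
  have c4 : (fun z => ψ z * v z + spaceDeriv i ψ z * f z) =ᵐ[volume]
      fun z => ψ z * v' z + spaceDeriv i ψ z * f' z := c2.add c3
  refine ⟨(hint hfl hψ.continuous hψs).congr c1,
    ((hint hvl hψ.continuous hψs).add (hint hfl hdψ hdψs)).congr c4, ?_⟩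
  intro φ hφ hφc
  have e1 : ∫ z, (fun z => ψ z * f' z) z * fderiv ℝ φ z (spaceDir i)
      = ∫ z, ψ z * f z * fderiv ℝ φ z (spaceDir i) := by
    refine integral_congr_ae ?_
    filter_upwards [c1] with z hz
    rw [← hz]
  have e2 : ∫ z, (ψ z * v' z + spaceDeriv i ψ z * f' z) * φ z
      = ∫ z, (ψ z * v z + spaceDeriv i ψ z * f z) * φ z := by
    refine integral_congr_ae ?_
    filter_upwards [c4] with z hz
    rw [← hz]
  rw [e1, e2]
  have hdφ : Continuous fun z => fderiv ℝ φ z (spaceDir i) :=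
    (hφ.continuous_fderiv (by simp)).clm_apply continuous_const
  -- The weak derivative of `f` is tested with `ψ φ`, whose support lies in `U` for arbitrary `φ`;
  -- the Leibniz rule then separates the two terms.
  have hψφ := hw (fun z => ψ z * φ z) (hψ.mul hφ) hψc.mul_right
    ((tsupport_mul_subset_left).trans hψU)
  have hder : ∀ z, spaceDeriv i (fun z => ψ z * φ z) z
      = ψ z * fderiv ℝ φ z (spaceDir i) + φ z * spaceDeriv i ψ z := by
    intro z
    have h1 : DifferentiableAt ℝ ψ z := (hψ.differentiable (by simp)).differentiableAt
    have h2 : DifferentiableAt ℝ φ z := (hφ.differentiable (by simp)).differentiableAt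
    rw [spaceDeriv, fderiv_fun_mul h1 h2]
    simp [spaceDeriv, spaceDir]
  rw [setIntegral_eq_integral_of_forall_compl_eq_zero, 
    setIntegral_eq_integral_of_forall_compl_eq_zero] at hψφ
  rotate_left
  · intro z hz
    simp [hψs z fun h => hz (hψU h)]
  · intro z hz
    rw [hder, hψs z fun h => hz (hψU h), hdψs z fun h => hz (hψU h)]
    simp
  have i1 : Integrable fun z => ψ z * f z * fderiv ℝ φ z (spaceDir i) := by
    have := hint hfl (hψ.continuous.mul hdφ) fun z hz => by simp [hψs z hz]
    refine this.congr (Eventually.of_forall fun z => ?_)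
    simp only [Pi.mul_apply]
    ring
  have i2 : Integrable fun z => spaceDeriv i ψ z * f z * φ z := by
    have := hint hfl (hdψ.mul hφ.continuous) fun z hz => by simp [hdψs z hz]
    refine this.congr (Eventually.of_forall fun z => ?_)
    simp only [Pi.mul_apply]
    ring
  have i3 : Integrable fun z => ψ z * v z * φ z := by
    have := hint hvl (hψ.continuous.mul hφ.continuous) fun z hz => by simp [hψs z hz]
    refine this.congr (Eventually.of_forall fun z => ?_)
    simp only [Pi.mul_apply]
    ring
  have e3 : ∀ z, f z * spaceDeriv i (fun z => ψ z * φ z) z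
      = ψ z * f z * fderiv ℝ φ z (spaceDir i) + spaceDeriv i ψ z * f z * φ z := fun z => by
    rw [hder]; ring
  have e4 : ∀ z, (ψ z * v z + spaceDeriv i ψ z * f z) * φ z
      = ψ z * v z * φ z + spaceDeriv i ψ z * f z * φ z := fun z => by ring
  have e5 : ∀ z, v z * (ψ z * φ z) = ψ z * v z * φ z := fun z => by ring
  simp_rw [e3, e5] at hψφ
  simp_rw [e4]
  rw [integral_add i1 i2] at hψφ
  rw [integral_add i3 i2]
  linarith

/-- Smooth time cutoffs exhausting `(0, T)`. -/
theorem exists_time_cutoff {T δ : ℝ} (hδ : 0 < δ) :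
    ∃ χ : ℝ → ℝ, ContDiff ℝ ∞ χ ∧ (∀ t, 0 ≤ χ t) ∧ (∀ t ∈ Icc (2 * δ) (T - 2 * δ), χ t = 1) ∧
      ∀ t, t ∉ Icc δ (T - δ) → χ t = 0 := by
  refine ⟨fun t => Real.smoothTransition ((t - δ) / δ) * Real.smoothTransition ((T - δ - t) / δ),
    ?_, fun t => mul_nonneg (Real.smoothTransition.nonneg _) (Real.smoothTransition.nonneg _),
    fun t ht => ?_, fun t ht => ?_⟩
  · exact (Real.smoothTransition.contDiff.comp (by fun_prop)).mul
      (Real.smoothTransition.contDiff.comp (by fun_prop))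
  · simp only
    rw [Real.smoothTransition.one_of_one_le, Real.smoothTransition.one_of_one_le, one_mul]
    · rw [le_div_iff₀ hδ]; linarith [ht.2]
    · rw [le_div_iff₀ hδ]; linarith [ht.1]
  · simp only
    rw [mem_Icc, not_and_or, not_le, not_le] at ht
    rcases ht with h | h
    · rw [Real.smoothTransition.zero_of_nonpos (x := (t - δ) / δ)
        (div_nonpos_of_nonpos_of_nonneg (by linarith) hδ.le),
        zero_mul]
    · rw [Real.smoothTransition.zero_of_nonpos (x := (T - δ - t) / δ)
        (div_nonpos_of_nonpos_of_nonneg (by linarith) hδ.le), mul_zero]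

/-- The anisotropic Sobolev inequality on almost every time slice, for the product of a weakly
differentiable function and a cutoff in space. -/
theorem sobolev_slices (hN : 2 ≤ N) {p a : Fin N → ℝ} {P : ℝ} (hp : ∀ i, 1 < p i)
    (ha : ∀ i, 1 ≤ a i) (hP0 : 0 < P) (hPN : P < N) (hP : ∑ i, 1 / p i = N / P)
    {Ω : Set (Fin N → ℝ)} {T : ℝ} (hΩ : IsOpen Ω) {f f' : SpaceTime N → ℝ}
    {v v' : Fin N → SpaceTime N → ℝ} (h : ∀ i, HasWeakSpaceDeriv (Ω ×ˢ Ioo 0 T) i f (v i))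
    (hff' : f' =ᵐ[volume.restrict (Ω ×ˢ Ioo 0 T)] f)
    (hvv' : ∀ i, v' i =ᵐ[volume.restrict (Ω ×ˢ Ioo 0 T)] v i)
    (hf'm : Measurable f') (hf'0 : ∀ z, 0 ≤ f' z) (hv'm : ∀ i, Measurable (v' i))
    {ψ : SpaceTime N → ℝ} (hψ : ContDiff ℝ ∞ ψ) (hψ0 : ∀ z, 0 ≤ ψ z) {K : Set (Fin N → ℝ)}
    (hK : IsCompact K) (hKΩ : K ⊆ Ω) (hψK : ∀ z : SpaceTime N, z.1 ∉ K → ψ z = 0) :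
    ∀ᵐ t : ℝ, t ∈ Ioo 0 T →
      (∀ i, ∫⁻ x, ENNReal.ofReal ((ψ (x, t) * f' (x, t)) ^ (a i - 1) *
        |ψ (x, t) * v' i (x, t) + spaceDeriv i ψ (x, t) * f' (x, t)|) ^ p i ≠ ⊤) →
      (∫⁻ x, ENNReal.ofReal (ψ (x, t) * f' (x, t)) ^ sobExp a P) ^ (((N : ℝ) - P) / N)
        ≤ sobConst p a P *
          ∏ i, (∫⁻ x, ENNReal.ofReal ((ψ (x, t) * f' (x, t)) ^ (a i - 1) *
            |ψ (x, t) * v' i (x, t) + spaceDeriv i ψ (x, t) * f' (x, t)|) ^ p i)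
            ^ (P / (N * p i)) := by
  have hU : MeasurableSet (Ω ×ˢ Ioo 0 T) := hΩ.measurableSet.prod measurableSet_Ioo
  -- The cutoff `ψ` need not be compactly supported in time. It is multiplied by a function of `t`
  -- alone that equals one on `[2δ, T - 2δ]` and so changes nothing on these slices; countably many
  -- `δ` exhaust `(0, T)`.
  have hmain : ∀ n : ℕ, ∀ᵐ t : ℝ, t ∈ Icc (2 * (1 / ((n : ℝ) + 1))) (T - 2 * (1 / ((n : ℝ) + 1))) →
      (∀ i, ∫⁻ x, ENNReal.ofReal ((ψ (x, t) * f' (x, t)) ^ (a i - 1) *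
        |ψ (x, t) * v' i (x, t) + spaceDeriv i ψ (x, t) * f' (x, t)|) ^ p i ≠ ⊤) →
      (∫⁻ x, ENNReal.ofReal (ψ (x, t) * f' (x, t)) ^ sobExp a P) ^ (((N : ℝ) - P) / N)
        ≤ sobConst p a P *
          ∏ i, (∫⁻ x, ENNReal.ofReal ((ψ (x, t) * f' (x, t)) ^ (a i - 1) *
            |ψ (x, t) * v' i (x, t) + spaceDeriv i ψ (x, t) * f' (x, t)|) ^ p i)
            ^ (P / (N * p i)) := by
    intro n
    have hδ : 0 < 1 / ((n : ℝ) + 1) := by positivity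
    obtain ⟨χ, hχ, hχ0, hχ1, hχs⟩ := exists_time_cutoff (T := T) hδ
    set δ := 1 / ((n : ℝ) + 1)
    set Ψ : SpaceTime N → ℝ := fun z => χ z.2 * ψ z with hΨ
    have hχs2 : ContDiff ℝ ∞ fun z : SpaceTime N => χ z.2 := hχ.comp contDiff_snd
    have hΨs : ContDiff ℝ ∞ Ψ := hχs2.mul hψ
    have hcomp : IsCompact (K ×ˢ Icc δ (T - δ)) := hK.prod isCompact_Icc
    have hsupp : ∀ z, z ∉ K ×ˢ Icc δ (T - δ) → Ψ z = 0 := by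
      intro z hz
      rw [mem_prod, not_and_or] at hz
      rcases hz with hz | hz
      · simp [hΨ, hψK z hz]
      · simp [hΨ, hχs _ hz]
    have hts : tsupport Ψ ⊆ K ×ˢ Icc δ (T - δ) :=
      closure_minimal (fun z hz => by_contra fun hn => hz (hsupp z hn)) hcomp.isClosed
    have hΨc : HasCompactSupport Ψ := HasCompactSupport.of_support_subset_isCompact hcomp
      ((subset_tsupport Ψ).trans hts)
    have hΨU : tsupport Ψ ⊆ Ω ×ˢ Ioo 0 T := hts.trans (prod_mono hKΩ fun t ht =>
      ⟨hδ.trans_le ht.1, ht.2.trans_lt (by linarith)⟩)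
    have hder : ∀ i z, spaceDeriv i Ψ z = χ z.2 * spaceDeriv i ψ z := by
      intro i z
      have h1 : DifferentiableAt ℝ (fun z : SpaceTime N => χ z.2) z :=
        (hχs2.differentiable (by simp)).differentiableAt
      have h2 : DifferentiableAt ℝ ψ z := (hψ.differentiable (by simp)).differentiableAt
      have h3 : fderiv ℝ (fun z : SpaceTime N => χ z.2) z (Pi.single i 1, 0) = 0 := by
        have h4 : DifferentiableAt ℝ χ z.2 := (hχ.differentiable (by simp)).differentiableAt
        have := (h4.hasFDerivAt.comp z (hasFDerivAt_snd (𝕜 := ℝ) (p := z))).fderiv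
        rw [Function.comp_def] at this
        rw [this]
        simp
      rw [spaceDeriv, hΨ, fderiv_fun_mul h1 h2]
      simp [h3, spaceDeriv]
    have hloc := fun i => (h i).localize hff' (hvv' i) hU hΨs hΨc hΨU
    obtain ⟨R, hR⟩ := hcomp.isBounded.exists_norm_le
    have hout : ∀ z, R < ‖z‖ → z ∉ K ×ˢ Icc δ (T - δ) := fun z hz hm =>
      absurd (hR z hm) (not_le.2 hz)
    have hcd : ∀ i, Continuous (spaceDeriv i Ψ) := fun i =>
      (hΨs.continuous_fderiv (by simp)).clm_apply continuous_const
    have hΨm : Measurable Ψ := hΨs.continuous.measurable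
    have := sobolev_slices_global hN hp ha hP0 hPN hP (F := fun z => Ψ z * f' z)
      (D := fun i z => Ψ z * v' i z + spaceDeriv i Ψ z * f' z)
      (by fun_prop) (fun z => mul_nonneg (mul_nonneg (hχ0 _) (hψ0 _)) (hf'0 _))
      (fun i => by
        have := (hcd i).measurable
        have := hv'm i
        fun_prop) (hloc ⟨0, by omega⟩).1 (fun i => (hloc i).2.1) (fun i => (hloc i).2.2)
      (R := R) (fun z hz => by simp [hsupp z (hout z hz)])
      (fun i z hz => by
        have h1 : z ∉ tsupport Ψ := fun hm => hout z hz (hts hm)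
        have h2 : fderiv ℝ Ψ z = 0 := by
          by_contra hne
          exact h1 (support_fderiv_subset ℝ hne)
        simp [hsupp z (hout z hz), spaceDeriv, h2])
    filter_upwards [this] with t ht htm
    have hΨt : ∀ x, Ψ (x, t) = ψ (x, t) := fun x => by simp [hΨ, hχ1 t htm]
    have hdt : ∀ i x, spaceDeriv i Ψ (x, t) = spaceDeriv i ψ (x, t) := fun i x => by
      simp [hder, hχ1 t htm]
    simpa only [hdt, hΨt] using ht
  filter_upwards [ae_all_iff.2 hmain] with t ht htm
  have hm : 0 < min t (T - t) := lt_min htm.1 (by linarith [htm.2])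
  obtain ⟨n, hn⟩ := exists_nat_one_div_lt (half_pos hm)
  have h1 := min_le_left t (T - t)
  have h2 := min_le_right t (T - t)
  exact ht n ⟨by linarith, by linarith⟩

end Slices

/-! ### Arithmetic of the exponents -/

namespace Exponents

variable {N : ℕ} {d : Exponents N}

/-- The powers of `(u^m - k^m)_+` controlled in the `i`-th direction. -/
def aExp (d : Exponents N) (i : Fin N) : ℝ :=
  1 + (d.m i - d.mMin) * (d.p i - 1) / (d.mMin * d.p i)

/-- All `1/p_i` are at most one, so the harmonic mean is at least one, and it is less than `N`. For
`N = 0` the mean is `0` by the conventions for division, which contradicts `p < N`. -/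
theorem Admissible.one_lt (hd : d.Admissible) : 1 < N := by
  rcases Nat.eq_zero_or_pos N with h0 | h0
  · have := hd.pMean_lt
    subst h0
    simp [pMean] at this
  · have hN : (0 : ℝ) < N := by exact_mod_cast h0
    have h1 : ∑ i, 1 / d.p i ≤ N := by
      calc ∑ i, 1 / d.p i ≤ ∑ _i : Fin N, (1 : ℝ) := Finset.sum_le_sum fun i _ => by
            have := hd.one_lt_p i
            rw [div_le_one (by linarith)]
            exact this.le
        _ = N := by simp
    have h2 : 0 < ∑ i, 1 / d.p i := Finset.sum_pos (fun i _ => by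
      have := hd.one_lt_p i
      have : 0 < d.p i := by linarith
      positivity) ⟨⟨0, h0⟩, Finset.mem_univ _⟩
    have h3 : 1 ≤ d.pMean := by
      rw [pMean, one_le_inv₀ (by positivity)]
      rw [one_div_mul_eq_div, div_le_one hN]
      exact h1
    have := hd.pMean_lt
    exact_mod_cast lt_of_le_of_lt h3 this

theorem Admissible.nonempty (hd : d.Admissible) : Nonempty (Fin N) :=
  ⟨⟨0, by have := hd.one_lt; omega⟩⟩

theorem Admissible.p_pos (hd : d.Admissible) (i : Fin N) : 0 < d.p i := by
  linarith [hd.one_lt_p i]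

theorem Admissible.one_lt_q (hd : d.Admissible) (i : Fin N) : 1 < d.q i :=
  (hd.one_lt_p i).trans_le (hd.p_le_q i)

theorem Admissible.sum_inv_p_pos (hd : d.Admissible) : 0 < ∑ i, 1 / d.p i := by
  have := hd.nonempty
  exact Finset.sum_pos (fun i _ => by have := hd.p_pos i; positivity) Finset.univ_nonempty

theorem Admissible.cast_pos (hd : d.Admissible) : (0 : ℝ) < N := by
  have := hd.one_lt
  exact_mod_cast (by omega : 0 < N)

theorem Admissible.pMean_pos (hd : d.Admissible) : 0 < d.pMean := by
  have := hd.sum_inv_p_pos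
  have := hd.cast_pos
  rw [pMean]
  positivity

theorem Admissible.sum_inv_p (hd : d.Admissible) : ∑ i, 1 / d.p i = N / d.pMean := by
  have := hd.cast_pos
  rw [pMean]
  field_simp

theorem mMin_le (i : Fin N) : d.mMin ≤ min (d.m i) (d.n i) :=
  ciInf_le (Set.finite_range _).bddBelow i

theorem Admissible.mMin_pos (hd : d.Admissible) : 0 < d.mMin := by
  have := hd.nonempty
  obtain ⟨i, hi⟩ := exists_eq_ciInf_of_finite (f := fun i => min (d.m i) (d.n i))
  rw [mMin, ← hi]
  exact lt_min (hd.m_pos i) (hd.n_pos i)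

theorem q_le_qMax (i : Fin N) : d.q i ≤ d.qMax := le_ciSup (Set.finite_range _).bddAbove i

theorem Admissible.one_lt_qMax (hd : d.Admissible) : 1 < d.qMax := by
  obtain ⟨i⟩ := hd.nonempty
  exact (hd.one_lt_q i).trans_le (q_le_qMax i)

theorem Lam_le_LamMax (i : Fin N) : d.Lam i ≤ d.LamMax := le_ciSup (Set.finite_range _).bddAbove i

theorem Admissible.exists_Lam_eq (hd : d.Admissible) : ∃ i, d.Lam i = d.LamMax := by
  have := hd.nonempty
  exact exists_eq_ciSup_of_finite (f := d.Lam)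

theorem Lam_le_calL (i : Fin N) : d.Lam i ≤ d.calL := (Lam_le_LamMax i).trans (le_max_right _ _)

theorem Admissible.lam_le_calL (hd : d.Admissible) (i : Fin N) : d.lam i ≤ d.calL :=
  (hd.lam_le_Lam i).trans (Lam_le_calL i)

theorem one_le_calL : 1 ≤ d.calL := le_max_left _ _

theorem Admissible.one_le_aExp (hd : d.Admissible) (i : Fin N) : 1 ≤ d.aExp i := by
  have h1 := (mMin_le (d := d) i).trans (min_le_left _ _)
  have h2 := hd.one_lt_p i
  have h3 := hd.p_pos i
  have h4 := hd.mMin_pos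
  have : 0 ≤ (d.m i - d.mMin) * (d.p i - 1) :=
    mul_nonneg (by linarith) (by linarith)
  rw [aExp]
  have : 0 ≤ (d.m i - d.mMin) * (d.p i - 1) / (d.mMin * d.p i) := by positivity
  linarith

/-- Thus `(u^m)^(a_i)` is the power `u^((λ_i + m)/p_i)` whose weak derivative occurs in the
definition of the class. -/
theorem Admissible.mMin_mul_aExp (hd : d.Admissible) (i : Fin N) :
    d.mMin * d.aExp i = (d.lam i + d.mMin) / d.p i := by
  have h3 := (hd.p_pos i).ne'
  have h4 := hd.mMin_pos.ne'
  rw [aExp, lam]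
  field_simp
  ring

/-- This identity identifies `𝓜` as the interpolation exponent: `u^(m+𝓜)` factors into
`(u^m)^(σ(N-p)/N)`, controlled by the Sobolev inequality, and `(u^(m+1))^(p/N)`, controlled by the
supremum in time. -/
theorem Admissible.mMin_add_calM (hd : d.Admissible) :
    d.mMin + d.calM = d.mMin * (sobExp d.aExp d.pMean * (((N : ℝ) - d.pMean) / N)) +
      (d.mMin + 1) * (d.pMean / N) := by
  have h1 := hd.cast_pos
  have h2 := hd.pMean_lt
  have h3 : (N : ℝ) - d.pMean ≠ 0 := by linarith
  have h4 := hd.pMean_pos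
  have h5 : d.mMin * ∑ i, d.aExp i = ∑ i, d.lam i / d.p i + d.mMin * (N / d.pMean) := by
    rw [← hd.sum_inv_p, Finset.mul_sum, Finset.mul_sum, ← Finset.sum_add_distrib]
    refine Finset.sum_congr rfl fun i _ => ?_
    rw [hd.mMin_mul_aExp]
    ring
  have h6 : ∑ i, d.lam i / d.p i = d.mMin * ∑ i, d.aExp i - d.mMin * (N / d.pMean) := by linarith
  rw [calM, lamOverP, h6, sobExp]
  field_simp
  ring

end Exponents

/-! ### Two-sided bounds for the energy density `g` -/

section GFun

theorem gFun_eq_zero {m a b : ℝ} (hab : a ≤ b) : gFun m a b = 0 := by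
  rw [gFun, intervalIntegral.integral_symm, intervalIntegral.integral_congr_ae (g := fun _ => 0)]
  · simp
  · refine Eventually.of_forall fun z hz => ?_
    rw [uIoc_of_le hab] at hz
    rw [max_eq_right (by linarith [hz.2]), mul_zero]

theorem gFun_nonneg {m a b : ℝ} (hm : 0 < m) (hb : 0 ≤ b) : 0 ≤ gFun m a b := by
  rcases le_total a b with h | h
  · rw [gFun_eq_zero h]
  · refine mul_nonneg (by positivity) (intervalIntegral.integral_nonneg h fun z hz => ?_)
    have : 0 ≤ z := hb.trans hz.1
    positivity

theorem gFun_le {m a b : ℝ} (hm : 0 < m) (hb : 0 ≤ b) (hab : b ≤ a) :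
    gFun m a b ≤ (1 / m) * a ^ (1 / m + 1) := by
  have ha : 0 ≤ a := hb.trans hab
  rw [gFun]
  gcongr
  refine (le_abs_self _).trans ?_
  rw [← Real.norm_eq_abs]
  have h1 : ∀ z ∈ uIoc b a, ‖z ^ (1 / m - 1) * max (z - b) 0‖ ≤ a ^ (1 / m) := by
    intro z hz
    rw [uIoc_of_le hab] at hz
    have hz0 : 0 < z := lt_of_le_of_lt hb hz.1
    have h2 : 0 ≤ z - b := by linarith [hz.1]
    rw [max_eq_left h2, Real.norm_eq_abs, abs_of_nonneg (by positivity)]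
    calc z ^ (1 / m - 1) * (z - b) ≤ z ^ (1 / m - 1) * z := by gcongr; linarith
      _ = z ^ (1 / m) := by
          rw [← Real.rpow_add_one hz0.ne']
          congr 1
          ring
      _ ≤ a ^ (1 / m) := by
          gcongr
          exact hz.2
  refine (intervalIntegral.norm_integral_le_of_norm_le_const h1).trans ?_
  rw [abs_of_nonneg (by linarith)]
  rcases ha.eq_or_lt with h0 | h0
  · rw [← h0, Real.zero_rpow (by positivity), zero_mul, Real.zero_rpow (by positivity)]
  · rw [Real.rpow_add_one h0.ne']
    gcongr
    linarith

/-- Only the upper half of the interval `[b, a]` is kept. There `z ≥ a/2` and `z - b ≥ (a - b)/2`;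
the minimum in the constant covers both signs of the exponent `1/m - 1`. -/
theorem le_gFun {m a b : ℝ} (hm : 0 < m) (hb : 0 < b) (hab : b ≤ a) :
    min 1 ((1 / 2 : ℝ) ^ (1 / m - 1)) / (4 * m) * (a ^ (1 / m - 1) * (a - b) ^ 2) ≤ gFun m a b := by
  have ha : 0 < a := hb.trans_le hab
  set κ := min 1 ((1 / 2 : ℝ) ^ (1 / m - 1)) with hκ
  set F : ℝ → ℝ := fun z => z ^ (1 / m - 1) * max (z - b) 0 with hF
  have hcont : ContinuousOn F (Icc b a) := by
    refine ContinuousOn.mul ?_ (by fun_prop)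
    exact continuousOn_id.rpow_const fun z hz => Or.inl (hb.trans_le hz.1).ne'
  set c := (a + b) / 2 with hc
  have hbc : b ≤ c := by rw [hc]; linarith
  have hca : c ≤ a := by rw [hc]; linarith
  have hi1 : IntervalIntegrable F volume b c :=
    (hcont.mono (Icc_subset_Icc_right hca)).intervalIntegrable_of_Icc hbc
  have hi2 : IntervalIntegrable F volume c a :=
    (hcont.mono (Icc_subset_Icc_left hbc)).intervalIntegrable_of_Icc hca
  have h0 : 0 ≤ ∫ z in b..c, F z := intervalIntegral.integral_nonneg hbc fun z hz => by
    have : 0 ≤ z := hb.le.trans hz.1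
    rw [hF]
    positivity
  have h1 : (a - c) * (κ * a ^ (1 / m - 1) * ((a - b) / 2)) ≤ ∫ z in c..a, F z := by
    rw [← smul_eq_mul, ← intervalIntegral.integral_const]
    refine intervalIntegral.integral_mono_on hca (by simp) hi2 fun z hz => ?_
    have hz0 : 0 < z := hb.trans_le (hbc.trans hz.1)
    have hza : a / 2 ≤ z := by
      have := hz.1
      rw [hc] at this
      linarith
    have h2 : κ * a ^ (1 / m - 1) ≤ z ^ (1 / m - 1) := by
      rcases le_total 0 (1 / m - 1) with he | he
      · calc κ * a ^ (1 / m - 1) ≤ (1 / 2 : ℝ) ^ (1 / m - 1) * a ^ (1 / m - 1) := by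
              gcongr
              exact min_le_right _ _
          _ = (a / 2) ^ (1 / m - 1) := by
              rw [← Real.mul_rpow (by norm_num) ha.le]
              congr 1
              ring
          _ ≤ z ^ (1 / m - 1) := by gcongr
      · calc κ * a ^ (1 / m - 1) ≤ 1 * a ^ (1 / m - 1) := by
              gcongr
              exact min_le_left _ _
          _ = a ^ (1 / m - 1) := one_mul _
          _ ≤ z ^ (1 / m - 1) := Real.rpow_le_rpow_of_nonpos hz0 hz.2 he
    have h3 : (a - b) / 2 ≤ max (z - b) 0 := by
      refine le_trans ?_ (le_max_left _ _)
      have := hz.1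
      rw [hc] at this
      linarith
    rw [hF]
    simp only
    gcongr
  rw [gFun, ← intervalIntegral.integral_add_adjacent_intervals hi1 hi2]
  have h4 : a - c = (a - b) / 2 := by rw [hc]; ring
  rw [h4] at h1
  calc κ / (4 * m) * (a ^ (1 / m - 1) * (a - b) ^ 2)
      = 1 / m * ((a - b) / 2 * (κ * a ^ (1 / m - 1) * ((a - b) / 2))) := by
        field_simp
        ring
    _ ≤ 1 / m * ((∫ z in b..c, F z) + ∫ z in c..a, F z) := by
        gcongr
        linarith

/-- For `m ≥ 1` powers of a number in `[0, 1]` decrease with the exponent; for `m ≤ 1` this is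
Bernoulli's inequality. -/
theorem one_sub_rpow_ge {m ε : ℝ} (hm : 0 < m) (hε0 : 0 ≤ ε) (hε1 : ε ≤ 1) :
    min 1 m * ε ≤ 1 - (1 - ε) ^ m := by
  rcases le_total 1 m with h | h
  · rw [min_eq_left h]
    have : (1 - ε) ^ m ≤ (1 - ε) ^ (1 : ℝ) :=
      Real.rpow_le_rpow_of_exponent_ge' (by linarith) (by linarith) (by linarith) h
    rw [Real.rpow_one] at this
    linarith
  · rw [min_eq_right h]
    have := rpow_one_add_le_one_add_mul_self (s := -ε) (by linarith) hm.le h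
    rw [← sub_eq_add_neg] at this
    linarith

theorem rpow_sub_rpow_ge {m ε u k : ℝ} (hm : 0 < m) (hε0 : 0 ≤ ε) (hε1 : ε ≤ 1) (hu : 0 ≤ u)
    (hk : 0 ≤ k) (hku : k ≤ (1 - ε) * u) : min 1 m * ε * u ^ m ≤ u ^ m - k ^ m := by
  have h1 : k ^ m ≤ (1 - ε) ^ m * u ^ m := by
    rw [← Real.mul_rpow (by linarith) hu]
    gcongr
  have h2 := one_sub_rpow_ge hm hε0 hε1
  have h3 : 0 ≤ u ^ m := by positivity
  nlinarith

/-- The constant in the lower bound for `gFun`. -/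
def gConst (m : ℝ) : ℝ := min 1 ((1 / 2 : ℝ) ^ (1 / m - 1)) / (4 * m) * min 1 m ^ 2

theorem gConst_pos {m : ℝ} (hm : 0 < m) : 0 < gConst m := by
  unfold gConst
  positivity

/-- Exceeding `k` by the fraction `ε` makes `u^m - k^m` at least `min 1 m · ε · u^m`. This
difference enters the lower bound `le_gFun` squared, whence `ε²`. -/
theorem le_gFun_rpow {m ε u k : ℝ} (hm : 0 < m) (hε0 : 0 ≤ ε) (hε1 : ε ≤ 1)
    (hk : 0 < k) (hku : k ≤ (1 - ε) * u) :
    gConst m * ε ^ 2 * u ^ (m + 1) ≤ gFun m (u ^ m) (k ^ m) := by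
  have hu : 0 < u := by
    by_contra h
    nlinarith
  have h1 := rpow_sub_rpow_ge hm hε0 hε1 hu.le hk.le hku
  have h0 : 0 ≤ min 1 m * ε * u ^ m := by positivity
  refine le_trans ?_ (le_gFun hm (by positivity) (by linarith))
  have h2 : (u ^ m) ^ (1 / m - 1) * (u ^ m) ^ 2 = u ^ (m + 1) := by
    rw [← Real.rpow_mul hu.le, ← Real.rpow_natCast, ← Real.rpow_mul hu.le, ← Real.rpow_add hu]
    congr 1
    push_cast
    field_simp
    ring
  calc gConst m * ε ^ 2 * u ^ (m + 1)
      = min 1 ((1 / 2 : ℝ) ^ (1 / m - 1)) / (4 * m) *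
          ((u ^ m) ^ (1 / m - 1) * (min 1 m * ε * u ^ m) ^ 2) := by
        rw [← h2, gConst]
        ring
    _ ≤ _ := by gcongr

theorem gFun_rpow_le {m u k : ℝ} (hm : 0 < m) (hk : 0 ≤ k) (hu : 0 ≤ u) :
    gFun m (u ^ m) (k ^ m) ≤ if k < u then (1 / m) * u ^ (m + 1) else 0 := by
  split_ifs with h
  · refine (gFun_le hm (by positivity) (by gcongr)).trans (le_of_eq ?_)
    rw [← Real.rpow_mul hu]
    congr 2
    field_simp
    ring
  · rw [gFun_eq_zero (by gcongr; exact not_lt.1 h)]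

end GFun

/-! ### Smooth cutoff functions and their derivatives -/

section Cutoff

variable {N : ℕ}

/-- The derivative is continuous and vanishes off `[0, 1]`. A bound at least one is chosen so that
its powers increase with the exponent. -/
theorem exists_deriv_smoothTransition_bound :
    ∃ M : ℝ, 1 ≤ M ∧ ∀ s, |deriv Real.smoothTransition s| ≤ M := by
  have hc : Continuous (deriv Real.smoothTransition) :=
    (Real.smoothTransition.contDiff (n := 1)).continuous_deriv (by simp)
  obtain ⟨M, hM⟩ := isCompact_Icc.exists_bound_of_continuousOn (s := Icc (0 : ℝ) 1)
    hc.continuousOn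
  refine ⟨max 1 M, le_max_left _ _, fun s => ?_⟩
  rcases lt_or_ge s 0 with h | h
  · have : Real.smoothTransition =ᶠ[𝓝 s] fun _ => 0 :=
      Filter.mem_of_superset (Iio_mem_nhds h) fun t ht => Real.smoothTransition.zero_of_nonpos (le_of_lt ht)
    rw [this.deriv_eq]
    simp
  rcases lt_or_ge 1 s with h' | h'
  · have : Real.smoothTransition =ᶠ[𝓝 s] fun _ => 1 :=
      Filter.mem_of_superset (Ioi_mem_nhds h') fun t ht => Real.smoothTransition.one_of_one_le (le_of_lt ht)
    rw [this.deriv_eq]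
    simp
  exact (hM s ⟨h, h'⟩).trans (le_max_right _ _)

/-- A bound for the derivative of the smooth transition function. -/
def transBound : ℝ := exists_deriv_smoothTransition_bound.choose

theorem one_le_transBound : 1 ≤ transBound := exists_deriv_smoothTransition_bound.choose_spec.1

theorem abs_deriv_smoothTransition_le (s : ℝ) : |deriv Real.smoothTransition s| ≤ transBound :=
  exists_deriv_smoothTransition_bound.choose_spec.2 s

theorem hasDerivAt_smoothTransition (s : ℝ) :
    HasDerivAt Real.smoothTransition (deriv Real.smoothTransition s) s :=
  ((Real.smoothTransition.contDiff (n := 1)).differentiable (by simp) s).hasDerivAt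

/-- A smooth bump on the line, equal to `1` for `|s| ≤ r - δ` and to `0` for `|s| ≥ r`. -/
def lineBump (r δ s : ℝ) : ℝ :=
  Real.smoothTransition ((r - s) / δ) * Real.smoothTransition ((r + s) / δ)

theorem contDiff_lineBump (r δ : ℝ) : ContDiff ℝ ∞ (lineBump r δ) := by
  unfold lineBump
  exact (Real.smoothTransition.contDiff.comp (by fun_prop)).mul
      (Real.smoothTransition.contDiff.comp (by fun_prop))

theorem lineBump_nonneg (r δ s : ℝ) : 0 ≤ lineBump r δ s :=
  mul_nonneg (Real.smoothTransition.nonneg _) (Real.smoothTransition.nonneg _)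

theorem lineBump_le_one (r δ s : ℝ) : lineBump r δ s ≤ 1 :=
  mul_le_one₀ (Real.smoothTransition.le_one _) (Real.smoothTransition.nonneg _)
    (Real.smoothTransition.le_one _)

theorem lineBump_eq_one {r δ s : ℝ} (hδ : 0 < δ) (hs : |s| ≤ r - δ) : lineBump r δ s = 1 := by
  rw [abs_le] at hs
  rw [lineBump, Real.smoothTransition.one_of_one_le, Real.smoothTransition.one_of_one_le, one_mul]
  · rw [le_div_iff₀ hδ]; linarith [hs.1]
  · rw [le_div_iff₀ hδ]; linarith [hs.2]

theorem lineBump_eq_zero {r δ s : ℝ} (hδ : 0 < δ) (hs : r ≤ |s|) : lineBump r δ s = 0 := by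
  rw [lineBump]
  rcases le_abs.1 hs with h | h
  · rw [Real.smoothTransition.zero_of_nonpos (x := (r - s) / δ)
      (div_nonpos_of_nonpos_of_nonneg (by linarith) hδ.le), zero_mul]
  · rw [Real.smoothTransition.zero_of_nonpos (x := (r + s) / δ)
      (div_nonpos_of_nonpos_of_nonneg (by linarith) hδ.le), mul_zero]

theorem abs_deriv_lineBump_le {r δ : ℝ} (hδ : 0 < δ) (s : ℝ) :
    |deriv (lineBump r δ) s| ≤ 2 * transBound / δ := by
  have h1 : HasDerivAt (fun s => Real.smoothTransition ((r - s) / δ))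
      (deriv Real.smoothTransition ((r - s) / δ) * (-1 / δ)) s :=
    (hasDerivAt_smoothTransition _).comp s (((hasDerivAt_id s).const_sub r).div_const δ)
  have h2 : HasDerivAt (fun s => Real.smoothTransition ((r + s) / δ))
      (deriv Real.smoothTransition ((r + s) / δ) * (1 / δ)) s :=
    (hasDerivAt_smoothTransition _).comp s (((hasDerivAt_id s).const_add r).div_const δ)
  have h3 := (h1.mul h2).deriv
  have h4 : deriv (lineBump r δ) s = _ := h3
  rw [h4]
  have hM := one_le_transBound
  refine (abs_add_le _ _).trans ?_
  simp only [abs_mul, abs_div, abs_neg, abs_one, abs_of_pos hδ,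
    abs_of_nonneg (Real.smoothTransition.nonneg _)]
  have e1 := abs_deriv_smoothTransition_le ((r - s) / δ)
  have e2 := abs_deriv_smoothTransition_le ((r + s) / δ)
  have e3 := Real.smoothTransition.le_one ((r - s) / δ)
  have e4 := Real.smoothTransition.le_one ((r + s) / δ)
  have e5 := Real.smoothTransition.nonneg ((r - s) / δ)
  have e6 := Real.smoothTransition.nonneg ((r + s) / δ)
  have hδ' : 0 ≤ 1 / δ := by positivity
  calc |deriv Real.smoothTransition ((r - s) / δ)| * (1 / δ) * Real.smoothTransition ((r + s) / δ) +
        Real.smoothTransition ((r - s) / δ) *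
          (|deriv Real.smoothTransition ((r + s) / δ)| * (1 / δ))
      ≤ transBound * (1 / δ) * 1 + 1 * (transBound * (1 / δ)) := by gcongr
    _ = 2 * transBound / δ := by ring

/-- The product cutoff in space. -/
def spaceCutoff (r δ y : Fin N → ℝ) (z : SpaceTime N) : ℝ :=
  ∏ i, lineBump (r i) (δ i) (z.1 i - y i)

theorem contDiff_spaceCutoff (r δ y : Fin N → ℝ) : ContDiff ℝ ∞ (spaceCutoff r δ y) := by
  unfold spaceCutoff
  refine contDiff_prod fun i _ => (contDiff_lineBump _ _).comp ?_
  fun_prop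

theorem spaceCutoff_nonneg (r δ y : Fin N → ℝ) (z : SpaceTime N) : 0 ≤ spaceCutoff r δ y z :=
  Finset.prod_nonneg fun _ _ => lineBump_nonneg _ _ _

theorem spaceCutoff_le_one (r δ y : Fin N → ℝ) (z : SpaceTime N) : spaceCutoff r δ y z ≤ 1 :=
  Finset.prod_le_one (fun _ _ => lineBump_nonneg _ _ _) fun _ _ => lineBump_le_one _ _ _

theorem spaceCutoff_eq_one {r δ y : Fin N → ℝ} (hδ : ∀ i, 0 < δ i) {z : SpaceTime N}
    (hz : z.1 ∈ box (fun i => r i - δ i) y) : spaceCutoff r δ y z = 1 :=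
  Finset.prod_eq_one fun i _ => lineBump_eq_one (hδ i) (hz i).le

theorem spaceCutoff_eq_zero {r δ y : Fin N → ℝ} (hδ : ∀ i, 0 < δ i) {z : SpaceTime N}
    (hz : z.1 ∉ box r y) : spaceCutoff r δ y z = 0 := by
  simp only [box, mem_ofPred_eq, not_forall, not_lt] at hz
  obtain ⟨i, hi⟩ := hz
  exact Finset.prod_eq_zero (Finset.mem_univ i) (lineBump_eq_zero (hδ i) hi)

/-- The cutoff in space and time used in the iteration. -/
def stepCutoff (r δ y : Fin N → ℝ) (s₀ e : ℝ) (z : SpaceTime N) : ℝ :=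
  spaceCutoff r δ y z * Real.smoothTransition ((z.2 - s₀) / e)

variable {r δ y : Fin N → ℝ} {s₀ e : ℝ}

theorem contDiff_stepCutoff : ContDiff ℝ ∞ (stepCutoff r δ y s₀ e) :=
  (contDiff_spaceCutoff r δ y).mul (Real.smoothTransition.contDiff.comp (by fun_prop))

theorem stepCutoff_nonneg (z : SpaceTime N) : 0 ≤ stepCutoff r δ y s₀ e z :=
  mul_nonneg (spaceCutoff_nonneg _ _ _ _) (Real.smoothTransition.nonneg _)

theorem stepCutoff_le_one (z : SpaceTime N) : stepCutoff r δ y s₀ e z ≤ 1 :=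
  mul_le_one₀ (spaceCutoff_le_one _ _ _ _) (Real.smoothTransition.nonneg _)
    (Real.smoothTransition.le_one _)

theorem stepCutoff_eq_one (hδ : ∀ i, 0 < δ i) (he : 0 < e) {z : SpaceTime N}
    (hz : z.1 ∈ box (fun i => r i - δ i) y) (ht : s₀ + e ≤ z.2) :
    stepCutoff r δ y s₀ e z = 1 := by
  rw [stepCutoff, spaceCutoff_eq_one hδ hz, Real.smoothTransition.one_of_one_le, one_mul]
  rw [le_div_iff₀ he]
  linarith

theorem stepCutoff_eq_zero_of_notMem (hδ : ∀ i, 0 < δ i) {z : SpaceTime N}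
    (hz : z.1 ∉ box r y) : stepCutoff r δ y s₀ e z = 0 := by
  rw [stepCutoff, spaceCutoff_eq_zero hδ hz, zero_mul]

theorem stepCutoff_eq_zero_of_le (he : 0 < e) {z : SpaceTime N} (hz : z.2 ≤ s₀) :
    stepCutoff r δ y s₀ e z = 0 := by
  rw [stepCutoff, Real.smoothTransition.zero_of_nonpos, mul_zero]
  exact div_nonpos_of_nonpos_of_nonneg (by linarith) he.le

theorem abs_spaceDeriv_spaceCutoff_le (hδ : ∀ i, 0 < δ i) (i : Fin N) (z : SpaceTime N) :
    |spaceDeriv i (spaceCutoff r δ y) z| ≤ 2 * transBound / δ i := by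
  have hdiff : DifferentiableAt ℝ (spaceCutoff r δ y) z :=
    ((contDiff_spaceCutoff r δ y).differentiable (by simp)).differentiableAt
  have h1 : spaceDeriv i (spaceCutoff r δ y) z
      = deriv (fun s : ℝ => spaceCutoff r δ y (z + s • spaceDir i)) 0 := by
    rw [spaceDeriv, ← hdiff.lineDeriv_eq_fderiv]
    rfl
  have h2 : (fun s : ℝ => spaceCutoff r δ y (z + s • spaceDir i))
      = fun s : ℝ => lineBump (r i) (δ i) (s + (z.1 i - y i)) *
          ∏ j ∈ Finset.univ.erase i, lineBump (r j) (δ j) (z.1 j - y j) := by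
    funext s
    rw [spaceCutoff, ← Finset.mul_prod_erase _ _ (Finset.mem_univ i)]
    congr 1
    · simp only [spaceDir, Prod.fst_add, Prod.smul_fst, Pi.add_apply, Pi.smul_apply,
        Pi.single_eq_same, smul_eq_mul, mul_one]
      congr 1
      ring
    · refine Finset.prod_congr rfl fun j hj => ?_
      simp [spaceDir, Finset.ne_of_mem_erase hj]
  have h3 : HasDerivAt (lineBump (r i) (δ i)) (deriv (lineBump (r i) (δ i)) (0 + (z.1 i - y i)))
      (0 + (z.1 i - y i)) :=
    ((contDiff_lineBump _ _).differentiable (by simp)).differentiableAt.hasDerivAt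
  rw [h1, h2, ((h3.comp_add_const 0 (z.1 i - y i)).mul_const _).deriv, abs_mul]
  have h4 : |∏ j ∈ Finset.univ.erase i, lineBump (r j) (δ j) (z.1 j - y j)| ≤ 1 := by
    rw [abs_of_nonneg (Finset.prod_nonneg fun _ _ => lineBump_nonneg _ _ _)]
    exact Finset.prod_le_one (fun _ _ => lineBump_nonneg _ _ _) fun _ _ => lineBump_le_one _ _ _
  exact (mul_le_of_le_one_right (abs_nonneg _) h4).trans (abs_deriv_lineBump_le (hδ i) _)

theorem abs_spaceDeriv_stepCutoff_le (hδ : ∀ i, 0 < δ i) (i : Fin N) (z : SpaceTime N) :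
    |spaceDeriv i (stepCutoff r δ y s₀ e) z| ≤ 2 * transBound / δ i := by
  have hdiff : DifferentiableAt ℝ (spaceCutoff r δ y) z :=
    ((contDiff_spaceCutoff r δ y).differentiable (by simp)).differentiableAt
  have hdiff' : DifferentiableAt ℝ (stepCutoff r δ y s₀ e) z :=
    (contDiff_stepCutoff.differentiable (by simp)).differentiableAt
  have h1 : spaceDeriv i (stepCutoff r δ y s₀ e) z
      = spaceDeriv i (spaceCutoff r δ y) z * Real.smoothTransition ((z.2 - s₀) / e) := by
    rw [spaceDeriv, spaceDeriv, ← hdiff.lineDeriv_eq_fderiv, ← hdiff'.lineDeriv_eq_fderiv,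
      lineDeriv, lineDeriv, ← deriv_mul_const_field]
    congr 1
    funext s
    simp [stepCutoff]
  rw [h1, abs_mul, abs_of_nonneg (Real.smoothTransition.nonneg _)]
  exact (mul_le_of_le_one_right (abs_nonneg _) (Real.smoothTransition.le_one _)).trans
    (abs_spaceDeriv_spaceCutoff_le hδ i z)

theorem abs_timeDeriv_stepCutoff_le (he : 0 < e) (z : SpaceTime N) :
    |timeDeriv (stepCutoff r δ y s₀ e) z| ≤ transBound / e := by
  have hdiff' : DifferentiableAt ℝ (stepCutoff r δ y s₀ e) z :=
    (contDiff_stepCutoff.differentiable (by simp)).differentiableAt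
  have h2 : (fun s : ℝ => stepCutoff r δ y s₀ e (z + s • ((0, 1) : SpaceTime N)))
      = fun s : ℝ => spaceCutoff r δ y z * Real.smoothTransition ((s + (z.2 - s₀)) / e) := by
    funext s
    simp only [stepCutoff, spaceCutoff]
    congr 1
    · simp
    · congr 2
      simp
      ring
  have h3 : HasDerivAt (fun s : ℝ => Real.smoothTransition ((s + (z.2 - s₀)) / e))
      (deriv Real.smoothTransition ((0 + (z.2 - s₀)) / e) * (1 / e)) 0 :=
    (hasDerivAt_smoothTransition _).comp (0 : ℝ)
      (((hasDerivAt_id (0 : ℝ)).add_const (z.2 - s₀)).div_const e)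
  rw [timeDeriv, ← hdiff'.lineDeriv_eq_fderiv, lineDeriv, h2, (h3.const_mul _).deriv, abs_mul,
    abs_of_nonneg (spaceCutoff_nonneg _ _ _ _), abs_mul, abs_of_pos (by positivity : 0 < 1 / e)]
  refine (mul_le_of_le_one_left (by positivity) (spaceCutoff_le_one _ _ _ _)).trans ?_
  rw [div_eq_mul_one_div transBound]
  gcongr
  exact abs_deriv_smoothTransition_le _

theorem isOpen_box (r y : Fin N → ℝ) : IsOpen (box r y) := by
  simp only [box, ofPred_forall]
  exact isOpen_iInter_of_finite fun i => isOpen_lt (by fun_prop) continuous_const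

theorem isCutoff_of_contDiff {η τ : ℝ} {ζ : SpaceTime N → ℝ} (h : ContDiff ℝ ∞ ζ)
    (h0 : ∀ z, 0 ≤ ζ z) (h1 : ∀ z, ζ z ≤ 1) (hz : ∀ z : SpaceTime N, z.1 ∉ box r y → ζ z = 0) :
    IsCutoff r η y τ ζ where
  piecewiseSmooth := ⟨1, fun _ => univ, fun _ => ζ, fun _ => isClosed_univ,
    fun z _ => mem_iUnion.2 ⟨0, mem_univ z⟩, fun _ => h, fun _ _ _ => rfl⟩
  mem_Icc := fun z _ => ⟨h0 z, h1 z⟩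
  lateral := fun z hzm => hz z fun hb => by
    have := hzm.1
    rw [(isOpen_box r y).frontier_eq] at this
    exact this.2 hb

end Cutoff

/-! ### The energy inequality at a level comparable to `K` -/

section Energy

variable {N : ℕ} {d : Exponents N}

/-- `u^s` on the set `{u > k}`, and zero elsewhere. -/
def superPow (u : SpaceTime N → ℝ) (k s : ℝ) (z : SpaceTime N) : ℝ := if k < u z then u z ^ s else 0

theorem superPow_nonneg {u : SpaceTime N → ℝ} (hu : ∀ z, 0 ≤ u z) (k s : ℝ) (z : SpaceTime N) :
    0 ≤ superPow u k s z := by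
  rw [superPow]
  split_ifs
  · exact Real.rpow_nonneg (hu z) _
  · exact le_rfl

theorem measurable_superPow {u : SpaceTime N → ℝ} (hu : Measurable u) (k s : ℝ) :
    Measurable (superPow u k s) :=
  Measurable.ite (measurableSet_lt measurable_const hu) (hu.pow_const s) measurable_const

/-- The right-hand side of the energy inequality, without the initial term. -/
def energyRight (d : Exponents N) (C : ℝ) (u : SpaceTime N → ℝ) (k : ℝ) (r : Fin N → ℝ) (η : ℝ)
    (y : Fin N → ℝ) (τ : ℝ) (ζ : SpaceTime N → ℝ) : ℝ≥0∞ :=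
  ENNReal.ofReal C * (∫⁻ z in cyl r η y τ,
      ENNReal.ofReal (gFun d.mMin (u z ^ d.mMin) (k ^ d.mMin) * |timeDeriv ζ z|)) +
    ENNReal.ofReal C * (∑ i, ∫⁻ z in cyl r η y τ,
      ENNReal.ofReal (u z ^ ((d.m i - d.mMin) * (d.p i - 1)) *
        max (u z ^ d.mMin - k ^ d.mMin) 0 ^ d.p i * |spaceDeriv i ζ z| ^ d.p i)) +
    ENNReal.ofReal C * (∑ i, ∫⁻ z in cyl r η y τ,
      ENNReal.ofReal (u z ^ ((d.n i - d.mMin) * (d.q i - 1)) *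
        max (u z ^ d.mMin - k ^ d.mMin) 0 ^ d.q i * |spaceDeriv i ζ z| ^ d.q i))

theorem box_mono {r r' y : Fin N → ℝ} (h : ∀ i, r i ≤ r' i) : box r y ⊆ box r' y :=
  fun _ hx i => (hx i).trans_le (h i)

theorem mem_box_self {r y : Fin N → ℝ} (h : ∀ i, 0 < r i) : y ∈ box r y := fun i => by
  simpa using h i

/-- Cylinders are open in time, so the inclusion still permits `τ = T`; the estimates therefore
reach the final time. -/
theorem cyl_subset_parCyl {Ω : Set (Fin N → ℝ)} {T : ℝ} {r : Fin N → ℝ} {η : ℝ} {y : Fin N → ℝ}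
    {τ : ℝ} (hr : ∀ i, 0 < r i) (hη : 0 < η) (h : cyl r η y τ ⊆ parCyl Ω T) :
    box r y ⊆ Ω ∧ 0 ≤ τ - η ∧ τ ≤ T := by
  refine ⟨fun x hx => ?_, ?_, ?_⟩
  · exact (h (show (x, τ - η / 2) ∈ cyl r η y τ from
      ⟨hx, by constructor <;> simp only <;> linarith⟩)).1
  · by_contra hlt
    push Not at hlt
    have h1 : τ - η < min τ 0 := lt_min (by linarith) hlt
    obtain ⟨t, ht1, ht2⟩ := exists_between h1
    have := (h (show (y, t) ∈ cyl r η y τ from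
      ⟨mem_box_self hr, ht1, ht2.trans_le (min_le_left _ _)⟩)).2.1
    simp only at this
    linarith [ht2.trans_le (min_le_right _ _)]
  · by_contra hlt
    push Not at hlt
    have h1 : max T (τ - η) < τ := max_lt hlt (by linarith)
    obtain ⟨t, ht1, ht2⟩ := exists_between h1
    have := (h (show (y, t) ∈ cyl r η y τ from
      ⟨mem_box_self hr, (le_max_right _ _).trans_lt ht1, ht2⟩)).2.2
    simp only at this
    linarith [(le_max_left _ _).trans_lt ht1]

theorem measurableSet_cyl (r : Fin N → ℝ) (η : ℝ) (y : Fin N → ℝ) (τ : ℝ) :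
    MeasurableSet (cyl r η y τ) :=
  (isOpen_box r y).measurableSet.prod measurableSet_Ioo

/-- The energy estimates in terms of a measurable representative. -/
theorem MemPDG.energy_measurable {Ω : Set (Fin N → ℝ)} {T C : ℝ} {u u' : SpaceTime N → ℝ}
    (hu : MemPDG d C Ω T u) (hΩ : IsOpen Ω)
    (hu' : u' =ᵐ[volume.restrict (Ω ×ˢ Ioo 0 T)] u) {k : ℝ} (hk : 0 < k) :
    ∃ v v' : Fin N → SpaceTime N → ℝ,
      (∀ i, HasWeakSpaceDeriv (Ω ×ˢ Ioo 0 T) i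
        (fun z => max (u z ^ d.mMin - k ^ d.mMin) 0) (v i)) ∧
      (∀ i, Measurable (v' i)) ∧ (∀ i, v' i =ᵐ[volume.restrict (Ω ×ˢ Ioo 0 T)] v i) ∧
      ∀ (r : Fin N → ℝ) (η : ℝ) (y : Fin N → ℝ) (τ : ℝ), (∀ i, 0 < r i) → 0 < η →
        cyl (fun i => 8 * r i) (8 * η) y τ ⊆ parCyl Ω T →
        ∀ ζ : SpaceTime N → ℝ, IsCutoff r η y τ ζ →
          (∀ᵐ t, t ∈ Ioo (τ - η) τ → ∫⁻ x in box r y,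
            ENNReal.ofReal (gFun d.mMin (u' (x, t) ^ d.mMin) (k ^ d.mMin) * ζ (x, t) ^ d.qMax)
              ≤ (∫⁻ x in box r y, ENNReal.ofReal
                (gFun d.mMin (u (x, τ - η) ^ d.mMin) (k ^ d.mMin) * ζ (x, τ - η) ^ d.qMax)) +
                energyRight d C u' k r η y τ ζ) ∧
          ∀ i, ENNReal.ofReal (1 / C) * ∫⁻ z in cyl r η y τ, ENNReal.ofReal
            (u' z ^ ((d.m i - d.mMin) * (d.p i - 1)) * |v' i z| ^ d.p i * ζ z ^ d.qMax)
              ≤ (∫⁻ x in box r y, ENNReal.ofReal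
                (gFun d.mMin (u (x, τ - η) ^ d.mMin) (k ^ d.mMin) * ζ (x, τ - η) ^ d.qMax)) +
                energyRight d C u' k r η y τ ζ := by
  obtain ⟨v, hv, hen⟩ := hu.energy k hk
  have hU : MeasurableSet (Ω ×ˢ Ioo 0 T) := hΩ.measurableSet.prod measurableSet_Ioo
  have hvm : ∀ i, AEStronglyMeasurable (v i) (volume.restrict (Ω ×ˢ Ioo 0 T)) :=
    fun i => (hv i).2.1.aestronglyMeasurable
  refine ⟨v, fun i => (hvm i).mk (v i), hv,
    fun i => (hvm i).stronglyMeasurable_mk.measurable, fun i => (hvm i).ae_eq_mk.symm, ?_⟩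
  intro r η y τ hr hη hsub ζ hζ
  have h := hen r η y τ hr hη hsub ζ hζ
  obtain ⟨hbox, hτ0, hτT⟩ := cyl_subset_parCyl (fun i => by linarith [hr i]) (by linarith) hsub
  have hbox' : box r y ⊆ Ω := (box_mono fun i => by linarith [hr i]).trans hbox
  have hIoo : Ioo (τ - η) τ ⊆ Ioo 0 T := Ioo_subset_Ioo (by linarith) hτT
  have hcylU : cyl r η y τ ⊆ Ω ×ˢ Ioo 0 T := prod_mono hbox' hIoo
  have haeu : ∀ᵐ z ∂(volume.restrict (cyl r η y τ)), u' z = u z :=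
    ae_mono (Measure.restrict_mono hcylU le_rfl) hu'
  have hright : energyRight d C u k r η y τ ζ = energyRight d C u' k r η y τ ζ := by
    have key : ∀ G : ℝ → SpaceTime N → ℝ≥0∞,
        ∫⁻ z in cyl r η y τ, G (u z) z = ∫⁻ z in cyl r η y τ, G (u' z) z := fun G =>
      lintegral_congr_ae (haeu.mono fun z hz => by simp only [hz])
    unfold energyRight
    rw [key fun a z => ENNReal.ofReal (gFun d.mMin (a ^ d.mMin) (k ^ d.mMin) * |timeDeriv ζ z|)]
    congr 2
    · congr 1
      refine Finset.sum_congr rfl fun i _ => ?_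
      exact key fun a z => ENNReal.ofReal (a ^ ((d.m i - d.mMin) * (d.p i - 1)) *
        max (a ^ d.mMin - k ^ d.mMin) 0 ^ d.p i * |spaceDeriv i ζ z| ^ d.p i)
    · refine Finset.sum_congr rfl fun i _ => ?_
      exact key fun a z => ENNReal.ofReal (a ^ ((d.n i - d.mMin) * (d.q i - 1)) *
        max (a ^ d.mMin - k ^ d.mMin) 0 ^ d.q i * |spaceDeriv i ζ z| ^ d.q i)
  rw [EnergyIneq] at h
  replace h := le_of_le_of_eq h (c := (∫⁻ x in box r y, ENNReal.ofReal
    (gFun d.mMin (u (x, τ - η) ^ d.mMin) (k ^ d.mMin) * ζ (x, τ - η) ^ d.qMax)) +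
      energyRight d C u k r η y τ ζ) (by simp only [energyRight, add_assoc])
  rw [hright] at h
  constructor
  · have hsl := ae_swap ((ae_restrict_iff' hU).1 hu')
    filter_upwards [hsl] with t ht htm
    refine le_trans ?_ (le_self_add.trans h)
    refine le_trans (le_of_eq ?_) (le_iSup₂ (f := fun t (_ : t ∈ Icc (τ - η) τ) =>
      ∫⁻ x in box r y, ENNReal.ofReal (gFun d.mMin (u (x, t) ^ d.mMin) (k ^ d.mMin) *
        ζ (x, t) ^ d.qMax)) t (Ioo_subset_Icc_self htm))
    refine lintegral_congr_ae ?_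
    filter_upwards [ae_restrict_of_ae ht, ae_restrict_mem (isOpen_box r y).measurableSet]
      with x hx hxm
    rw [hx ⟨hbox' hxm, hIoo htm⟩]
  · intro i
    refine le_trans ?_ (le_add_self.trans h)
    gcongr
    refine le_trans (le_of_eq ?_) (Finset.single_le_sum (f := fun i => ∫⁻ z in cyl r η y τ,
      ENNReal.ofReal (u z ^ ((d.m i - d.mMin) * (d.p i - 1)) * |v i z| ^ d.p i * ζ z ^ d.qMax))
      (fun _ _ => zero_le) (Finset.mem_univ i))
    refine lintegral_congr_ae ?_
    filter_upwards [haeu, ae_mono (Measure.restrict_mono hcylU le_rfl) (hvm i).ae_eq_mk]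
      with z hz hz'
    rw [hz, ← hz']

theorem lintegral_ofReal_le_mul {α : Type*} [MeasurableSpace α] {μ : Measure α} {f g : α → ℝ}
    {B : ℝ} (hB : 0 ≤ B) (h : ∀ z, f z ≤ B * g z) :
    ∫⁻ z, ENNReal.ofReal (f z) ∂μ ≤ ENNReal.ofReal B * ∫⁻ z, ENNReal.ofReal (g z) ∂μ := by
  rw [← lintegral_const_mul' _ _ ENNReal.ofReal_ne_top]
  refine lintegral_mono fun z => ?_
  rw [← ENNReal.ofReal_mul hB]
  exact ENNReal.ofReal_le_ofReal (h z)

/-- The sum of the scale-invariant coefficients in the energy estimate at level `K`. -/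
def coefSum (d : Exponents N) (K θ : ℝ) (ρ : Fin N → ℝ) : ℝ :=
  K ^ (1 - d.calL) / θ + (∑ i, K ^ (d.lam i - d.calL) / ρ i ^ d.p i) +
    ∑ i, K ^ (d.Lam i - d.calL) / ρ i ^ d.q i

/-- Above the level `K/2` the nonpositive power `u^(s-L)` is at most its value at `K/2`. All lower
growth exponents are raised to the largest one in this way. -/
theorem rpow_add_le_of_level {m L s K u : ℝ} (hs0 : 0 ≤ s) (hsL : s ≤ L) (hK : 0 < K)
    (hu : K / 2 ≤ u) : u ^ (m + s) ≤ 2 ^ L * K ^ (s - L) * u ^ (m + L) := by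
  have hu0 : 0 < u := (by linarith : (0 : ℝ) < K / 2).trans_le hu
  have h1 : u ^ (m + s) = u ^ (m + L) * u ^ (s - L) := by
    rw [← Real.rpow_add hu0]
    congr 1
    ring
  have h2 : u ^ (s - L) ≤ (K / 2) ^ (s - L) :=
    Real.rpow_le_rpow_of_nonpos (by linarith) hu (by linarith)
  have h3 : (K / 2) ^ (s - L) = K ^ (s - L) * 2 ^ (L - s) := by
    rw [Real.div_rpow hK.le (by norm_num), div_eq_mul_inv, ← Real.rpow_neg (by norm_num)]
    congr 2
    ring
  have h4 : (2 : ℝ) ^ (L - s) ≤ 2 ^ L :=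
    Real.rpow_le_rpow_of_exponent_le (by norm_num) (by linarith)
  rw [h1]
  calc u ^ (m + L) * u ^ (s - L) ≤ u ^ (m + L) * (K ^ (s - L) * 2 ^ L) := by
        gcongr
        rw [h3] at h2
        exact h2.trans (by gcongr)
    _ = _ := by ring

theorem one_div_rpow_le {ε e q A : ℝ} (hε : 0 < ε) (hε1 : ε ≤ 1) (he : e ≤ q)
    (hA : 1 ≤ A) : (A / ε) ^ e ≤ A ^ q * (1 / ε) ^ q := by
  rw [← Real.mul_rpow (by linarith) (by positivity), mul_one_div]
  refine Real.rpow_le_rpow_of_exponent_le ?_ he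
  rw [le_div_iff₀ hε]
  linarith

/-- From `(u^m - k^m)_+ ≤ u^m` and `(μ - m)(e - 1) + m e = m + μ(e - 1)`, the power of `u` is `m +
s` with `s = μ(e - 1) ≤ L`, and `rpow_add_le_of_level` raises it to `m + L`. The form covers both
families, `(m_i, p_i)` and `(n_i, q_i)`. -/
theorem diffusion_term_le {u : SpaceTime N → ℝ} (hu : ∀ z, 0 ≤ u z) {m L q μ e K k ε ρ M D : ℝ}
    (hm : 0 < m) (he : 1 < e) (hμ : 0 < μ) (heq : e ≤ q) (hL : μ * (e - 1) ≤ L)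
    (hK : 0 < K) (hk : K / 2 ≤ k) (hε : 0 < ε) (hε1 : ε ≤ 1) (hρ : 0 < ρ) (hM : 1 ≤ M)
    (hD0 : 0 ≤ D) (hD : D ≤ M / (ε * ρ)) (z : SpaceTime N) :
    u z ^ ((μ - m) * (e - 1)) * max (u z ^ m - k ^ m) 0 ^ e * D ^ e
      ≤ 2 ^ L * M ^ q * (1 / ε) ^ q * (K ^ (μ * (e - 1) - L) / ρ ^ e) *
        superPow u k (m + L) z := by
  have hk0 : 0 < k := by linarith
  rw [superPow]
  split_ifs with h
  · have hu0 : 0 < u z := hk0.trans h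
    have h1 : u z ^ ((μ - m) * (e - 1)) * max (u z ^ m - k ^ m) 0 ^ e
        ≤ u z ^ (m + μ * (e - 1)) := by
      calc u z ^ ((μ - m) * (e - 1)) * max (u z ^ m - k ^ m) 0 ^ e
          ≤ u z ^ ((μ - m) * (e - 1)) * (u z ^ m) ^ e := by
            gcongr
            refine max_le ?_ (by positivity)
            have : 0 ≤ k ^ m := by positivity
            linarith
        _ = u z ^ (m + μ * (e - 1)) := by
            rw [← Real.rpow_mul hu0.le, ← Real.rpow_add hu0]
            congr 1
            ring
    have h2 := rpow_add_le_of_level (m := m) (L := L) (u := u z)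
      (mul_nonneg hμ.le (by linarith : 0 ≤ e - 1)) hL hK (by linarith)
    have h3 : D ^ e ≤ M ^ q * (1 / ε) ^ q / ρ ^ e := by
      calc D ^ e ≤ (M / ε / ρ) ^ e := by
            gcongr
            rwa [div_div]
        _ = (M / ε) ^ e / ρ ^ e := Real.div_rpow (by positivity) hρ.le _
        _ ≤ _ := by
            gcongr
            exact one_div_rpow_le hε hε1 heq hM
    calc u z ^ ((μ - m) * (e - 1)) * max (u z ^ m - k ^ m) 0 ^ e * D ^ e
        ≤ (2 ^ L * K ^ (μ * (e - 1) - L) * u z ^ (m + L)) *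
            (M ^ q * (1 / ε) ^ q / ρ ^ e) := by
          have := (by positivity : 0 ≤ D ^ e)
          exact mul_le_mul (h1.trans h2) h3 this (by positivity)
      _ = _ := by ring
  · rw [max_eq_right, Real.zero_rpow (by linarith)]
    · simp
    · have : u z ^ m ≤ k ^ m := by
        have := hu z
        gcongr
        exact not_lt.1 h
      linarith

/-- The constant in the bound for the right-hand side of the energy inequality. -/
def rightConst (d : Exponents N) : ℝ :=
  2 ^ d.calL * (2 * transBound) ^ d.qMax * (1 + 1 / d.mMin)

theorem rightConst_pos (hd : d.Admissible) : 0 < rightConst d := by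
  have := one_le_transBound
  have := hd.mMin_pos
  unfold rightConst
  positivity

/-- The cutoff varies over the lengths `ε θ` in time and `ε ρ i` in space. The time term has growth
exponent `1`, the diffusion terms have `λ_i` and `Λ_i`; each yields one summand of `coefSum`, and
the powers of `1/ε` are all raised to `q`. -/
theorem energyRight_le (hd : d.Admissible) {C : ℝ} (hC : 0 < C) {u : SpaceTime N → ℝ}
    (hu : ∀ z, 0 ≤ u z) {K k ε θ : ℝ} {ρ r : Fin N → ℝ} {η : ℝ} {y : Fin N → ℝ} {τ : ℝ}
    (hK : 0 < K) (hk : K / 2 ≤ k) (hε : 0 < ε) (hε1 : ε ≤ 1) (hρ : ∀ i, 0 < ρ i) (hθ : 0 < θ) :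
    energyRight d C u k r η y τ (stepCutoff r (fun i => ε * ρ i) y (τ - η) (ε * θ))
      ≤ ENNReal.ofReal (C * (rightConst d * (1 / ε) ^ d.qMax * coefSum d K θ ρ)) *
        ∫⁻ z in cyl r η y τ, ENNReal.ofReal (superPow u k (d.mMin + d.calL) z) := by
  set ζ := stepCutoff r (fun i => ε * ρ i) y (τ - η) (ε * θ) with hζ
  have hk0 : 0 < k := by linarith
  have hm := hd.mMin_pos
  have hq := hd.one_lt_qMax
  have hM := one_le_transBound
  set A := 2 ^ d.calL * (2 * transBound) ^ d.qMax * (1 / ε) ^ d.qMax with hA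
  have hA0 : 0 < A := by positivity
  have hA1 : A ≤ rightConst d * (1 / ε) ^ d.qMax := by
    have : 0 ≤ A * (1 / d.mMin) := by positivity
    have e : rightConst d * (1 / ε) ^ d.qMax = A + A * (1 / d.mMin) := by
      rw [rightConst, hA]; ring
    linarith
  have hB0 : 0 < rightConst d * (1 / ε) ^ d.qMax := hA0.trans_le hA1
  set B := rightConst d * (1 / ε) ^ d.qMax with hB
  set Y := ∫⁻ z in cyl r η y τ, ENNReal.ofReal (superPow u k (d.mMin + d.calL) z) with hY
  have hsp := superPow_nonneg hu k (d.mMin + d.calL)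
  have t1 : ∫⁻ z in cyl r η y τ,
      ENNReal.ofReal (gFun d.mMin (u z ^ d.mMin) (k ^ d.mMin) * |timeDeriv ζ z|)
      ≤ ENNReal.ofReal (B * (K ^ (1 - d.calL) / θ)) * Y := by
    refine lintegral_ofReal_le_mul (by positivity) fun z => ?_
    have hg := gFun_rpow_le hm hk0.le (hu z)
    have ht : |timeDeriv ζ z| ≤ transBound / (ε * θ) :=
      abs_timeDeriv_stepCutoff_le (by positivity) z
    rw [superPow]
    split_ifs at hg ⊢ with h
    · have h2 := rpow_add_le_of_level (m := d.mMin) (L := d.calL) (u := u z)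
        (by norm_num) Exponents.one_le_calL hK (by linarith)
      have h3 : transBound / ε ≤ (2 * transBound) ^ d.qMax * (1 / ε) ^ d.qMax := by
        have h4 := one_div_rpow_le (A := 2 * transBound) hε hε1 hq.le (by linarith)
        rw [Real.rpow_one] at h4
        refine le_trans ?_ h4
        gcongr
        linarith
      calc gFun d.mMin (u z ^ d.mMin) (k ^ d.mMin) * |timeDeriv ζ z|
          ≤ ((1 / d.mMin) * (2 ^ d.calL * K ^ (1 - d.calL) * u z ^ (d.mMin + d.calL))) *
              (transBound / ε / θ) := by
            rw [div_div]
            have := hu z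
            gcongr
            exact hg.trans (by gcongr)
        _ ≤ ((1 / d.mMin) * (2 ^ d.calL * K ^ (1 - d.calL) * u z ^ (d.mMin + d.calL))) *
              ((2 * transBound) ^ d.qMax * (1 / ε) ^ d.qMax / θ) := by
            have := hu z
            gcongr
        _ = (A * (1 / d.mMin)) * (K ^ (1 - d.calL) / θ) * u z ^ (d.mMin + d.calL) := by
            rw [hA]; ring
        _ ≤ B * (K ^ (1 - d.calL) / θ) * u z ^ (d.mMin + d.calL) := by
            have := hu z
            gcongr
            rw [hB, rightConst]
            have e : 2 ^ d.calL * (2 * transBound) ^ d.qMax * (1 + 1 / d.mMin) *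
              (1 / ε) ^ d.qMax = A + A * (1 / d.mMin) := by rw [hA]; ring
            linarith
    · have h5 := gFun_nonneg (a := u z ^ d.mMin) hm (b := k ^ d.mMin) (by positivity)
      rw [le_antisymm hg h5]
      simp
  have hDz : ∀ i z, |spaceDeriv i ζ z| ≤ 2 * transBound / (ε * ρ i) := fun i z =>
    abs_spaceDeriv_stepCutoff_le (fun i => mul_pos hε (hρ i)) i z
  have t2 : ∀ i, ∫⁻ z in cyl r η y τ,
      ENNReal.ofReal (u z ^ ((d.m i - d.mMin) * (d.p i - 1)) *
        max (u z ^ d.mMin - k ^ d.mMin) 0 ^ d.p i * |spaceDeriv i ζ z| ^ d.p i)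
      ≤ ENNReal.ofReal (B * (K ^ (d.lam i - d.calL) / ρ i ^ d.p i)) * Y := by
    intro i
    have := hρ i
    refine lintegral_ofReal_le_mul (by positivity) fun z => ?_
    refine (diffusion_term_le hu hm (hd.one_lt_p i) (hd.m_pos i)
      ((hd.p_le_q i).trans (Exponents.q_le_qMax i)) (hd.lam_le_calL i) hK hk hε hε1 (hρ i)
      (by linarith) (abs_nonneg _) (hDz i z) z).trans ?_
    exact mul_le_mul_of_nonneg_right (mul_le_mul_of_nonneg_right hA1 (by positivity)) (hsp z)
  have t3 : ∀ i, ∫⁻ z in cyl r η y τ,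
      ENNReal.ofReal (u z ^ ((d.n i - d.mMin) * (d.q i - 1)) *
        max (u z ^ d.mMin - k ^ d.mMin) 0 ^ d.q i * |spaceDeriv i ζ z| ^ d.q i)
      ≤ ENNReal.ofReal (B * (K ^ (d.Lam i - d.calL) / ρ i ^ d.q i)) * Y := by
    intro i
    have := hρ i
    refine lintegral_ofReal_le_mul (by positivity) fun z => ?_
    refine (diffusion_term_le hu hm (hd.one_lt_q i) (hd.n_pos i)
      (Exponents.q_le_qMax i) (Exponents.Lam_le_calL i) hK hk hε hε1 (hρ i)
      (by linarith) (abs_nonneg _) (hDz i z) z).trans ?_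
    exact mul_le_mul_of_nonneg_right (mul_le_mul_of_nonneg_right hA1 (by positivity)) (hsp z)
  have n1 : 0 ≤ B * (K ^ (1 - d.calL) / θ) := by positivity
  have n2 : ∀ i, 0 ≤ B * (K ^ (d.lam i - d.calL) / ρ i ^ d.p i) := fun i => by
    have := hρ i
    positivity
  have n3 : ∀ i, 0 ≤ B * (K ^ (d.Lam i - d.calL) / ρ i ^ d.q i) := fun i => by
    have := hρ i
    positivity
  have s2 : 0 ≤ ∑ i, B * (K ^ (d.lam i - d.calL) / ρ i ^ d.p i) :=
    Finset.sum_nonneg fun i _ => n2 i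
  have s3 : 0 ≤ ∑ i, B * (K ^ (d.Lam i - d.calL) / ρ i ^ d.q i) :=
    Finset.sum_nonneg fun i _ => n3 i
  have hsum : B * coefSum d K θ ρ = B * (K ^ (1 - d.calL) / θ) +
      (∑ i, B * (K ^ (d.lam i - d.calL) / ρ i ^ d.p i)) +
      ∑ i, B * (K ^ (d.Lam i - d.calL) / ρ i ^ d.q i) := by
    rw [coefSum, mul_add, mul_add, Finset.mul_sum, Finset.mul_sum]
  rw [energyRight, hsum, ENNReal.ofReal_mul hC.le, ENNReal.ofReal_add (by positivity) s3,
    ENNReal.ofReal_add n1 s2, ENNReal.ofReal_sum_of_nonneg fun i _ => n2 i,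
    ENNReal.ofReal_sum_of_nonneg fun i _ => n3 i, ← mul_add, ← mul_add, mul_assoc]
  gcongr
  rw [add_mul, add_mul, Finset.sum_mul, Finset.sum_mul]
  gcongr with i _ i _
  · exact t2 i
  · exact t3 i

end Energy

/-! ### Parabolic embedding and one step of the iteration -/

section Step

variable {N : ℕ} {d : Exponents N}

theorem add_rpow_le_two_rpow {x y p : ℝ} (hx : 0 ≤ x) (hy : 0 ≤ y) (hp : 0 ≤ p) :
    (x + y) ^ p ≤ 2 ^ p * (x ^ p + y ^ p) := by
  have h1 : x + y ≤ 2 * max x y := by linarith [le_max_left x y, le_max_right x y]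
  have h0 : 0 ≤ max x y := hx.trans (le_max_left _ _)
  calc (x + y) ^ p ≤ (2 * max x y) ^ p := by gcongr
    _ = 2 ^ p * max x y ^ p := Real.mul_rpow (by norm_num) h0
    _ ≤ 2 ^ p * (x ^ p + y ^ p) := by
        gcongr
        rcases max_choice x y with h | h <;> rw [h]
        · linarith [Real.rpow_nonneg hy p]
        · linarith [Real.rpow_nonneg hx p]

theorem spaceDeriv_pow {ζ : SpaceTime N → ℝ} (hζ : ContDiff ℝ ∞ ζ) (b : ℕ) (i : Fin N)
    (z : SpaceTime N) :
    spaceDeriv i (fun z => ζ z ^ b) z = b * ζ z ^ (b - 1) * spaceDeriv i ζ z := by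
  have h : DifferentiableAt ℝ ζ z := (hζ.differentiable (by simp)).differentiableAt
  rw [spaceDeriv, spaceDeriv, (h.hasFDerivAt.pow b).fderiv]
  simp [mul_assoc]

/-- The exponent `a_i` satisfies `m (a_i - 1) p_i = (m_i - m)(p_i - 1)`, so `w ≤ u^m` turns the
Sobolev weight into that of the energy. The integer power `b ≥ q` keeps the cutoff smooth and gives
`ζ^(b p_i) ≤ ζ^q`. -/
theorem sobolev_integrand_le (hd : d.Admissible) {u ζ D w V : ℝ} {k : ℝ} (i : Fin N) {b : ℕ}
    (hb : d.qMax ≤ b) (hu : 0 ≤ u) (hk : 0 ≤ k) (hζ0 : 0 ≤ ζ) (hζ1 : ζ ≤ 1)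
    (hw : w = max (u ^ d.mMin - k ^ d.mMin) 0) :
    ENNReal.ofReal ((ζ ^ b * w) ^ (d.aExp i - 1) * |ζ ^ b * V + b * ζ ^ (b - 1) * D * w|) ^ d.p i
      ≤ ENNReal.ofReal (2 ^ d.qMax) *
        ENNReal.ofReal (u ^ ((d.m i - d.mMin) * (d.p i - 1)) * |V| ^ d.p i * ζ ^ d.qMax) +
        ENNReal.ofReal (2 ^ d.qMax * b ^ d.qMax) *
        ENNReal.ofReal (u ^ ((d.m i - d.mMin) * (d.p i - 1)) * w ^ d.p i * |D| ^ d.p i) := by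
  have hm := hd.mMin_pos
  have hp := hd.one_lt_p i
  have hp0 := hd.p_pos i
  have hq := hd.one_lt_qMax
  have ha := hd.one_le_aExp i
  have hpq : d.p i ≤ d.qMax := (hd.p_le_q i).trans (Exponents.q_le_qMax i)
  have hw0 : 0 ≤ w := hw ▸ le_max_right _ _
  have hb1 : (1 : ℝ) ≤ b := hq.le.trans hb
  have hwu : w ≤ u ^ d.mMin := by
    rw [hw]
    refine max_le ?_ (by positivity)
    linarith [Real.rpow_nonneg hk d.mMin]
  have hUe : d.mMin * ((d.aExp i - 1) * d.p i) = (d.m i - d.mMin) * (d.p i - 1) := by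
    rw [Exponents.aExp]
    field_simp
    ring
  have h1 : ((ζ ^ b * w) ^ (d.aExp i - 1)) ^ d.p i ≤ u ^ ((d.m i - d.mMin) * (d.p i - 1)) := by
    rw [← hUe, Real.rpow_mul hu, ← Real.rpow_mul (by positivity)]
    have : 0 ≤ (d.aExp i - 1) * d.p i := mul_nonneg (by linarith) hp0.le
    gcongr
    exact (mul_le_of_le_one_left hw0 (pow_le_one₀ hζ0 hζ1)).trans hwu
  have h2 : |ζ ^ b * V + b * ζ ^ (b - 1) * D * w| ^ d.p i
      ≤ 2 ^ d.qMax * (|V| ^ d.p i * ζ ^ d.qMax) +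
        2 ^ d.qMax * b ^ d.qMax * (w ^ d.p i * |D| ^ d.p i) := by
    have e1 : |ζ ^ b * V + b * ζ ^ (b - 1) * D * w| ≤ ζ ^ b * |V| + b * |D| * w := by
      refine (abs_add_le _ _).trans ?_
      rw [abs_mul, abs_mul, abs_mul, abs_mul, abs_of_nonneg (pow_nonneg hζ0 b),
        abs_of_nonneg (pow_nonneg hζ0 _), abs_of_nonneg hw0, Nat.abs_cast]
      gcongr
      exact mul_le_of_le_one_right (by positivity) (pow_le_one₀ hζ0 hζ1)
    have e2 : (ζ ^ b) ^ d.p i ≤ ζ ^ d.qMax := by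
      rw [← Real.rpow_natCast, ← Real.rpow_mul hζ0]
      refine Real.rpow_le_rpow_of_exponent_ge' hζ0 hζ1 (by linarith) ?_
      nlinarith
    have e3 : (2 : ℝ) ^ d.p i ≤ 2 ^ d.qMax := Real.rpow_le_rpow_of_exponent_le (by norm_num) hpq
    have e4 : (b : ℝ) ^ d.p i ≤ b ^ d.qMax := Real.rpow_le_rpow_of_exponent_le hb1 hpq
    calc |ζ ^ b * V + b * ζ ^ (b - 1) * D * w| ^ d.p i
        ≤ (ζ ^ b * |V| + b * |D| * w) ^ d.p i := by gcongr
      _ ≤ 2 ^ d.p i * ((ζ ^ b * |V|) ^ d.p i + (b * |D| * w) ^ d.p i) :=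
          add_rpow_le_two_rpow (by positivity) (by positivity) hp0.le
      _ = 2 ^ d.p i * ((ζ ^ b) ^ d.p i * |V| ^ d.p i +
            (b : ℝ) ^ d.p i * |D| ^ d.p i * w ^ d.p i) := by
          rw [Real.mul_rpow (by positivity) (by positivity),
            Real.mul_rpow (by positivity) hw0, Real.mul_rpow (by positivity) (by positivity)]
      _ ≤ 2 ^ d.qMax * (ζ ^ d.qMax * |V| ^ d.p i +
            (b : ℝ) ^ d.qMax * |D| ^ d.p i * w ^ d.p i) := by gcongr
      _ = _ := by ring
  rw [ENNReal.ofReal_rpow_of_nonneg (by positivity) hp0.le,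
    Real.mul_rpow (by positivity) (abs_nonneg _),
    ← ENNReal.ofReal_mul (by positivity), ← ENNReal.ofReal_mul (by positivity),
    ← ENNReal.ofReal_add (by positivity) (by positivity)]
  refine ENNReal.ofReal_le_ofReal ?_
  calc _ ≤ u ^ ((d.m i - d.mMin) * (d.p i - 1)) *
        (2 ^ d.qMax * (|V| ^ d.p i * ζ ^ d.qMax) +
        2 ^ d.qMax * b ^ d.qMax * (w ^ d.p i * |D| ^ d.p i)) := by gcongr
    _ = _ := by ring

/-- The exponent of `1/ε` in the pointwise bound of the parabolic embedding. -/
def interpExp (d : Exponents N) : ℝ :=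
  sobExp d.aExp d.pMean * (((N : ℝ) - d.pMean) / N) + 2 * (d.pMean / N)

/-- The constant in the pointwise bound of the parabolic embedding. -/
def interpConst (d : Exponents N) : ℝ :=
  (1 / min 1 d.mMin) ^ (sobExp d.aExp d.pMean * (((N : ℝ) - d.pMean) / N)) *
    (1 / gConst d.mMin) ^ (d.pMean / N)

theorem _root_.PDG.Exponents.Admissible.sobExp_pos (hd : d.Admissible) :
    0 < sobExp d.aExp d.pMean := by
  have := hd.nonempty
  have h1 : 0 < ∑ i, d.aExp i := Finset.sum_pos
    (fun i _ => lt_of_lt_of_le one_pos (hd.one_le_aExp i)) Finset.univ_nonempty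
  have h2 := hd.pMean_pos
  have h3 : 0 < (N : ℝ) - d.pMean := by linarith [hd.pMean_lt]
  rw [sobExp]
  positivity

/-- At such points `u` exceeds `k` by the fraction `ε`, so `u^m` is bounded by a multiple of `w/ε`
and `u^(m+1)` by a multiple of `g/ε²`. The factorization of `u^(m+𝓜)` from `mMin_add_calM` combines
the two. -/
theorem interp_integrand_le (hd : d.Admissible) {u k K ε : ℝ} (hk : 0 < k)
    (hε0 : 0 < ε) (hε1 : ε ≤ 1) (hkK : k + ε * K ≤ K) (hu : k + ε * K < u) :
    ENNReal.ofReal (u ^ (d.mMin + d.calM))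
      ≤ ENNReal.ofReal (interpConst d * (1 / ε) ^ interpExp d) *
        ((ENNReal.ofReal (max (u ^ d.mMin - k ^ d.mMin) 0) ^ sobExp d.aExp d.pMean) ^
            (((N : ℝ) - d.pMean) / N) *
          ENNReal.ofReal (gFun d.mMin (u ^ d.mMin) (k ^ d.mMin)) ^ (d.pMean / N)) := by
  have hm := hd.mMin_pos
  have hN := hd.cast_pos
  have hP := hd.pMean_pos
  have hNP : 0 < (N : ℝ) - d.pMean := by linarith [hd.pMean_lt]
  have hσ := hd.sobExp_pos
  have hK : 0 < K := by
    by_contra hK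
    push Not at hK
    nlinarith
  have hu0 : 0 < u := by
    have : 0 < ε * K := by positivity
    linarith
  -- Indeed `(1 - ε)(k + εK) = k + ε(K - k - εK) ≥ k`.
  have hku : k ≤ (1 - ε) * u := by nlinarith
  set s := ((N : ℝ) - d.pMean) / N with hs
  set σ := sobExp d.aExp d.pMean with hσd
  have hs0 : 0 < s := by positivity
  have hw := rpow_sub_rpow_ge hm hε0.le hε1 hu0.le hk.le hku
  have hg := le_gFun_rpow hm hε0.le hε1 hk hku
  have hc := gConst_pos hm
  set w := max (u ^ d.mMin - k ^ d.mMin) 0 with hwd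
  set g := gFun d.mMin (u ^ d.mMin) (k ^ d.mMin) with hgd
  have hw0 : 0 ≤ w := le_max_right _ _
  have hg0 : 0 ≤ g := gFun_nonneg hm (by positivity)
  have h1 : u ^ d.mMin ≤ 1 / min 1 d.mMin * (1 / ε) * w := by
    have : min 1 d.mMin * ε * u ^ d.mMin ≤ w := hw.trans (le_max_left _ _)
    calc u ^ d.mMin = 1 / min 1 d.mMin * (1 / ε) * (min 1 d.mMin * ε * u ^ d.mMin) := by
          field_simp
      _ ≤ _ := by gcongr
  have h2 : u ^ (d.mMin + 1) ≤ 1 / gConst d.mMin * (1 / ε) ^ 2 * g := by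
    calc u ^ (d.mMin + 1)
        = 1 / gConst d.mMin * (1 / ε) ^ 2 * (gConst d.mMin * ε ^ 2 * u ^ (d.mMin + 1)) := by
          field_simp
      _ ≤ _ := by gcongr
  have h3 : u ^ (d.mMin + d.calM)
      = (u ^ d.mMin) ^ (σ * s) * (u ^ (d.mMin + 1)) ^ (d.pMean / N) := by
    rw [hd.mMin_add_calM, ← Real.rpow_mul hu0.le, ← Real.rpow_mul hu0.le, ← Real.rpow_add hu0]
  have h4 : u ^ (d.mMin + d.calM) ≤ interpConst d * (1 / ε) ^ interpExp d *
      (w ^ (σ * s) * g ^ (d.pMean / N)) := by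
    rw [h3]
    calc (u ^ d.mMin) ^ (σ * s) * (u ^ (d.mMin + 1)) ^ (d.pMean / N)
        ≤ (1 / min 1 d.mMin * (1 / ε) * w) ^ (σ * s) *
            (1 / gConst d.mMin * (1 / ε) ^ 2 * g) ^ (d.pMean / N) := by gcongr
      _ = _ := by
          rw [Real.mul_rpow (by positivity) hw0, Real.mul_rpow (by positivity) (by positivity),
            Real.mul_rpow (by positivity) hg0, Real.mul_rpow (by positivity) (by positivity),
            interpConst, interpExp, ← hs, ← hσd, Real.rpow_add (by positivity),
            ← Real.rpow_natCast (1 / ε) 2, ← Real.rpow_mul (by positivity)]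
          push_cast
          ring
  have hI : 0 ≤ interpConst d * (1 / ε) ^ interpExp d := by
    unfold interpConst
    positivity
  rw [← ENNReal.rpow_mul, ENNReal.ofReal_rpow_of_nonneg hw0 (by positivity),
    ENNReal.ofReal_rpow_of_nonneg hg0 (by positivity), ← ENNReal.ofReal_mul (by positivity),
    ← ENNReal.ofReal_mul hI]
  exact ENNReal.ofReal_le_ofReal h4

theorem lintegral_cyl (r : Fin N → ℝ) (η : ℝ) (y : Fin N → ℝ) (τ : ℝ) {f : SpaceTime N → ℝ≥0∞}
    (hf : Measurable f) :
    ∫⁻ z in cyl r η y τ, f z = ∫⁻ t in Ioo (τ - η) τ, ∫⁻ x in box r y, f (x, t) := by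
  rw [cyl, Measure.volume_eq_prod, ← Measure.prod_restrict, lintegral_prod_symm _ hf.aemeasurable]

theorem measurable_gFun {m : ℝ} (hm : 0 < m) (b : ℝ) : Measurable fun a => gFun m a b := by
  unfold gFun
  refine Measurable.const_mul (Continuous.measurable ?_) _
  refine intervalIntegral.continuous_primitive (fun a' b' => ?_) b
  refine (intervalIntegral.intervalIntegrable_rpow' ?_).mul_continuousOn (by fun_prop)
  have : 0 < 1 / m := by positivity
  linarith

theorem isCompact_closure_box (r y : Fin N → ℝ) : IsCompact (closure (box r y)) := by
  refine (Bornology.IsBounded.subset (Metric.isBounded_closedBall (x := y) (r := ∑ i, |r i|))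
    fun x hx => ?_).isCompact_closure
  rw [Metric.mem_closedBall, dist_pi_le_iff (Finset.sum_nonneg fun _ _ => abs_nonneg _)]
  intro i
  rw [Real.dist_eq]
  exact (hx i).le.trans ((le_abs_self _).trans (Finset.single_le_sum (f := fun i => |r i|)
    (fun _ _ => abs_nonneg _) (Finset.mem_univ i)))

theorem closure_box_subset (r y : Fin N → ℝ) {r' : Fin N → ℝ} (h : ∀ i, r i < r' i) :
    closure (box r y) ⊆ box r' y := by
  have hc : IsClosed {x : Fin N → ℝ | ∀ i, |x i - y i| ≤ r i} := by
    simp only [ofPred_forall]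
    exact isClosed_iInter fun i => isClosed_le (by fun_prop) continuous_const
  have h1 : closure (box r y) ⊆ {x : Fin N → ℝ | ∀ i, |x i - y i| ≤ r i} :=
    closure_minimal (fun x hx i => (hx i).le) hc
  exact fun x hx i => (h1 hx i).trans_lt (h i)

/-- The parabolic embedding obtained by integrating the Sobolev inequality on time slices. -/
theorem lintegral_interp_le (hd : d.Admissible) {u : SpaceTime N → ℝ}
    (hum : Measurable u) {k K ε : ℝ} (hk : 0 < k) (hε0 : 0 < ε) (hε1 : ε ≤ 1)
    (hkK : k + ε * K ≤ K) {r r' : Fin N → ℝ} {η η' : ℝ} {y : Fin N → ℝ} {τ : ℝ}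
    (hr : ∀ i, r' i ≤ r i) (hη : η' ≤ η) {ζ : SpaceTime N → ℝ} (hζm : Measurable ζ) {b : ℕ}
    (hζ : ∀ z ∈ cyl r' η' y τ, ζ z = 1) {E : Fin N → ℝ → ℝ≥0∞} (hEm : ∀ i, Measurable (E i))
    {R A : ℝ≥0∞} (hEA : ∀ i, ∫⁻ t in Ioo (τ - η) τ, E i t ≤ A) (hA : A ≠ ⊤)
    (hsob : ∀ᵐ t, t ∈ Ioo (τ - η) τ → (∀ i, E i t ≠ ⊤) →
      (∫⁻ x, ENNReal.ofReal (ζ (x, t) ^ b * max (u (x, t) ^ d.mMin - k ^ d.mMin) 0) ^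
          sobExp d.aExp d.pMean) ^ (((N : ℝ) - d.pMean) / N)
        ≤ sobConst d.p d.aExp d.pMean * ∏ i, E i t ^ (d.pMean / (N * d.p i)))
    (hsup : ∀ᵐ t, t ∈ Ioo (τ - η) τ → ∫⁻ x in box r y,
      ENNReal.ofReal (gFun d.mMin (u (x, t) ^ d.mMin) (k ^ d.mMin) * ζ (x, t) ^ d.qMax) ≤ R) :
    ∫⁻ z in cyl r' η' y τ, ENNReal.ofReal (superPow u (k + ε * K) (d.mMin + d.calM) z)
      ≤ ENNReal.ofReal (interpConst d * (1 / ε) ^ interpExp d) *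
        (sobConst d.p d.aExp d.pMean * A * R ^ (d.pMean / N)) := by
  have hN := hd.cast_pos
  have hP := hd.pMean_pos
  have hNP : 0 < (N : ℝ) - d.pMean := by linarith [hd.pMean_lt]
  have hσ := hd.sobExp_pos
  have hm := hd.mMin_pos
  set s := ((N : ℝ) - d.pMean) / N with hs
  set σ := sobExp d.aExp d.pMean with hσd
  have hs0 : 0 < s := by positivity
  have hPN0 : 0 < d.pMean / N := by positivity
  have hsum : s + d.pMean / N = 1 := by rw [hs]; field_simp; ring
  set κ := ENNReal.ofReal (interpConst d * (1 / ε) ^ interpExp d) with hκ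
  set S := sobConst d.p d.aExp d.pMean with hS
  have hκt : κ ≠ ⊤ := ENNReal.ofReal_ne_top
  have hSt : S ≠ ⊤ := sobConst_ne_top hd.one_lt _ _ hP
  have hIoo : Ioo (τ - η') τ ⊆ Ioo (τ - η) τ := Ioo_subset_Ioo_left (by linarith)
  have hgm : Measurable fun z => gFun d.mMin (u z ^ d.mMin) (k ^ d.mMin) :=
    (measurable_gFun hm (k ^ d.mMin)).comp (hum.pow_const _)
  -- The Sobolev inequality on a slice requires finite gradient integrals; these are finite for
  -- almost every time because their time integrals are.
  have hfin : ∀ᵐ t, t ∈ Ioo (τ - η) τ → ∀ i, E i t ≠ ⊤ := by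
    rw [← ae_restrict_iff' measurableSet_Ioo, ae_all_iff]
    intro i
    exact (ae_lt_top (hEm i) (ne_top_of_le_ne_top hA (hEA i))).mono fun t ht => ht.ne
  have hslice : ∀ᵐ t, t ∈ Ioo (τ - η') τ → ∫⁻ x in box r' y,
      ENNReal.ofReal (superPow u (k + ε * K) (d.mMin + d.calM) (x, t))
        ≤ κ * (S * (∏ i, E i t ^ (d.pMean / (N * d.p i))) * R ^ (d.pMean / N)) := by
    filter_upwards [hsob, hsup, hfin] with t h1 h2 h3 ht
    have ht' := hIoo ht
    set W : (Fin N → ℝ) → ℝ≥0∞ := fun x =>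
      ENNReal.ofReal (ζ (x, t) ^ b * max (u (x, t) ^ d.mMin - k ^ d.mMin) 0) ^ σ with hW
    set H : (Fin N → ℝ) → ℝ≥0∞ := fun x =>
      ENNReal.ofReal (gFun d.mMin (u (x, t) ^ d.mMin) (k ^ d.mMin) * ζ (x, t) ^ d.qMax) with hH
    have hWm : Measurable W := by fun_prop
    have hHm : Measurable H := by
      have : Measurable fun x : Fin N → ℝ =>
        gFun d.mMin (u (x, t) ^ d.mMin) (k ^ d.mMin) := hgm.comp (by fun_prop)
      fun_prop
    calc ∫⁻ x in box r' y, ENNReal.ofReal (superPow u (k + ε * K) (d.mMin + d.calM) (x, t))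
        ≤ ∫⁻ x in box r' y, κ * (W x ^ s * H x ^ (d.pMean / N)) := by
          refine setLIntegral_mono' (isOpen_box _ _).measurableSet fun x hx => ?_
          rw [superPow]
          split_ifs with hlt
          · have := interp_integrand_le hd hk hε0 hε1 hkK hlt
            have hζ1 : ζ (x, t) = 1 := hζ _ ⟨hx, ht⟩
            simpa only [hW, hH, hζ1, one_pow, one_mul, Real.one_rpow, mul_one] using this
          · simp
      _ = κ * ∫⁻ x in box r' y, W x ^ s * H x ^ (d.pMean / N) := lintegral_const_mul' _ _ hκt
      -- Hölder's inequality in space with the weights `(N - p)/N` and `p/N`, whose sum is one.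
      _ ≤ κ * ((∫⁻ x in box r' y, W x) ^ s * (∫⁻ x in box r' y, H x) ^ (d.pMean / N)) := by
          gcongr
          exact ENNReal.lintegral_mul_norm_pow_le hWm.aemeasurable hHm.aemeasurable hs0.le
            hPN0.le hsum
      _ ≤ κ * ((∫⁻ x, W x) ^ s * (∫⁻ x in box r y, H x) ^ (d.pMean / N)) := by
          gcongr
          · exact Measure.restrict_le_self
          · exact box_mono hr
      _ ≤ κ * ((S * ∏ i, E i t ^ (d.pMean / (N * d.p i))) * R ^ (d.pMean / N)) := by
          gcongr
          · exact h1 ht' (h3 ht')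
          · exact h2 ht'
  -- Hölder's inequality in time over all directions; the weights `p/(N p_i)` add up to one because
  -- `p` is the harmonic mean.
  have hprod : ∫⁻ t in Ioo (τ - η) τ, ∏ i, E i t ^ (d.pMean / (N * d.p i)) ≤ A := by
    have hexp : ∑ i, d.pMean / (N * d.p i) = 1 := by
      have : ∀ i, d.pMean / (N * d.p i) = d.pMean / N * (1 / d.p i) := fun i => by
        have := (hd.p_pos i).ne'
        field_simp
      simp_rw [this]
      rw [← Finset.mul_sum, hd.sum_inv_p]
      field_simp
    have hnn : ∀ i ∈ Finset.univ, 0 ≤ d.pMean / (N * d.p i) := fun i _ => by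
      have := hd.p_pos i
      positivity
    refine (ENNReal.lintegral_prod_norm_pow_le Finset.univ
      (fun i _ => (hEm i).aemeasurable) hexp hnn).trans ?_
    calc ∏ i, (∫⁻ t in Ioo (τ - η) τ, E i t) ^ (d.pMean / (N * d.p i))
        ≤ ∏ i, A ^ (d.pMean / (N * d.p i)) := Finset.prod_le_prod' fun i hi =>
          ENNReal.rpow_le_rpow (hEA i) (hnn i hi)
      _ = A := by rw [← rpow_sum_of_nonneg _ hnn, hexp, ENNReal.rpow_one]
  rw [lintegral_cyl _ _ _ _ (measurable_superPow hum _ _).ennreal_ofReal]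
  calc ∫⁻ t in Ioo (τ - η') τ, ∫⁻ x in box r' y,
        ENNReal.ofReal (superPow u (k + ε * K) (d.mMin + d.calM) (x, t))
      ≤ ∫⁻ t in Ioo (τ - η') τ,
          κ * (S * (∏ i, E i t ^ (d.pMean / (N * d.p i))) * R ^ (d.pMean / N)) :=
        lintegral_mono_ae ((ae_restrict_iff' measurableSet_Ioo).2 hslice)
    _ ≤ ∫⁻ t in Ioo (τ - η) τ,
          κ * (S * (∏ i, E i t ^ (d.pMean / (N * d.p i))) * R ^ (d.pMean / N)) :=
        lintegral_mono_set hIoo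
    _ = κ * (S * (∫⁻ t in Ioo (τ - η) τ, ∏ i, E i t ^ (d.pMean / (N * d.p i))) *
          R ^ (d.pMean / N)) := by
        have hpm : Measurable fun t => ∏ i, E i t ^ (d.pMean / (N * d.p i)) :=
          Finset.measurable_prod _ fun i _ => (hEm i).pow_const _
        rw [lintegral_const_mul' _ _ hκt, lintegral_mul_const _ (hpm.const_mul _),
          lintegral_const_mul' _ _ hSt]
    _ ≤ _ := by gcongr

/-- The integer power of the cutoff used in the embedding. -/
def cutPow (d : Exponents N) : ℕ := ⌈d.qMax⌉₊

/-- The factor between the energy and the Sobolev quantities. -/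
def gradConst (d : Exponents N) (C : ℝ) : ℝ :=
  2 ^ d.qMax * C + 2 ^ d.qMax * (cutPow d : ℝ) ^ d.qMax * (1 / C)

/-- The constant of one step of the iteration. -/
def stepConst (d : Exponents N) (C : ℝ) : ℝ≥0∞ :=
  ENNReal.ofReal (2 ^ d.calM * interpConst d) * sobConst d.p d.aExp d.pMean *
    ENNReal.ofReal (gradConst d C) * ENNReal.ofReal (C * rightConst d) ^ (1 + d.pMean / N)

/-- The exponent of `1/ε` in one step of the iteration. -/
def stepExp (d : Exponents N) : ℝ := interpExp d + d.qMax * (1 + d.pMean / N)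

theorem stepConst_ne_top (hd : d.Admissible) (C : ℝ) : stepConst d C ≠ ⊤ := by
  have hN := hd.cast_pos
  have hP := hd.pMean_pos
  refine ENNReal.mul_ne_top (ENNReal.mul_ne_top (ENNReal.mul_ne_top ENNReal.ofReal_ne_top
    (sobConst_ne_top hd.one_lt _ _ hP)) ENNReal.ofReal_ne_top)
    (ENNReal.rpow_ne_top_of_nonneg (by positivity) ENNReal.ofReal_ne_top)

theorem coefSum_pos {K θ : ℝ} {ρ : Fin N → ℝ} (hK : 0 < K) (hθ : 0 < θ)
    (hρ : ∀ i, 0 < ρ i) : 0 < coefSum d K θ ρ := by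
  have h1 : 0 ≤ ∑ i, K ^ (d.lam i - d.calL) / ρ i ^ d.p i := Finset.sum_nonneg fun i _ => by
    have := hρ i
    positivity
  have h2 : 0 ≤ ∑ i, K ^ (d.Lam i - d.calL) / ρ i ^ d.q i := Finset.sum_nonneg fun i _ => by
    have := hρ i
    positivity
  have h3 : 0 < K ^ (1 - d.calL) / θ := by positivity
  rw [coefSum]
  linarith

/-- One step of the De Giorgi iteration. -/
theorem MemPDG.step {Ω : Set (Fin N → ℝ)} {T C : ℝ} {u u' : SpaceTime N → ℝ}
    (hd : d.Admissible) (hC : 0 < C) (hLM : d.calL ≤ d.calM) (hu : MemPDG d C Ω T u)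
    (hΩ : IsOpen Ω) (hu' : u' =ᵐ[volume.restrict (Ω ×ˢ Ioo 0 T)] u) (hu'm : Measurable u')
    (hu'0 : ∀ z, 0 ≤ u' z) {K k ε θ : ℝ} {ρ r : Fin N → ℝ} {η : ℝ} {y : Fin N → ℝ} {τ : ℝ}
    (hK : 0 < K) (hk : K / 2 ≤ k) (hε : 0 < ε) (hε1 : ε ≤ 1) (hkK : k + ε * K ≤ K)
    (hρ : ∀ i, 0 < ρ i) (hθ : 0 < θ) (hr : ∀ i, 0 < r i) (hη : 0 < η)
    (hsub : cyl (fun i => 8 * r i) (8 * η) y τ ⊆ parCyl Ω T)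
    (hY : ∫⁻ z in cyl r η y τ, ENNReal.ofReal (superPow u' k (d.mMin + d.calL) z) ≠ ⊤) :
    ∫⁻ z in cyl (fun i => r i - ε * ρ i) (η - ε * θ) y τ,
        ENNReal.ofReal (superPow u' (k + ε * K) (d.mMin + d.calL) z)
      ≤ stepConst d C * ENNReal.ofReal ((1 / ε) ^ stepExp d) *
          ENNReal.ofReal (K ^ (d.calL - d.calM)) *
          (ENNReal.ofReal (coefSum d K θ ρ) *
            ∫⁻ z in cyl r η y τ, ENNReal.ofReal (superPow u' k (d.mMin + d.calL) z)) ^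
              (1 + d.pMean / N) := by
  have hm := hd.mMin_pos
  have hN := hd.cast_pos
  have hP := hd.pMean_pos
  have hPN : 0 < d.pMean / N := by positivity
  have hk0 : 0 < k := by linarith
  have hq := hd.one_lt_qMax
  set Y := ∫⁻ z in cyl r η y τ, ENNReal.ofReal (superPow u' k (d.mMin + d.calL) z) with hYd
  set ζ := stepCutoff r (fun i => ε * ρ i) y (τ - η) (ε * θ) with hζd
  have hδ : ∀ i, 0 < ε * ρ i := fun i => mul_pos hε (hρ i)
  have he : 0 < ε * θ := mul_pos hε hθ
  have hζs : ContDiff ℝ ∞ ζ := contDiff_stepCutoff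
  have hζ0 : ∀ z, 0 ≤ ζ z := stepCutoff_nonneg
  have hζ1 : ∀ z, ζ z ≤ 1 := stepCutoff_le_one
  have hζbox : ∀ z : SpaceTime N, z.1 ∉ box r y → ζ z = 0 := fun z hz =>
    stepCutoff_eq_zero_of_notMem hδ hz
  obtain ⟨v, v', hv, hv'm, hvv', hen⟩ := hu.energy_measurable hΩ hu' hk0
  obtain ⟨hE1, hE2⟩ := hen r η y τ hr hη hsub ζ (isCutoff_of_contDiff hζs hζ0 hζ1 hζbox)
  -- The cutoff vanishes at the bottom of the cylinder, which removes the initial term of the energy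
  -- inequality.
  have hζi : ∀ x, ζ (x, τ - η) = 0 := fun x => stepCutoff_eq_zero_of_le he le_rfl
  simp only [hζi, Real.zero_rpow (by linarith : d.qMax ≠ 0), mul_zero, ENNReal.ofReal_zero,
    lintegral_zero, zero_add] at hE1 hE2
  set R := energyRight d C u' k r η y τ ζ with hR
  have hRY : R ≤ ENNReal.ofReal (C * (rightConst d * (1 / ε) ^ d.qMax * coefSum d K θ ρ)) * Y :=
    energyRight_le hd hC hu'0 hK hk hε hε1 hρ hθ
  have hRt : R ≠ ⊤ := ne_top_of_le_ne_top (ENNReal.mul_ne_top ENNReal.ofReal_ne_top hY) hRY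
  obtain ⟨hbox, hτ0, hτT⟩ := cyl_subset_parCyl (fun i => by linarith [hr i]) (by linarith) hsub
  have hKc : closure (box r y) ⊆ Ω :=
    (closure_box_subset r y fun i => by linarith [hr i]).trans hbox
  have hIoo : Ioo (τ - η) τ ⊆ Ioo 0 T := Ioo_subset_Ioo (by linarith) hτT
  set b := cutPow d with hb
  have hbq : d.qMax ≤ b := Nat.le_ceil _
  have hb2 : 2 ≤ b := by
    have : (1 : ℝ) < b := hq.trans_le hbq
    exact_mod_cast this
  set w : SpaceTime N → ℝ := fun z => max (u' z ^ d.mMin - k ^ d.mMin) 0 with hw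
  have hwm : Measurable w := by fun_prop
  have hζm : Measurable ζ := hζs.continuous.measurable
  have hDm : ∀ i, Measurable (spaceDeriv i ζ) := fun i =>
    ((hζs.continuous_fderiv (by simp)).clm_apply continuous_const).measurable
  have hwae : w =ᵐ[volume.restrict (Ω ×ˢ Ioo 0 T)]
      fun z => max (u z ^ d.mMin - k ^ d.mMin) 0 := hu'.mono fun z hz => by
    simp only [hw, hz]
  have hsob := sobolev_slices hd.one_lt hd.one_lt_p hd.one_le_aExp hP hd.pMean_lt hd.sum_inv_p
    hΩ hv hwae hvv' hwm (fun z => le_max_right _ _) hv'm (hζs.pow b)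
    (fun z => pow_nonneg (hζ0 z) b) (isCompact_closure_box r y) hKc
    (fun z hz => by rw [hζbox z fun h => hz (subset_closure h), zero_pow (by omega)])
  simp only [spaceDeriv_pow hζs] at hsob
  set G : Fin N → SpaceTime N → ℝ≥0∞ := fun i z => ENNReal.ofReal ((ζ z ^ b * w z) ^ (d.aExp i - 1) *
    |ζ z ^ b * v' i z + b * ζ z ^ (b - 1) * spaceDeriv i ζ z * w z|) ^ d.p i with hG
  have hGm : ∀ i, Measurable (G i) := fun i => by
    have := hDm i
    have := hv'm i
    fun_prop
  set E : Fin N → ℝ → ℝ≥0∞ := fun i t => ∫⁻ x, G i (x, t) with hE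
  have hEm : ∀ i, Measurable (E i) := fun i => (hGm i).lintegral_prod_left'
  have hEA : ∀ i, ∫⁻ t in Ioo (τ - η) τ, E i t ≤ ENNReal.ofReal (gradConst d C) * R := by
    intro i
    -- The integrand vanishes with `ζ`. The derivative of `ζ^b` carries `ζ^(b-1)`, which is why `b ≥
    -- 2` is needed.
    have hEbox : ∀ t, E i t = ∫⁻ x in box r y, G i (x, t) := by
      intro t
      refine (setLIntegral_eq_of_support_subset ?_).symm
      intro x hx
      by_contra hn
      refine hx ?_
      have h0 : ζ (x, t) = 0 := hζbox _ hn
      have hp0 := hd.p_pos i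
      simp [hG, h0, zero_pow (show b - 1 ≠ 0 by omega), zero_pow (show b ≠ 0 by omega), hp0]
    simp_rw [hEbox]
    rw [← lintegral_cyl r η y τ (hGm i)]
    have hI1 : ∫⁻ z in cyl r η y τ, ENNReal.ofReal
        (u' z ^ ((d.m i - d.mMin) * (d.p i - 1)) * |v' i z| ^ d.p i * ζ z ^ d.qMax)
          ≤ ENNReal.ofReal C * R := by
      have := mul_le_mul_right (hE2 i) (ENNReal.ofReal C)
      rwa [← mul_assoc, ← ENNReal.ofReal_mul hC.le, mul_one_div_cancel hC.ne', ENNReal.ofReal_one,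
        one_mul] at this
    -- The term with the derivative of the cutoff is already one of the summands of `R`.
    have hI2 : ∫⁻ z in cyl r η y τ, ENNReal.ofReal
        (u' z ^ ((d.m i - d.mMin) * (d.p i - 1)) * w z ^ d.p i * |spaceDeriv i ζ z| ^ d.p i)
          ≤ ENNReal.ofReal (1 / C) * R := by
      have h1 : ENNReal.ofReal C * ∫⁻ z in cyl r η y τ, ENNReal.ofReal
        (u' z ^ ((d.m i - d.mMin) * (d.p i - 1)) * w z ^ d.p i * |spaceDeriv i ζ z| ^ d.p i)
          ≤ R := by
        rw [hR, energyRight]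
        refine le_trans ?_ le_self_add
        refine le_trans ?_ le_add_self
        gcongr
        exact Finset.single_le_sum (f := fun i => ∫⁻ z in cyl r η y τ, ENNReal.ofReal
          (u' z ^ ((d.m i - d.mMin) * (d.p i - 1)) * max (u' z ^ d.mMin - k ^ d.mMin) 0 ^ d.p i *
            |spaceDeriv i ζ z| ^ d.p i)) (fun _ _ => zero_le) (Finset.mem_univ i)
      have := mul_le_mul_right h1 (ENNReal.ofReal (1 / C))
      rwa [← mul_assoc, ← ENNReal.ofReal_mul (by positivity), one_div_mul_cancel hC.ne',
        ENNReal.ofReal_one, one_mul] at this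
    have hm1 : Measurable fun z => ENNReal.ofReal
        (u' z ^ ((d.m i - d.mMin) * (d.p i - 1)) * |v' i z| ^ d.p i * ζ z ^ d.qMax) := by
      have := hv'm i
      fun_prop
    calc ∫⁻ z in cyl r η y τ, G i z
        ≤ ∫⁻ z in cyl r η y τ, (ENNReal.ofReal (2 ^ d.qMax) * ENNReal.ofReal
            (u' z ^ ((d.m i - d.mMin) * (d.p i - 1)) * |v' i z| ^ d.p i * ζ z ^ d.qMax) +
          ENNReal.ofReal (2 ^ d.qMax * b ^ d.qMax) * ENNReal.ofReal
            (u' z ^ ((d.m i - d.mMin) * (d.p i - 1)) * w z ^ d.p i *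
              |spaceDeriv i ζ z| ^ d.p i)) :=
          lintegral_mono fun z =>
            sobolev_integrand_le hd i hbq (hu'0 z) hk0.le (hζ0 z) (hζ1 z) rfl
      _ ≤ ENNReal.ofReal (2 ^ d.qMax) * (ENNReal.ofReal C * R) +
          ENNReal.ofReal (2 ^ d.qMax * b ^ d.qMax) * (ENNReal.ofReal (1 / C) * R) := by
          rw [lintegral_add_left (hm1.const_mul _), lintegral_const_mul' _ _ ENNReal.ofReal_ne_top,
            lintegral_const_mul' _ _ ENNReal.ofReal_ne_top]
          gcongr
      _ = ENNReal.ofReal (gradConst d C) * R := by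
          rw [← mul_assoc, ← mul_assoc, ← ENNReal.ofReal_mul (by positivity),
            ← ENNReal.ofReal_mul (by positivity), ← add_mul,
            ← ENNReal.ofReal_add (by positivity) (by positivity), gradConst]
  have hint := lintegral_interp_le hd hu'm hk0 hε hε1 hkK (r := r)
    (r' := fun i => r i - ε * ρ i) (η := η) (η' := η - ε * θ) (y := y) (τ := τ)
    (fun i => by linarith [hδ i]) (by linarith) hζm (b := b)
    (fun z hz => stepCutoff_eq_one hδ he hz.1 (by linarith [hz.2.1])) hEm hEA
    (ENNReal.mul_ne_top ENNReal.ofReal_ne_top hRt)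
    (hsob.mono fun t ht htm => ht (hIoo htm)) hE1
  have hIc : 0 ≤ interpConst d := by
    have := gConst_pos hm
    unfold interpConst
    positivity
  have hgc : 0 ≤ gradConst d C := by
    unfold gradConst
    positivity
  have hrc := rightConst_pos hd
  have hcs := coefSum_pos (d := d) hK hθ hρ
  -- Here `𝓛 ≤ 𝓜` enters: above `K/2` the power `m + 𝓛` is at most `2^𝓜 K^(𝓛-𝓜)` times the power `m
  -- + 𝓜`. The gradients then contribute `R` and the supremum in time `R^(p/N)`, which together give
  -- the superlinear power.
  calc ∫⁻ z in cyl (fun i => r i - ε * ρ i) (η - ε * θ) y τ,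
        ENNReal.ofReal (superPow u' (k + ε * K) (d.mMin + d.calL) z)
      ≤ ENNReal.ofReal (2 ^ d.calM * K ^ (d.calL - d.calM)) *
        ∫⁻ z in cyl (fun i => r i - ε * ρ i) (η - ε * θ) y τ,
          ENNReal.ofReal (superPow u' (k + ε * K) (d.mMin + d.calM) z) := by
        refine lintegral_ofReal_le_mul (by positivity) fun z => ?_
        rw [superPow, superPow]
        split_ifs with h
        · have : 0 < ε * K := by positivity
          exact rpow_add_le_of_level (by linarith [Exponents.one_le_calL (d := d)]) hLM hK
            (by linarith)
        · simp
    _ ≤ ENNReal.ofReal (2 ^ d.calM * K ^ (d.calL - d.calM)) *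
        (ENNReal.ofReal (interpConst d * (1 / ε) ^ interpExp d) *
        (sobConst d.p d.aExp d.pMean * (ENNReal.ofReal (gradConst d C) * R) *
          R ^ (d.pMean / N))) := by gcongr
    _ = ENNReal.ofReal (2 ^ d.calM * K ^ (d.calL - d.calM)) *
        (ENNReal.ofReal (interpConst d * (1 / ε) ^ interpExp d) *
        (sobConst d.p d.aExp d.pMean * ENNReal.ofReal (gradConst d C) *
          R ^ (1 + d.pMean / N))) := by
        rw [ENNReal.rpow_add_of_nonneg _ _ zero_le_one hPN.le, ENNReal.rpow_one]
        ring
    _ ≤ ENNReal.ofReal (2 ^ d.calM * K ^ (d.calL - d.calM)) *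
        (ENNReal.ofReal (interpConst d * (1 / ε) ^ interpExp d) *
        (sobConst d.p d.aExp d.pMean * ENNReal.ofReal (gradConst d C) *
          (ENNReal.ofReal (C * (rightConst d * (1 / ε) ^ d.qMax * coefSum d K θ ρ)) * Y) ^
            (1 + d.pMean / N))) := by gcongr
    _ = _ := by
        have e1 : C * (rightConst d * (1 / ε) ^ d.qMax * coefSum d K θ ρ)
            = (C * rightConst d) * ((1 / ε) ^ d.qMax * coefSum d K θ ρ) := by ring
        have hnn : 0 ≤ 1 + d.pMean / N := by positivity
        rw [e1, ENNReal.ofReal_mul (p := C * rightConst d) (by positivity),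
          ENNReal.ofReal_mul (p := (1 / ε) ^ d.qMax) (by positivity),
          ENNReal.mul_rpow_of_nonneg _ _ hnn, ENNReal.mul_rpow_of_nonneg _ _ hnn,
          ENNReal.mul_rpow_of_nonneg _ _ hnn, ENNReal.mul_rpow_of_nonneg _ _ hnn,
          stepConst, stepExp, ENNReal.ofReal_mul (p := 2 ^ d.calM) (by positivity),
          ENNReal.ofReal_mul (p := 2 ^ d.calM) (by positivity),
          ENNReal.ofReal_mul (p := interpConst d) hIc,
          Real.rpow_add (by positivity), ENNReal.ofReal_mul (p := (1 / ε) ^ interpExp d)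
            (by positivity),
          ENNReal.ofReal_rpow_of_nonneg (p := 1 + d.pMean / N) (x := (1 / ε) ^ d.qMax)
            (by positivity) hnn, ← Real.rpow_mul (by positivity)]
        ring

end Step

/-! ### The De Giorgi iteration -/

section Iteration

variable {N : ℕ} {d : Exponents N}

/-- Fast geometric convergence. -/
theorem le_mul_pow_of_superlinear {Y : ℕ → ℝ≥0∞} {A b l : ℝ≥0∞} {β : ℝ} (hβ : 0 < β)
    (hbl : b * l ^ β = 1) (hA : A * Y 0 ^ β ≤ l)
    (hY : ∀ n, Y (n + 1) ≤ A * b ^ n * Y n ^ (1 + β)) (n : ℕ) : Y n ≤ Y 0 * l ^ n := by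
  induction n with
  | zero => simp
  | succ n ih =>
    have h1 : (l ^ n) ^ β = (l ^ β) ^ n := by
      rw [← ENNReal.rpow_natCast, ← ENNReal.rpow_natCast, ← ENNReal.rpow_mul, ← ENNReal.rpow_mul,
        mul_comm]
    calc Y (n + 1) ≤ A * b ^ n * Y n ^ (1 + β) := hY n
      _ = A * b ^ n * (Y n * Y n ^ β) := by
          rw [ENNReal.rpow_add_of_nonneg _ _ zero_le_one hβ.le, ENNReal.rpow_one]
      _ ≤ A * b ^ n * ((Y 0 * l ^ n) * (Y 0 * l ^ n) ^ β) := by gcongr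
      -- The growth `b^n` is cancelled by `b l^β = 1`, and the smallness of `A (Y 0)^β` supplies the
      -- next factor `l`.
      _ = (A * Y 0 ^ β) * (b * l ^ β) ^ n * (Y 0 * l ^ n) := by
          rw [ENNReal.mul_rpow_of_nonneg _ _ hβ.le, h1, mul_pow]
          ring
      _ ≤ l * (b * l ^ β) ^ n * (Y 0 * l ^ n) := by gcongr
      _ = Y 0 * l ^ (n + 1) := by
          rw [hbl, one_pow]
          ring

/-- The ratio of the geometric decay in the iteration. -/
def decay (d : Exponents N) : ℝ≥0∞ :=
  ENNReal.ofReal (((2 : ℝ) ^ stepExp d) ^ (-(1 / (d.pMean / N))))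

/-- The constant in the smallness condition of the iteration. -/
def iterConst (d : Exponents N) (C : ℝ) : ℝ≥0∞ :=
  stepConst d C * ENNReal.ofReal (((2 : ℝ) ^ stepExp d) ^ 2) * (decay d)⁻¹

theorem stepExp_pos (hd : d.Admissible) : 0 < stepExp d := by
  have h1 := hd.pMean_pos
  have h2 := hd.cast_pos
  have h3 := hd.sobExp_pos
  have h4 : 0 < (N : ℝ) - d.pMean := by linarith [hd.pMean_lt]
  have h5 := hd.one_lt_qMax
  unfold stepExp interpExp
  positivity

theorem decay_pos : 0 < decay d := by
  unfold decay
  rw [ENNReal.ofReal_pos]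
  positivity

theorem decay_lt_one (hd : d.Admissible) : decay d < 1 := by
  have h1 := hd.pMean_pos
  have h2 := hd.cast_pos
  rw [decay, ENNReal.ofReal_lt_one]
  refine Real.rpow_lt_one_of_one_lt_of_neg ?_ (neg_lt_zero.2 (by positivity))
  exact Real.one_lt_rpow (by norm_num) (stepExp_pos hd)

theorem ofReal_mul_decay_rpow (hd : d.Admissible) :
    ENNReal.ofReal ((2 : ℝ) ^ stepExp d) * decay d ^ (d.pMean / N) = 1 := by
  have h1 := hd.pMean_pos
  have h2 := hd.cast_pos
  have h3 : (0 : ℝ) < 2 ^ stepExp d := by positivity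
  rw [decay, ENNReal.ofReal_rpow_of_nonneg (by positivity) (by positivity),
    ← ENNReal.ofReal_mul h3.le, ← Real.rpow_mul h3.le]
  have : -(1 / (d.pMean / N)) * (d.pMean / N) = -1 := by field_simp
  rw [this, Real.rpow_neg_one, mul_inv_cancel₀ h3.ne', ENNReal.ofReal_one]

theorem iterConst_ne_top (hd : d.Admissible) (C : ℝ) : iterConst d C ≠ ⊤ :=
  ENNReal.mul_ne_top (ENNReal.mul_ne_top (stepConst_ne_top hd C) ENNReal.ofReal_ne_top)
    (ENNReal.inv_ne_top.2 decay_pos.ne')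

theorem superPow_mono {u : SpaceTime N → ℝ} (hu : ∀ z, 0 ≤ u z) {k k' : ℝ} (hk : k ≤ k') (s : ℝ)
    (z : SpaceTime N) : superPow u k' s z ≤ superPow u k s z := by
  by_cases h : k' < u z
  · rw [superPow, superPow, if_pos h, if_pos (hk.trans_lt h)]
  · rw [superPow, if_neg h]
    exact superPow_nonneg hu _ _ _

theorem cyl_mono {r r' y : Fin N → ℝ} {η η' τ : ℝ} (hr : ∀ i, r i ≤ r' i) (hη : η ≤ η') :
    cyl r η y τ ⊆ cyl r' η' y τ :=
  prod_mono (box_mono hr) (Ioo_subset_Ioo_left (by linarith))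

/-- The De Giorgi iteration: a smallness condition at level `K` implies that `u ≤ K`. -/
theorem MemPDG.ae_le_of_small {Ω : Set (Fin N → ℝ)} {T C : ℝ} {u u' : SpaceTime N → ℝ}
    (hd : d.Admissible) (hC : 0 < C) (hLM : d.calL ≤ d.calM) (hu : MemPDG d C Ω T u)
    (hΩ : IsOpen Ω) (hu' : u' =ᵐ[volume.restrict (Ω ×ˢ Ioo 0 T)] u) (hu'm : Measurable u')
    (hu'0 : ∀ z, 0 ≤ u' z) {K θ : ℝ} {ρ : Fin N → ℝ} {y : Fin N → ℝ} {τ : ℝ}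
    (hK : 0 < K) (hρ : ∀ i, 0 < ρ i) (hθ : 0 < θ)
    (hsub : cyl (fun i => 8 * ρ i) (8 * θ) y τ ⊆ parCyl Ω T)
    (hY : ∫⁻ z in cyl ρ θ y τ, ENNReal.ofReal (superPow u' (K / 2) (d.mMin + d.calL) z) ≠ ⊤)
    (hsmall : iterConst d C * ENNReal.ofReal (K ^ (d.calL - d.calM)) *
      ENNReal.ofReal (coefSum d K θ ρ) ^ (1 + d.pMean / N) *
      (∫⁻ z in cyl ρ θ y τ, ENNReal.ofReal (superPow u' (K / 2) (d.mMin + d.calL) z)) ^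
        (d.pMean / N) ≤ 1) :
    ∀ᵐ z ∂(volume.restrict (cyl (fun i => ρ i / 2) (θ / 2) y τ)), u' z ≤ K := by
  have hN := hd.cast_pos
  have hP := hd.pMean_pos
  have hβ : 0 < d.pMean / N := by positivity
  set β := d.pMean / N with hβd
  -- One sequence governs everything: levels rise from `K/2` to `K` and cylinders shrink from `ρ, θ`
  -- to their halves. Since `f n - f (n+1) = f (n+1)`, step `n` is the one-step estimate with `ε = f
  -- (n+1)`.
  set f : ℕ → ℝ := fun n => (1 / 2 : ℝ) ^ (n + 1) with hf
  have hf0 : ∀ n, 0 < f n := fun n => by positivity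
  have hf1 : ∀ n, f n ≤ 1 / 2 := fun n => by
    rw [hf]
    simp only [pow_succ]
    have : (1 / 2 : ℝ) ^ n ≤ 1 := pow_le_one₀ (by norm_num) (by norm_num)
    linarith
  have hfs : ∀ n, f (n + 1) = f n / 2 := fun n => by
    simp only [hf, pow_succ]
    ring
  set k : ℕ → ℝ := fun n => K * (1 - f n) with hk
  set r : ℕ → Fin N → ℝ := fun n i => ρ i * (1 / 2 + f n) with hr
  set η : ℕ → ℝ := fun n => θ * (1 / 2 + f n) with hη
  set Y : ℕ → ℝ≥0∞ := fun n => ∫⁻ z in cyl (r n) (η n) y τ,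
    ENNReal.ofReal (superPow u' (k n) (d.mMin + d.calL) z) with hYd
  have hf00 : f 0 = 1 / 2 := by simp [hf]
  have hY0 : Y 0 = ∫⁻ z in cyl ρ θ y τ,
      ENNReal.ofReal (superPow u' (K / 2) (d.mMin + d.calL) z) := by
    have e1 : r 0 = ρ := by funext i; simp only [hr, hf00]; ring
    have e2 : η 0 = θ := by simp only [hη, hf00]; ring
    have e3 : k 0 = K / 2 := by simp only [hk, hf00]; ring
    simp only [hYd, e1, e2, e3]
  rw [← hY0] at hY hsmall
  have hrle : ∀ n i, r n i ≤ ρ i := fun n i => by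
    have := hρ i
    have := hf1 n
    simp only [hr]
    nlinarith
  have hηle : ∀ n, η n ≤ θ := fun n => by
    have := hf1 n
    simp only [hη]
    nlinarith
  have hkge : ∀ n, K / 2 ≤ k n := fun n => by
    have := hf1 n
    simp only [hk]
    nlinarith
  have hYle : ∀ n, Y n ≤ Y 0 := fun n => by
    rw [hY0]
    refine (lintegral_mono_set (cyl_mono (hrle n) (hηle n))).trans ?_
    exact lintegral_mono fun z => ENNReal.ofReal_le_ofReal (superPow_mono hu'0 (hkge n) _ z)
  set A := stepConst d C * ENNReal.ofReal (((2 : ℝ) ^ stepExp d) ^ 2) *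
    ENNReal.ofReal (K ^ (d.calL - d.calM)) * ENNReal.ofReal (coefSum d K θ ρ) ^ (1 + β) with hA
  have hstep : ∀ n, Y (n + 1) ≤ A * ENNReal.ofReal ((2 : ℝ) ^ stepExp d) ^ n * Y n ^ (1 + β) := by
    intro n
    have hε : 0 < f (n + 1) := hf0 _
    have hr0 : ∀ i, 0 < r n i := fun i => by
      have := hρ i
      have := hf0 n
      simp only [hr]
      positivity
    have hη0 : 0 < η n := by
      have := hf0 n
      simp only [hη]
      positivity
    have h := hu.step hd hC hLM hΩ hu' hu'm hu'0 (K := K) (k := k n) (ε := f (n + 1)) (θ := θ)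
      (ρ := ρ) (r := r n) (η := η n) (y := y) (τ := τ) hK (hkge n) hε (by linarith [hf1 (n + 1)])
      (by
        have := hf0 n
        simp only [hk, hfs]
        nlinarith) hρ hθ hr0 hη0
      ((cyl_mono (fun i => by linarith [hrle n i]) (by linarith [hηle n])).trans hsub)
      (ne_top_of_le_ne_top hY (hYle n))
    have e1 : (fun i => r n i - f (n + 1) * ρ i) = r (n + 1) := by
      funext i
      simp only [hr, hfs]
      ring
    have e2 : η n - f (n + 1) * θ = η (n + 1) := by
      simp only [hη, hfs]
      ring
    have e3 : k n + f (n + 1) * K = k (n + 1) := by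
      simp only [hk, hfs]
      ring
    -- Here `1/ε = 2^(n+2)`; the two surplus factors explain the square in `iterConst`.
    have e4 : (1 / f (n + 1)) ^ stepExp d = ((2 : ℝ) ^ stepExp d) ^ 2 * (2 ^ stepExp d) ^ n := by
      have : 1 / f (n + 1) = 2 ^ (n + 2) := by
        simp only [hf, one_div, inv_pow, inv_inv]
      rw [this, ← pow_add, ← Real.rpow_natCast, ← Real.rpow_natCast, ← Real.rpow_mul (by norm_num),
        ← Real.rpow_mul (by norm_num), mul_comm (stepExp d)]
      congr 2
      push_cast
      ring
    rw [e1, e2, e3, e4, ENNReal.ofReal_mul (by positivity),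
      ENNReal.mul_rpow_of_nonneg _ _ (by positivity),
      ENNReal.ofReal_pow (p := 2 ^ stepExp d) (by positivity) n] at h
    refine h.trans (le_of_eq ?_)
    rw [hA]
    ring
  have hAl : A * Y 0 ^ β ≤ decay d := by
    have h1 : (decay d)⁻¹ * (A * Y 0 ^ β) ≤ 1 := by
      refine le_of_eq_of_le ?_ hsmall
      rw [hA, iterConst]
      ring
    have h2 := mul_le_mul_right h1 (decay d)
    rwa [← mul_assoc, ENNReal.mul_inv_cancel decay_pos.ne' ((decay_lt_one hd).trans_le le_top).ne,
      one_mul, mul_one] at h2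
  have hconv := le_mul_pow_of_superlinear hβ (ofReal_mul_decay_rpow hd) hAl hstep
  have hlim : Tendsto (fun n => Y 0 * decay d ^ n) atTop (𝓝 0) := by
    have := ENNReal.Tendsto.const_mul (a := Y 0)
      (ENNReal.tendsto_pow_atTop_nhds_zero_of_lt_one (decay_lt_one hd)) (Or.inr hY)
    simpa using this
  -- The half cylinder lies in every cylinder of the sequence and `K` is above every level, so this
  -- integral is below all the `Y n`.
  have hzero : ∫⁻ z in cyl (fun i => ρ i / 2) (θ / 2) y τ,
      ENNReal.ofReal (superPow u' K (d.mMin + d.calL) z) = 0 := by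
    refine le_antisymm (ge_of_tendsto' hlim fun n => ?_) zero_le
    refine le_trans ?_ (hconv n)
    refine (lintegral_mono_set (cyl_mono (r' := r n) (η' := η n) (fun i => ?_) ?_)).trans ?_
    · have := hρ i
      have := hf0 n
      simp only [hr]
      nlinarith
    · have := hf0 n
      simp only [hη]
      nlinarith
    · refine lintegral_mono fun z => ENNReal.ofReal_le_ofReal (superPow_mono hu'0 ?_ _ z)
      have := hf0 n
      simp only [hk]
      nlinarith
  rw [lintegral_eq_zero_iff (measurable_superPow hu'm _ _).ennreal_ofReal] at hzero
  filter_upwards [hzero] with z hz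
  by_contra hlt
  push Not at hlt
  have hz0 : superPow u' K (d.mMin + d.calL) z ≤ 0 := by simpa using hz
  rw [superPow, if_pos hlt] at hz0
  exact absurd hz0 (not_le.2 (Real.rpow_pos_of_pos (hK.trans hlt) _))

end Iteration

/-! ### Integrability of `u^(m+𝓛)` -/

section Finiteness

variable {N : ℕ} {d : Exponents N} {Ω : Set (Fin N → ℝ)} {T C : ℝ} {u u' : SpaceTime N → ℝ}

theorem prod_Ioo_subset_parCyl : Ω ×ˢ Ioo 0 T ⊆ parCyl Ω T :=
  prod_mono le_rfl Ioo_subset_Ioc_self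

/-- Taking the maximum with zero makes the representative nonnegative everywhere, also outside the
domain, so real powers of it need no side conditions. -/
theorem MemPDG.exists_measurable (hu : MemPDG d C Ω T u) (hΩ : IsOpen Ω) :
    ∃ u' : SpaceTime N → ℝ, Measurable u' ∧ (∀ z, 0 ≤ u' z) ∧
      u' =ᵐ[volume.restrict (Ω ×ˢ Ioo 0 T)] u := by
  have hU : MeasurableSet (Ω ×ˢ Ioo 0 T) := hΩ.measurableSet.prod measurableSet_Ioo
  have h : AEMeasurable u (volume.restrict (Ω ×ˢ Ioo 0 T)) :=
    hu.memVLoc.aemeasurable.mono_measure (Measure.restrict_mono prod_Ioo_subset_parCyl le_rfl)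
  refine ⟨fun z => max (h.mk u z) 0, h.measurable_mk.max measurable_const,
    fun z => le_max_right _ _, ?_⟩
  filter_upwards [h.ae_eq_mk, ae_restrict_mem hU] with z hz hzU
  rw [← hz, max_eq_left (hu.nonneg z (prod_Ioo_subset_parCyl hzU))]

/-- Local integrability of a power of `u` in terms of the measurable representative. -/
theorem lintegral_rpow_ne_top_of_memLpLoc {e s : ℝ} (he : 0 < e) (hu'0 : ∀ z, 0 ≤ u' z)
    (hu' : u' =ᵐ[volume.restrict (Ω ×ˢ Ioo 0 T)] u)
    (h : MemLpLoc e Ω T (fun z => u z ^ (s / e))) {K : Set (Fin N → ℝ)} (hK : IsCompact K)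
    (hKΩ : K ⊆ Ω) : ∫⁻ z in K ×ˢ Ioo 0 T, ENNReal.ofReal (u' z ^ s) ≠ ⊤ := by
  have h1 := (h K hK hKΩ).eLpNorm_lt_top
  rw [eLpNorm_lt_top_iff_lintegral_rpow_enorm_lt_top (by simpa using he) ENNReal.ofReal_ne_top,
    ENNReal.toReal_ofReal he.le] at h1
  refine ne_top_of_le_ne_top h1.ne (le_of_eq (lintegral_congr_ae ?_))
  have hae : ∀ᵐ z ∂(volume.restrict (K ×ˢ Ioo 0 T)), u' z = u z :=
    ae_mono (Measure.restrict_mono (prod_mono hKΩ le_rfl) le_rfl) hu'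
  filter_upwards [hae] with z hz
  rw [← hz, Real.enorm_eq_ofReal (Real.rpow_nonneg (hu'0 z) _),
    ENNReal.ofReal_rpow_of_nonneg (Real.rpow_nonneg (hu'0 z) _) he.le, ← Real.rpow_mul (hu'0 z)]
  congr 2
  field_simp

theorem superPow_le_rpow (hu'0 : ∀ z, 0 ≤ u' z) (k s : ℝ) (z : SpaceTime N) :
    superPow u' k s z ≤ u' z ^ s := by
  rw [superPow]
  split_ifs
  · exact le_rfl
  · exact Real.rpow_nonneg (hu'0 z) _

/-- The diffusion terms of the energy inequality are finite. -/
theorem lintegral_diffusion_ne_top (hm : 0 < d.mMin) {μ e : ℝ} (he : 1 < e) (hμ : 0 < μ)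
    (hu'0 : ∀ z, 0 ≤ u' z) {r : Fin N → ℝ} {η : ℝ} {y : Fin N → ℝ} {τ : ℝ}
    (h : ∫⁻ z in cyl r η y τ, ENNReal.ofReal (u' z ^ (μ * (e - 1) + d.mMin)) ≠ ⊤)
    {δ : Fin N → ℝ} (hδ : ∀ i, 0 < δ i) (i : Fin N) :
    ∫⁻ z in cyl r η y τ, ENNReal.ofReal (u' z ^ ((μ - d.mMin) * (e - 1)) *
      max (u' z ^ d.mMin - 1 ^ d.mMin) 0 ^ e * |spaceDeriv i (spaceCutoff r δ y) z| ^ e) ≠ ⊤ := by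
  have hM := one_le_transBound
  refine ne_top_of_le_ne_top (ENNReal.mul_ne_top ENNReal.ofReal_ne_top h)
    (lintegral_ofReal_le_mul (B := 2 ^ (μ * (e - 1)) * (2 * transBound) ^ e * (1 / 1) ^ e *
      (1 ^ (μ * (e - 1) - μ * (e - 1)) / δ i ^ e)) ?_ fun z => ?_)
  · have := hδ i
    positivity
  · have h1 := diffusion_term_le (L := μ * (e - 1)) (q := e) (K := 1) (k := 1) (ε := 1)
      (M := 2 * transBound) (D := |spaceDeriv i (spaceCutoff r δ y) z|) hu'0 hm he hμ le_rfl le_rfl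
      one_pos (by norm_num) one_pos le_rfl (hδ i) (by linarith) (abs_nonneg _)
      (by rw [one_mul]; exact abs_spaceDeriv_spaceCutoff_le hδ i z) z
    refine h1.trans ?_
    have h2 := superPow_le_rpow hu'0 1 (d.mMin + μ * (e - 1)) z
    rw [add_comm (μ * (e - 1))]
    have := hδ i
    gcongr

theorem timeDeriv_spaceCutoff (r δ y : Fin N → ℝ) (z : SpaceTime N) :
    timeDeriv (spaceCutoff r δ y) z = 0 := by
  have hdiff : DifferentiableAt ℝ (spaceCutoff r δ y) z :=
    ((contDiff_spaceCutoff r δ y).differentiable (by simp)).differentiableAt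
  rw [timeDeriv, ← hdiff.lineDeriv_eq_fderiv, lineDeriv]
  simp [spaceCutoff]

theorem volume_box_ne_top (r y : Fin N → ℝ) : volume (box r y) ≠ ⊤ :=
  ne_top_of_le_ne_top (isCompact_closure_box r y).measure_ne_top (measure_mono subset_closure)

/-- Integrability of `u^(m+1)` up to the top of a cylinder, from the energy inequality. -/
theorem MemPDG.lintegral_rpow_succ_ne_top (hd : d.Admissible) (hu : MemPDG d C Ω T u)
    (hΩ : IsOpen Ω) (hu' : u' =ᵐ[volume.restrict (Ω ×ˢ Ioo 0 T)] u) (hu'm : Measurable u')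
    (hu'0 : ∀ z, 0 ≤ u' z) {ρ : Fin N → ℝ} {θ : ℝ} {y : Fin N → ℝ} {τ : ℝ}
    (hρ : ∀ i, 0 < ρ i) (hθ : 0 < θ)
    (hsub : cyl (fun i => 8 * (2 * ρ i)) (8 * θ) y τ ⊆ parCyl Ω T) :
    ∫⁻ z in cyl ρ θ y τ, ENNReal.ofReal (u' z ^ (d.mMin + 1)) ≠ ⊤ := by
  have hm := hd.mMin_pos
  have hq := hd.one_lt_qMax
  set r : Fin N → ℝ := fun i => 2 * ρ i with hr
  have hr0 : ∀ i, 0 < r i := fun i => by have := hρ i; simp only [hr]; positivity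
  obtain ⟨hbox, hτ0, hτT⟩ := cyl_subset_parCyl (fun i => by have := hρ i; positivity)
    (by linarith) hsub
  have hKc : closure (box r y) ⊆ Ω :=
    (closure_box_subset r y fun i => by have := hρ i; simp only [hr]; linarith).trans hbox
  have hcomp := isCompact_closure_box r y
  have hs0 : τ - θ ∈ Ioo 0 T := ⟨by linarith, by linarith⟩
  -- The cutoff does not depend on time. Its time derivative vanishes, so the integral of `g` over
  -- the cylinder, comparable to the one to be bounded, is absent from the right side. The initial
  -- slice remains and is finite because `u(·, τ - θ)` is locally in `L^(1+m)`.
  set ζ := spaceCutoff r ρ y with hζ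
  obtain ⟨v, v', -, -, -, hen⟩ := hu.energy_measurable hΩ hu' one_pos
  have hE1 := (hen r θ y τ hr0 hθ hsub ζ (isCutoff_of_contDiff (contDiff_spaceCutoff _ _ _)
    (spaceCutoff_nonneg _ _ _) (spaceCutoff_le_one _ _ _)
    (fun z hz => spaceCutoff_eq_zero hρ hz))).1
  set I0 := ∫⁻ x in box r y, ENNReal.ofReal (gFun d.mMin (u (x, τ - θ) ^ d.mMin) (1 ^ d.mMin) *
    ζ (x, τ - θ) ^ d.qMax) with hI0
  set R := energyRight d C u' 1 r θ y τ ζ with hR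
  have hI0t : I0 ≠ ⊤ := by
    have h1 := (hu.memCLoc _ hcomp hKc _ hs0).1.eLpNorm_lt_top
    rw [eLpNorm_lt_top_iff_lintegral_rpow_enorm_lt_top (by simp; linarith) ENNReal.ofReal_ne_top,
      ENNReal.toReal_ofReal (by linarith)] at h1
    have h2 : I0 ≤ ENNReal.ofReal (1 / d.mMin) *
        ∫⁻ x in closure (box r y), ‖u (x, τ - θ)‖ₑ ^ (1 + d.mMin) := by
      rw [← lintegral_const_mul' _ _ ENNReal.ofReal_ne_top]
      refine le_trans ?_ (lintegral_mono_set subset_closure)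
      refine setLIntegral_mono' (isOpen_box _ _).measurableSet fun x hx => ?_
      have hux : 0 ≤ u (x, τ - θ) :=
        hu.nonneg _ (prod_Ioo_subset_parCyl ⟨hKc (subset_closure hx), hs0⟩)
      rw [Real.enorm_eq_ofReal hux, ENNReal.ofReal_rpow_of_nonneg hux (by linarith),
        ← ENNReal.ofReal_mul (by positivity)]
      refine ENNReal.ofReal_le_ofReal ?_
      have h3 := gFun_rpow_le hm zero_le_one hux
      have h4 : gFun d.mMin (u (x, τ - θ) ^ d.mMin) (1 ^ d.mMin)
          ≤ 1 / d.mMin * u (x, τ - θ) ^ (1 + d.mMin) := by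
        refine h3.trans ?_
        split_ifs
        · rw [add_comm]
        · positivity
      have h5 : ζ (x, τ - θ) ^ d.qMax ≤ 1 :=
        Real.rpow_le_one (spaceCutoff_nonneg _ _ _ _) (spaceCutoff_le_one _ _ _ _) (by linarith)
      exact (mul_le_of_le_one_right (gFun_nonneg hm (by positivity)) h5).trans h4
    exact ne_top_of_le_ne_top (ENNReal.mul_ne_top ENNReal.ofReal_ne_top h1.ne) h2
  have hcyl : cyl r θ y τ ⊆ closure (box r y) ×ˢ Ioo 0 T :=
    prod_mono subset_closure (Ioo_subset_Ioo (by linarith) hτT)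
  have hfin : ∀ {s : ℝ}, ∫⁻ z in closure (box r y) ×ˢ Ioo 0 T, ENNReal.ofReal (u' z ^ s) ≠ ⊤ →
      ∫⁻ z in cyl r θ y τ, ENNReal.ofReal (u' z ^ s) ≠ ⊤ := fun h =>
    ne_top_of_le_ne_top h (lintegral_mono_set hcyl)
  have hRt : R ≠ ⊤ := by
    rw [hR, energyRight]
    refine ENNReal.add_ne_top.2 ⟨ENNReal.add_ne_top.2 ⟨?_, ?_⟩, ?_⟩
    · simp [hζ, timeDeriv_spaceCutoff]
    · refine ENNReal.mul_ne_top ENNReal.ofReal_ne_top (ENNReal.sum_ne_top.2 fun i _ => ?_)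
      exact lintegral_diffusion_ne_top hm (hd.one_lt_p i) (hd.m_pos i) hu'0
        (hfin (lintegral_rpow_ne_top_of_memLpLoc (hd.p_pos i) hu'0 hu' (hu.memVLoc.memLp_lam i)
          hcomp hKc)) hρ i
    · refine ENNReal.mul_ne_top ENNReal.ofReal_ne_top (ENNReal.sum_ne_top.2 fun i _ => ?_)
      exact lintegral_diffusion_ne_top hm (hd.one_lt_q i) (hd.n_pos i) hu'0
        (hfin (lintegral_rpow_ne_top_of_memLpLoc (hd.p_pos i) hu'0 hu' (hu.memVLoc.memLp_Lam i)
          hcomp hKc)) hρ i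
  have hgc := gConst_pos hm
  -- The lower bound for `g` is used with `ε = 1/2` and `k = 1`, which requires `u ≥ 2`; the factor
  -- `4` is `1/ε²`. Where `u ≤ 2` the integrand is bounded.
  set c := 4 / gConst d.mMin with hc
  have hslice : ∀ᵐ t, t ∈ Ioo (τ - θ) τ → ∫⁻ x in box ρ y, ENNReal.ofReal (u' (x, t) ^ (d.mMin + 1))
      ≤ ENNReal.ofReal (2 ^ (d.mMin + 1)) * volume (box ρ y) + ENNReal.ofReal c * (I0 + R) := by
    filter_upwards [hE1] with t ht htm
    calc ∫⁻ x in box ρ y, ENNReal.ofReal (u' (x, t) ^ (d.mMin + 1))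
        ≤ ∫⁻ x in box ρ y, (ENNReal.ofReal (2 ^ (d.mMin + 1)) + ENNReal.ofReal c * ENNReal.ofReal
            (gFun d.mMin (u' (x, t) ^ d.mMin) (1 ^ d.mMin) * ζ (x, t) ^ d.qMax)) := by
          refine setLIntegral_mono' (isOpen_box _ _).measurableSet fun x hx => ?_
          rcases le_total (u' (x, t)) 2 with h2 | h2
          · refine le_trans (ENNReal.ofReal_le_ofReal ?_) le_self_add
            have := hu'0 (x, t)
            gcongr
          · refine le_trans ?_ le_add_self
            have hζ1 : ζ (x, t) = 1 := by
              refine spaceCutoff_eq_one hρ ?_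
              intro i
              have := hx i
              simp only [hr]
              linarith
            rw [hζ1, Real.one_rpow d.qMax, mul_one, ← ENNReal.ofReal_mul (by positivity)]
            refine ENNReal.ofReal_le_ofReal ?_
            have h3 := le_gFun_rpow (ε := 1 / 2) (u := u' (x, t)) (k := 1) hm (by norm_num)
              (by norm_num) one_pos (by linarith)
            calc u' (x, t) ^ (d.mMin + 1)
                = c * (gConst d.mMin * (1 / 2) ^ 2 * u' (x, t) ^ (d.mMin + 1)) := by
                  rw [hc]
                  field_simp
                  norm_num
              _ ≤ _ := by gcongr
      _ = ENNReal.ofReal (2 ^ (d.mMin + 1)) * volume (box ρ y) + ENNReal.ofReal c *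
            ∫⁻ x in box ρ y, ENNReal.ofReal
              (gFun d.mMin (u' (x, t) ^ d.mMin) (1 ^ d.mMin) * ζ (x, t) ^ d.qMax) := by
          rw [lintegral_add_left measurable_const, lintegral_const_mul' _ _ ENNReal.ofReal_ne_top,
            setLIntegral_const]
      _ ≤ _ := by
          gcongr
          refine le_trans (lintegral_mono_set (box_mono fun i => ?_)) (ht htm)
          have := hρ i
          simp only [hr]
          linarith
  rw [lintegral_cyl _ _ _ _ (by fun_prop)]
  refine ne_top_of_le_ne_top ?_
    (lintegral_mono_ae ((ae_restrict_iff' measurableSet_Ioo).2 hslice))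
  rw [setLIntegral_const]
  refine ENNReal.mul_ne_top (ENNReal.add_ne_top.2 ⟨?_, ?_⟩) (by simp)
  · exact ENNReal.mul_ne_top ENNReal.ofReal_ne_top (volume_box_ne_top _ _)
  · exact ENNReal.mul_ne_top ENNReal.ofReal_ne_top (ENNReal.add_ne_top.2 ⟨hI0t, hRt⟩)

/-- If `𝓛 = Λ`, this is the assumed integrability of `u^((Λ_i+m)/p_i)` to the power `p_i` for an
index attaining the maximum. If `𝓛 = 1`, it comes from the energy inequality. -/
theorem MemPDG.lintegral_rpow_calL_ne_top (hd : d.Admissible) (hu : MemPDG d C Ω T u)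
    (hΩ : IsOpen Ω) (hu' : u' =ᵐ[volume.restrict (Ω ×ˢ Ioo 0 T)] u) (hu'm : Measurable u')
    (hu'0 : ∀ z, 0 ≤ u' z) {ρ : Fin N → ℝ} {θ : ℝ} {y : Fin N → ℝ} {τ : ℝ}
    (hρ : ∀ i, 0 < ρ i) (hθ : 0 < θ)
    (hsub : cyl (fun i => 8 * (2 * ρ i)) (8 * θ) y τ ⊆ parCyl Ω T) :
    ∫⁻ z in cyl ρ θ y τ, ENNReal.ofReal (u' z ^ (d.mMin + d.calL)) ≠ ⊤ := by
  rcases le_total d.LamMax 1 with h | h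
  · rw [Exponents.calL, max_eq_left h]
    exact hu.lintegral_rpow_succ_ne_top hd hΩ hu' hu'm hu'0 hρ hθ hsub
  · rw [Exponents.calL, max_eq_right h]
    obtain ⟨i, hi⟩ := hd.exists_Lam_eq
    obtain ⟨hbox, hτ0, hτT⟩ := cyl_subset_parCyl (fun i => by have := hρ i; positivity)
      (by linarith) hsub
    have hKc : closure (box ρ y) ⊆ Ω :=
      (closure_box_subset ρ y fun i => by have := hρ i; linarith).trans hbox
    refine ne_top_of_le_ne_top (lintegral_rpow_ne_top_of_memLpLoc (hd.p_pos i) hu'0 hu'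
      (hu.memVLoc.memLp_Lam i) (isCompact_closure_box ρ y) hKc) ?_
    rw [← hi, add_comm]
    exact lintegral_mono_set (prod_mono subset_closure (Ioo_subset_Ioo (by linarith) hτT))

end Finiteness

/-! ### Local boundedness up to the final time -/

section LocalBoundedness

variable {N : ℕ} {d : Exponents N} {Ω : Set (Fin N → ℝ)} {T C : ℝ} {u u' : SpaceTime N → ℝ}

theorem coefSum_antitone (hd : d.Admissible) {K K' θ : ℝ} {ρ : Fin N → ℝ} (hK : 0 < K)
    (hKK : K ≤ K') (hθ : 0 < θ) (hρ : ∀ i, 0 < ρ i) : coefSum d K' θ ρ ≤ coefSum d K θ ρ := by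
  have h : ∀ {s : ℝ}, s ≤ d.calL → K' ^ (s - d.calL) ≤ K ^ (s - d.calL) := fun hs =>
    Real.rpow_le_rpow_of_nonpos hK hKK (by linarith)
  unfold coefSum
  refine add_le_add (add_le_add ?_ ?_) ?_
  · exact div_le_div_of_nonneg_right (h Exponents.one_le_calL) hθ.le
  · refine Finset.sum_le_sum fun i _ => ?_
    exact div_le_div_of_nonneg_right (h (hd.lam_le_calL i)) (Real.rpow_nonneg (hρ i).le _)
  · refine Finset.sum_le_sum fun i _ => ?_
    exact div_le_div_of_nonneg_right (h (Exponents.Lam_le_calL i)) (Real.rpow_nonneg (hρ i).le _)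

theorem tendsto_lintegral_superPow {μ : Measure (SpaceTime N)} (hu'm : Measurable u')
    (hu'0 : ∀ z, 0 ≤ u' z) {s : ℝ} (h : ∫⁻ z, ENNReal.ofReal (u' z ^ s) ∂μ ≠ ⊤) :
    Tendsto (fun n : ℕ => ∫⁻ z, ENNReal.ofReal (superPow u' n s z) ∂μ) atTop (𝓝 0) := by
  have h1 := tendsto_lintegral_of_dominated_convergence (μ := μ)
    (F := fun (n : ℕ) z => ENNReal.ofReal (superPow u' n s z)) (f := fun _ => 0)
    (fun z => ENNReal.ofReal (u' z ^ s))
    (fun n => (measurable_superPow hu'm n s).ennreal_ofReal)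
    (fun n => ae_of_all _ fun z => ENNReal.ofReal_le_ofReal (superPow_le_rpow hu'0 n s z)) h
    (ae_of_all _ fun z => ?_)
  · simpa using h1
  · obtain ⟨k, hk⟩ := exists_nat_ge (u' z)
    refine tendsto_const_nhds.congr' ?_
    filter_upwards [eventually_ge_atTop k] with n hn
    have : u' z ≤ n := hk.trans (by exact_mod_cast hn)
    simp [superPow, not_lt.2 this]

/-- Boundedness on a half cylinder, once `u ^ (m + 𝓛)` is integrable on the cylinder. -/
theorem MemPDG.exists_ae_le (hd : d.Admissible) (hC : 0 < C) (hLM : d.calL ≤ d.calM)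
    (hu : MemPDG d C Ω T u) (hΩ : IsOpen Ω) (hu' : u' =ᵐ[volume.restrict (Ω ×ˢ Ioo 0 T)] u)
    (hu'm : Measurable u') (hu'0 : ∀ z, 0 ≤ u' z) {θ : ℝ} {ρ : Fin N → ℝ} {y : Fin N → ℝ} {τ : ℝ}
    (hρ : ∀ i, 0 < ρ i) (hθ : 0 < θ) (hsub : cyl (fun i => 8 * ρ i) (8 * θ) y τ ⊆ parCyl Ω T)
    (hI : ∫⁻ z in cyl ρ θ y τ, ENNReal.ofReal (u' z ^ (d.mMin + d.calL)) ≠ ⊤) :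
    ∃ B : ℝ, ∀ᵐ z ∂(volume.restrict (cyl (fun i => ρ i / 2) (θ / 2) y τ)), u' z ≤ B := by
  have hβ : 0 < d.pMean / N := div_pos hd.pMean_pos hd.cast_pos
  -- At `K = 2n` with `n ≥ 1`, both `K^(𝓛-𝓜)` and the coefficient sum are bounded by their values at
  -- `K = 1`. Only the tail integral over `{u > n}` must become small, so equality `𝓛 = 𝓜` is
  -- allowed.
  set A := iterConst d C * ENNReal.ofReal (coefSum d 1 θ ρ) ^ (1 + d.pMean / N) with hA
  have hAt : A ≠ ⊤ := ENNReal.mul_ne_top (iterConst_ne_top hd C)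
    (ENNReal.rpow_ne_top_of_nonneg (by positivity) ENNReal.ofReal_ne_top)
  have hlim : Tendsto (fun n : ℕ => A * (∫⁻ z in cyl ρ θ y τ,
      ENNReal.ofReal (superPow u' n (d.mMin + d.calL) z)) ^ (d.pMean / N)) atTop (𝓝 0) := by
    have h1 := ENNReal.Tendsto.const_mul (a := A)
      ((tendsto_lintegral_superPow hu'm hu'0 hI).ennrpow_const (d.pMean / N)) (Or.inr hAt)
    simpa [ENNReal.zero_rpow_of_pos hβ] using h1
  obtain ⟨n, hn, hn1⟩ := ((hlim.eventually (ge_mem_nhds zero_lt_one)).and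
    (eventually_ge_atTop 1)).exists
  have hn1' : (1 : ℝ) ≤ n := by exact_mod_cast hn1
  refine ⟨2 * n, hu.ae_le_of_small hd hC hLM hΩ hu' hu'm hu'0 (by linarith) hρ hθ hsub ?_ ?_⟩
  · exact ne_top_of_le_ne_top hI (lintegral_mono fun z =>
      ENNReal.ofReal_le_ofReal (superPow_le_rpow hu'0 _ _ z))
  · rw [mul_div_cancel_left₀ _ two_ne_zero]
    refine le_trans ?_ hn
    rw [hA]
    gcongr
    · refine mul_le_of_le_one_right zero_le ?_
      rw [ENNReal.ofReal_le_one]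
      exact Real.rpow_le_one_of_one_le_of_nonpos (by linarith) (by linarith)
    · exact coefSum_antitone hd one_pos (by linarith) hθ hρ

theorem MemPDG.exists_ae_le_nhds (hd : d.Admissible) (hC : 0 < C) (hLM : d.calL ≤ d.calM)
    (hu : MemPDG d C Ω T u) (hΩ : IsOpen Ω) (hu' : u' =ᵐ[volume.restrict (Ω ×ˢ Ioo 0 T)] u)
    (hu'm : Measurable u') (hu'0 : ∀ z, 0 ≤ u' z) {z₀ : SpaceTime N} (hz₀ : z₀ ∈ parCyl Ω T) :
    ∃ V ∈ 𝓝 z₀, ∃ B : ℝ, ∀ᵐ z, z ∈ V → z.2 < T → u' z ≤ B := by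
  obtain ⟨x, t⟩ := z₀
  obtain ⟨hx, ht0, htT⟩ := hz₀
  simp only at hx ht0 htT
  obtain ⟨δ, hδ, hball⟩ := Metric.isOpen_iff.1 hΩ x hx
  -- The top is placed slightly above `t` when there is room and at `T` otherwise. With height
  -- `t/16` the eightfold cylinder starts at `τ - t/2 > 0`, and the half cylinder starts at `τ -
  -- t/32 ≤ t - t/64`.
  set τ := min (t + t / 64) T with hτ
  have hτ1 : t ≤ τ := le_min (by linarith) htT
  have hτ2 : τ ≤ T := min_le_right _ _
  have hτ3 : τ ≤ t + t / 64 := min_le_left _ _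
  have hsub : cyl (fun _ : Fin N => 8 * (2 * (δ / 16))) (8 * (t / 16)) x τ ⊆ parCyl Ω T := by
    refine prod_mono (fun w hw => hball ?_) fun s hs => ?_
    · have := hd.nonempty
      rw [Metric.mem_ball, dist_pi_lt_iff hδ]
      intro i
      rw [Real.dist_eq]
      have := hw i
      simp only at this
      linarith
    · exact ⟨by linarith [hs.1], by linarith [hs.2]⟩
  have hI := hu.lintegral_rpow_calL_ne_top hd hΩ hu' hu'm hu'0 (ρ := fun _ => δ / 16)
    (θ := t / 16) (y := x) (τ := τ) (fun _ => by positivity) (by positivity) hsub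
  obtain ⟨B, hB⟩ := hu.exists_ae_le hd hC hLM hΩ hu' hu'm hu'0 (ρ := fun _ => δ / 16)
    (θ := t / 16) (y := x) (τ := τ) (fun _ => by positivity) (by positivity)
    ((cyl_mono (fun _ => by linarith) le_rfl).trans hsub) hI
  refine ⟨box (fun _ => δ / 16 / 2) x ×ˢ Ioo (t - t / 64) (t + t / 64), ?_, B, ?_⟩
  · refine prod_mem_nhds ((isOpen_box _ _).mem_nhds (mem_box_self fun _ => by positivity)) ?_
    exact Ioo_mem_nhds (by linarith) (by linarith)
  · filter_upwards [(ae_restrict_iff' (measurableSet_cyl _ _ _ _)).1 hB] with z hz hzV hzT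
    refine hz ⟨hzV.1, ?_, lt_min hzV.2.2 hzT⟩
    linarith [hzV.2.1]

theorem MemPDG.locallyBounded (hd : d.Admissible) (hC : 0 < C) (hLM : d.calL ≤ d.calM)
    (hu : MemPDG d C Ω T u) (hΩ : IsOpen Ω) : LocallyBounded Ω T u := by
  intro K hK hKsub
  obtain ⟨u', hu'm, hu'0, hu'⟩ := hu.exists_measurable hΩ
  obtain ⟨B, hB⟩ : ∃ B : ℝ, ∀ᵐ z, z ∈ K → z.2 < T → u' z ≤ B := by
    refine hK.induction_on (p := fun s => ∃ B : ℝ, ∀ᵐ z, z ∈ s → z.2 < T → u' z ≤ B)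
      ⟨0, by simp⟩ ?_ ?_ ?_
    · rintro s t hst ⟨B, hB⟩
      exact ⟨B, hB.mono fun z hz hzs => hz (hst hzs)⟩
    · rintro s t ⟨B, hB⟩ ⟨B', hB'⟩
      refine ⟨max B B', ?_⟩
      filter_upwards [hB, hB'] with z h1 h2 hz hzT
      exact hz.elim (fun h => (h1 h hzT).trans (le_max_left _ _))
        fun h => (h2 h hzT).trans (le_max_right _ _)
    · intro z hz
      obtain ⟨V, hV, B, hB⟩ := hu.exists_ae_le_nhds hd hC hLM hΩ hu' hu'm hu'0 (hKsub hz)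
      exact ⟨V, mem_nhdsWithin_of_mem_nhds hV, B, hB⟩
  -- The final time slice, omitted by the local bounds, is a null set.
  have hT : ∀ᵐ z : SpaceTime N, z.2 ≠ T := by
    have h1 : ∀ᵐ t : ℝ, t ≠ T := by simp [ae_iff]
    exact Measure.quasiMeasurePreserving_snd.ae h1
  refine ⟨B, (ae_restrict_iff' hK.measurableSet).2 ?_⟩
  filter_upwards [hB, hT, (ae_restrict_iff' (hΩ.measurableSet.prod measurableSet_Ioo)).1 hu']
    with z h1 h2 h3 hzK
  have hz := hKsub hzK
  have hzT : z.2 < T := lt_of_le_of_ne hz.2.2 h2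
  rw [abs_of_nonneg (hu.nonneg z hz), ← h3 ⟨hz.1, hz.2.1, hzT⟩]
  exact h1 hzK hzT

/-- The margin of the eightfold cylinder puts the closed cylinder inside `Ω × (0, T]`, where `u` is
bounded by compactness. -/
theorem MemPDG.integrableOn_rpow (hd : d.Admissible) (hC : 0 < C) (hLM : d.calL ≤ d.calM)
    (hu : MemPDG d C Ω T u) (hΩ : IsOpen Ω) {θ : ℝ} {ρ : Fin N → ℝ} {y : Fin N → ℝ} {τ : ℝ}
    (hρ : ∀ i, 0 < ρ i) (hθ : 0 < θ) (hsub : cyl (fun i => 8 * ρ i) (8 * θ) y τ ⊆ parCyl Ω T)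
    {s : ℝ} (hs : 0 ≤ s) : IntegrableOn (fun z => u z ^ s) (cyl ρ θ y τ) := by
  obtain ⟨hbox, hτ0, hτT⟩ := cyl_subset_parCyl (fun i => by have := hρ i; positivity)
    (by positivity) hsub
  set S := closure (box ρ y) ×ˢ Icc (τ - θ) τ with hS
  have hSc : IsCompact S := (isCompact_closure_box ρ y).prod isCompact_Icc
  have hSsub : S ⊆ parCyl Ω T :=
    prod_mono ((closure_box_subset ρ y fun i => by linarith [hρ i]).trans hbox)
      fun t ht => ⟨by linarith [ht.1], ht.2.trans hτT⟩
  have hcS : cyl ρ θ y τ ⊆ S := prod_mono subset_closure Ioo_subset_Icc_self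
  obtain ⟨B, hB⟩ := hu.locallyBounded hd hC hLM hΩ S hSc hSsub
  refine IntegrableOn.mono_set ?_ hcS
  have : IsFiniteMeasure (volume.restrict S) := ⟨by
    rw [Measure.restrict_apply_univ]
    exact hSc.measure_lt_top⟩
  refine Integrable.of_bound ?_ (B ^ s) ?_
  · exact ((hu.memVLoc.aemeasurable.mono_measure
      (Measure.restrict_mono hSsub le_rfl)).pow_const s).aestronglyMeasurable
  · filter_upwards [hB, ae_restrict_mem hSc.measurableSet] with z hz hzS
    have h0 := hu.nonneg z (hSsub hzS)
    rw [Real.norm_of_nonneg (Real.rpow_nonneg h0 _)]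
    exact Real.rpow_le_rpow h0 ((le_abs_self _).trans hz) hs

end LocalBoundedness

/-! ### The coefficient sum above the level `𝓡` -/

section IntrinsicScaling

variable {N : ℕ} {d : Exponents N} {θ : ℝ} {ρ : Fin N → ℝ}

/-- Every summand of `𝓡` has the form `(B/X)^(1/(L-s))` with `1/B ≤ 𝓗`. Exceeding it means `K^(L-s)
≥ B/X`, that is, `K^(s-L)/X ≤ 1/B`. -/
theorem rpow_div_le_of_rpow_le {K s L X B H : ℝ} (hK : 0 < K) (hX : 0 < X) (hB : 0 < B)
    (hs : s < L) (h : (B / X) ^ (1 / (L - s)) ≤ K) (hH : 1 / B ≤ H) : K ^ (s - L) / X ≤ H := by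
  have hBX : 0 < B / X := by positivity
  have h1 : B / X ≤ K ^ (L - s) := by
    calc B / X = ((B / X) ^ (1 / (L - s))) ^ (L - s) := by
          rw [← Real.rpow_mul hBX.le, one_div_mul_cancel (by linarith), Real.rpow_one]
      _ ≤ K ^ (L - s) := Real.rpow_le_rpow (by positivity) h (by linarith)
  refine le_trans ?_ hH
  rw [← neg_sub, Real.rpow_neg hK.le, div_le_div_iff₀ hX hB, one_mul,
    inv_mul_le_iff₀ (by positivity)]
  exact (div_le_iff₀ hX).1 h1

theorem rpow_sub_self_div {K L X : ℝ} : K ^ (L - L) / X = 1 / X := by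
  rw [sub_self, Real.rpow_zero]

theorem le_sum_filter {P : Fin N → Prop} [DecidablePred P] {f : Fin N → ℝ} (hf : ∀ i, 0 ≤ f i)
    {i : Fin N} (hi : P i) : f i ≤ ∑ j with P j, f j :=
  Finset.single_le_sum (fun j _ => hf j) (by simpa using hi)

theorem sum_filter_nonneg {P : Fin N → Prop} [DecidablePred P] {f : Fin N → ℝ}
    (hf : ∀ i, 0 ≤ f i) : 0 ≤ ∑ j with P j, f j :=
  Finset.sum_nonneg fun j _ => hf j

theorem Exponents.topLam_pos (hd : d.Admissible) (hρ : ∀ i, 0 < ρ i) : 0 < d.topLam ρ := by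
  obtain ⟨i, hi⟩ := hd.exists_Lam_eq
  exact (Real.rpow_pos_of_pos (hρ i) (d.q i)).trans_le
    (le_sum_filter (f := fun l => ρ l ^ d.q l) (fun l => Real.rpow_nonneg (hρ l).le _) hi)

theorem Exponents.one_div_topLam_le (hd : d.Admissible) (hρ : ∀ i, 0 < ρ i) :
    1 / d.topLam ρ ≤ ∑ i with d.Lam i = d.LamMax, 1 / ρ i ^ d.q i := by
  have h : ∀ i, 0 < ρ i ^ d.q i := fun i => Real.rpow_pos_of_pos (hρ i) _
  obtain ⟨i, hi⟩ := hd.exists_Lam_eq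
  calc 1 / d.topLam ρ ≤ 1 / ρ i ^ d.q i :=
        one_div_le_one_div_of_le (h i) (le_sum_filter (f := fun l => ρ l ^ d.q l)
          (fun l => (h l).le) hi)
    _ ≤ _ := le_sum_filter (f := fun i => 1 / ρ i ^ d.q i) (fun l => (one_div_pos.2 (h l)).le) hi

theorem Exponents.topLamP_pos (hd : d.Admissible) (hρ : ∀ i, 0 < ρ i) : 0 < d.topLamP ρ := by
  unfold topLamP
  split_ifs with hex
  · obtain ⟨i, hi⟩ := hex
    exact (Real.rpow_pos_of_pos (hρ i) (d.p i)).trans_le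
      (le_sum_filter (f := fun l => ρ l ^ d.p l) (fun l => Real.rpow_nonneg (hρ l).le _) hi)
  · exact topLam_pos hd hρ

/-- A sum of positive terms dominates each of them, so its reciprocal is at most one of the summands
of `𝓗`; without an index `λ_l = Λ` the second sum is used. -/
theorem Exponents.one_div_topLamP_le (hd : d.Admissible) (hρ : ∀ i, 0 < ρ i) :
    1 / d.topLamP ρ ≤ (∑ i with d.lam i = d.LamMax, 1 / ρ i ^ d.p i) +
      ∑ i with d.Lam i = d.LamMax, 1 / ρ i ^ d.q i := by
  have h : ∀ (s : ℝ) (i : Fin N), 0 < ρ i ^ s := fun s i => Real.rpow_pos_of_pos (hρ i) s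
  have h' : ∀ (f : Fin N → ℝ) (i : Fin N), 0 ≤ 1 / ρ i ^ f i := fun f i =>
    (one_div_pos.2 (h _ i)).le
  unfold topLamP
  split_ifs with hex
  · obtain ⟨i, hi⟩ := hex
    refine le_add_of_le_of_nonneg ?_ (sum_filter_nonneg (h' d.q))
    calc 1 / (∑ l with d.lam l = d.LamMax, ρ l ^ d.p l) ≤ 1 / ρ i ^ d.p i :=
          one_div_le_one_div_of_le (h _ i) (le_sum_filter (f := fun l => ρ l ^ d.p l)
            (fun l => (h _ l).le) hi)
      _ ≤ _ := le_sum_filter (h' d.p) hi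
  · exact le_add_of_nonneg_of_le (sum_filter_nonneg (h' d.p)) (one_div_topLam_le hd hρ)

theorem Exponents.calH_pos (hd : d.Admissible) (hθ : 0 < θ) (hρ : ∀ i, 0 < ρ i) :
    0 < d.calH θ ρ := by
  have h' : ∀ (f : Fin N → ℝ) (i : Fin N), 0 ≤ 1 / ρ i ^ f i := fun f i =>
    (one_div_pos.2 (Real.rpow_pos_of_pos (hρ i) _)).le
  have h1 : 0 < 1 / θ := one_div_pos.2 hθ
  unfold calH
  split_ifs
  · exact h1
  · exact add_pos_of_pos_of_nonneg (add_pos_of_pos_of_nonneg h1 (sum_filter_nonneg (h' d.p)))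
      (sum_filter_nonneg (h' d.q))
  · exact add_pos_of_nonneg_of_pos (sum_filter_nonneg (h' d.p))
      ((one_div_pos.2 (topLam_pos hd hρ)).trans_le (one_div_topLam_le hd hρ))

theorem Exponents.calR_nonneg (hd : d.Admissible) (hθ : 0 < θ) (hρ : ∀ i, 0 < ρ i) :
    0 ≤ d.calR θ ρ := by
  have h : ∀ (s : ℝ) (i : Fin N), 0 < ρ i ^ s := fun s i => Real.rpow_pos_of_pos (hρ i) s
  have hS := topLam_pos hd hρ
  have hS' := topLamP_pos hd hρ
  unfold calR
  split_ifs
  · exact add_nonneg (Finset.sum_nonneg fun i _ => by have := h (d.p i) i; positivity)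
      (Finset.sum_nonneg fun i _ => by have := h (d.q i) i; positivity)
  · exact add_nonneg (sum_filter_nonneg fun i => by have := h (d.p i) i; positivity)
      (sum_filter_nonneg fun i => by have := h (d.q i) i; positivity)
  · exact add_nonneg (add_nonneg (add_nonneg
      (sum_filter_nonneg fun i => by have := h (d.p i) i; positivity)
      (sum_filter_nonneg fun i => by have := h (d.q i) i; positivity))
      (sum_filter_nonneg fun i => by have := h (d.p i) i; positivity))
      (sum_filter_nonneg fun i => by have := h (d.q i) i; positivity)

/-- Above the level `𝓡(θ, ρ)` every term of the coefficient sum is controlled by `𝓗(θ, ρ)`. -/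
theorem coefSum_terms_le (hd : d.Admissible) {K : ℝ} (hK : 0 < K) (hθ : 0 < θ)
    (hρ : ∀ i, 0 < ρ i) (hR : d.calR θ ρ ≤ K) :
    K ^ (1 - d.calL) / θ ≤ d.calH θ ρ ∧
      (∀ i, K ^ (d.lam i - d.calL) / ρ i ^ d.p i ≤ d.calH θ ρ) ∧
      ∀ i, K ^ (d.Lam i - d.calL) / ρ i ^ d.q i ≤ d.calH θ ρ := by
  have h : ∀ (s : ℝ) (i : Fin N), 0 < ρ i ^ s := fun s i => Real.rpow_pos_of_pos (hρ i) s
  have hinv : ∀ (f : Fin N → ℝ) (i : Fin N), 0 ≤ 1 / ρ i ^ f i := fun f i =>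
    (one_div_pos.2 (h _ i)).le
  have hθinv : 0 ≤ 1 / θ := (one_div_pos.2 hθ).le
  have hquot : ∀ (f g : Fin N → ℝ) (i : Fin N), 0 ≤ (θ / ρ i ^ f i) ^ (g i) := fun f g i => by
    have := h (f i) i
    positivity
  -- A term whose growth exponent equals `𝓛` is independent of `K` and is itself a summand of `𝓗`.
  -- For the others `rpow_div_le_of_rpow_le` applies with `B = θ` if `Λ ≤ 1`; if `Λ > 1`, with `B =
  -- ρ_i^(q_i)` for some `Λ_i = Λ` in the time term, `B = S'` in the `p`-terms and `B = S` in the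
  -- `q`-terms.
  rcases lt_trichotomy d.LamMax 1 with hΛ | hΛ | hΛ
  · have hL : d.calL = 1 := max_eq_left hΛ.le
    have hLam : ∀ i, d.Lam i < 1 := fun i => (Exponents.Lam_le_LamMax i).trans_lt hΛ
    have hlam : ∀ i, d.lam i < 1 := fun i => (hd.lam_le_Lam i).trans_lt (hLam i)
    rw [Exponents.calR, if_pos hΛ] at hR
    rw [Exponents.calH, if_pos hΛ, hL]
    have hs1 := Finset.sum_nonneg fun i (_ : i ∈ Finset.univ) =>
      hquot d.p (fun i => 1 / (1 - d.lam i)) i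
    have hs2 := Finset.sum_nonneg fun i (_ : i ∈ Finset.univ) =>
      hquot d.q (fun i => 1 / (1 - d.Lam i)) i
    refine ⟨rpow_sub_self_div.le, fun i => ?_, fun i => ?_⟩
    · refine rpow_div_le_of_rpow_le hK (h _ i) hθ (hlam i) ?_ le_rfl
      have := Finset.single_le_sum (fun i _ => hquot d.p (fun i => 1 / (1 - d.lam i)) i)
        (Finset.mem_univ i)
      linarith
    · refine rpow_div_le_of_rpow_le hK (h _ i) hθ (hLam i) ?_ le_rfl
      have := Finset.single_le_sum (fun i _ => hquot d.q (fun i => 1 / (1 - d.Lam i)) i)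
        (Finset.mem_univ i)
      linarith
  · have hL : d.calL = 1 := max_eq_left hΛ.le
    have hLam : ∀ i, d.Lam i ≤ 1 := fun i => (Exponents.Lam_le_LamMax i).trans hΛ.le
    have hlam : ∀ i, d.lam i ≤ 1 := fun i => (hd.lam_le_Lam i).trans (hLam i)
    rw [Exponents.calR, if_neg hΛ.not_lt, if_pos hΛ] at hR
    rw [Exponents.calH, if_neg hΛ.not_lt, if_pos hΛ, hL]
    have hs1 := sum_filter_nonneg (P := fun i => d.lam i < 1)
      (hquot d.p fun i => 1 / (1 - d.lam i))
    have hs2 := sum_filter_nonneg (P := fun i => d.Lam i < 1)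
      (hquot d.q fun i => 1 / (1 - d.Lam i))
    have ht1 := sum_filter_nonneg (P := fun i => d.lam i = 1) (hinv d.p)
    have ht2 := sum_filter_nonneg (P := fun i => d.Lam i = 1) (hinv d.q)
    refine ⟨?_, fun i => ?_, fun i => ?_⟩
    · rw [rpow_sub_self_div]
      linarith
    · rcases (hlam i).lt_or_eq with hi | hi
      · refine rpow_div_le_of_rpow_le hK (h _ i) hθ hi ?_ (by linarith)
        have := le_sum_filter (P := fun i => d.lam i < 1)
          (hquot d.p fun i => 1 / (1 - d.lam i)) hi
        linarith
      · have := le_sum_filter (P := fun i => d.lam i = 1) (hinv d.p) hi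
        rw [hi, rpow_sub_self_div]
        linarith
    · rcases (hLam i).lt_or_eq with hi | hi
      · refine rpow_div_le_of_rpow_le hK (h _ i) hθ hi ?_ (by linarith)
        have := le_sum_filter (P := fun i => d.Lam i < 1)
          (hquot d.q fun i => 1 / (1 - d.Lam i)) hi
        linarith
      · have := le_sum_filter (P := fun i => d.Lam i = 1) (hinv d.q) hi
        rw [hi, rpow_sub_self_div]
        linarith
  · have hL : d.calL = d.LamMax := max_eq_right hΛ.le
    have hLam : ∀ i, d.Lam i ≤ d.LamMax := Exponents.Lam_le_LamMax
    have hlam : ∀ i, d.lam i ≤ d.LamMax := fun i => (hd.lam_le_Lam i).trans (hLam i)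
    have hS := Exponents.topLam_pos hd hρ
    have hS' := Exponents.topLamP_pos hd hρ
    have hH' := Exponents.one_div_topLamP_le hd hρ
    have hH := Exponents.one_div_topLam_le hd hρ
    rw [Exponents.calR, if_neg hΛ.not_gt, if_neg hΛ.ne'] at hR
    rw [Exponents.calH, if_neg hΛ.not_gt, if_neg hΛ.ne', hL]
    have hg1 : ∀ (f : Fin N → ℝ) (i : Fin N),
        0 ≤ (ρ i ^ f i / θ) ^ (1 / (d.LamMax - 1)) := fun f i => by
      have := h (f i) i
      positivity
    have hg2 : ∀ i : Fin N,
        0 ≤ (1 / ρ i ^ d.p i * d.topLamP ρ) ^ (1 / (d.LamMax - d.lam i)) := fun i => by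
      have := h (d.p i) i
      positivity
    have hg3 : ∀ i : Fin N,
        0 ≤ (1 / ρ i ^ d.q i * d.topLam ρ) ^ (1 / (d.LamMax - d.Lam i)) := fun i => by
      have := h (d.q i) i
      positivity
    have hs1 := sum_filter_nonneg (P := fun i => d.lam i = d.LamMax) (hg1 d.p)
    have hs2 := sum_filter_nonneg (P := fun i => d.Lam i = d.LamMax) (hg1 d.q)
    have hs3 := sum_filter_nonneg (P := fun i => d.lam i < d.LamMax) hg2
    have hs4 := sum_filter_nonneg (P := fun i => d.Lam i < d.LamMax) hg3
    have ht1 := sum_filter_nonneg (P := fun i => d.lam i = d.LamMax) (hinv d.p)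
    have ht2 := sum_filter_nonneg (P := fun i => d.Lam i = d.LamMax) (hinv d.q)
    refine ⟨?_, fun i => ?_, fun i => ?_⟩
    · obtain ⟨i, hi⟩ := hd.exists_Lam_eq
      refine rpow_div_le_of_rpow_le hK hθ (h (d.q i) i) hΛ ?_ ?_
      · have := le_sum_filter (P := fun i => d.Lam i = d.LamMax) (hg1 d.q) hi
        linarith
      · have := le_sum_filter (P := fun i => d.Lam i = d.LamMax) (hinv d.q) hi
        linarith
    · rcases (hlam i).lt_or_eq with hi | hi
      · refine rpow_div_le_of_rpow_le hK (h _ i) hS' hi ?_ hH'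
        have := le_sum_filter (P := fun i => d.lam i < d.LamMax) hg2 hi
        rw [one_div_mul_eq_div] at this
        linarith
      · have := le_sum_filter (P := fun i => d.lam i = d.LamMax) (hinv d.p) hi
        rw [hi, rpow_sub_self_div]
        linarith
    · rcases (hLam i).lt_or_eq with hi | hi
      · refine rpow_div_le_of_rpow_le hK (h _ i) hS hi ?_ (by linarith)
        have := le_sum_filter (P := fun i => d.Lam i < d.LamMax) hg3 hi
        rw [one_div_mul_eq_div] at this
        linarith
      · have := le_sum_filter (P := fun i => d.Lam i = d.LamMax) (hinv d.q) hi
        rw [hi, rpow_sub_self_div]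
        linarith

theorem coefSum_le (hd : d.Admissible) {K : ℝ} (hK : 0 < K) (hθ : 0 < θ)
    (hρ : ∀ i, 0 < ρ i) (hR : d.calR θ ρ ≤ K) :
    coefSum d K θ ρ ≤ (1 + 2 * N) * d.calH θ ρ := by
  obtain ⟨h1, h2, h3⟩ := coefSum_terms_le hd hK hθ hρ hR
  have h4 := Finset.sum_le_card_nsmul Finset.univ _ _ fun i _ => h2 i
  have h5 := Finset.sum_le_card_nsmul Finset.univ _ _ fun i _ => h3 i
  simp only [Finset.card_univ, Fintype.card_fin, nsmul_eq_mul] at h4 h5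
  unfold coefSum
  linarith

end IntrinsicScaling

/-! ### The quantitative estimate for `𝓛 < 𝓜` -/

section QuantitativeBound

variable {N : ℕ} {d : Exponents N}

/-- This solves the smallness condition of the iteration for `K`. Raising the hypothesis to the
power `s = 𝓜 - 𝓛 > 0` gives matching exponents, since `((n + P)/P) β = 1 + β`. -/
theorem mul_rpow_le_one_of_level {a c H I s β n P K : ℝ} (ha : 0 < a) (hc : 0 < c) (hH : 0 < H)
    (hI : 0 < I) (hs : 0 < s) (hn : 0 < n) (hP : 0 < P) (hβ : β = P / n) (hK : 0 < K)
    (h : (a * c ^ (1 + β)) ^ (1 / s) * (H ^ ((n + P) / P) * I) ^ (P / (s * n)) ≤ K) :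
    a * K ^ (-s) * (c * H) ^ (1 + β) * I ^ β ≤ 1 := by
  have h1 : ((a * c ^ (1 + β)) ^ (1 / s) * (H ^ ((n + P) / P) * I) ^ (P / (s * n))) ^ s
      = a * c ^ (1 + β) * (H ^ (1 + β) * I ^ β) := by
    rw [Real.mul_rpow (by positivity) (by positivity), ← Real.rpow_mul (by positivity),
      one_div_mul_cancel hs.ne', Real.rpow_one, ← Real.rpow_mul (by positivity),
      Real.mul_rpow (by positivity) hI.le, ← Real.rpow_mul hH.le,
      show P / (s * n) * s = β by rw [hβ]; field_simp,
      show (n + P) / P * β = 1 + β by rw [hβ]; field_simp]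
  have h2 : a * c ^ (1 + β) * (H ^ (1 + β) * I ^ β) ≤ K ^ s := by
    rw [← h1]
    exact Real.rpow_le_rpow (by positivity) h hs.le
  calc a * K ^ (-s) * (c * H) ^ (1 + β) * I ^ β
      = K ^ (-s) * (a * c ^ (1 + β) * (H ^ (1 + β) * I ^ β)) := by
        rw [Real.mul_rpow hc.le hH.le]
        ring
    _ ≤ K ^ (-s) * K ^ s := by gcongr
    _ = 1 := by rw [← Real.rpow_add hK, neg_add_cancel, Real.rpow_zero]

/-- The constant of the quantitative bound. -/
def supConst (d : Exponents N) (C : ℝ) : ℝ :=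
  (((iterConst d C).toReal + 1) * (1 + 2 * N) ^ (1 + d.pMean / N)) ^ (1 / (d.calM - d.calL))

theorem supConst_pos (d : Exponents N) (C : ℝ) : 0 < supConst d C := by
  unfold supConst
  positivity

/-- The level `K` is the claimed bound itself: its summand `𝓡` makes the coefficient sum at most `(1
+ 2N) 𝓗`, and its other summand makes the smallness condition hold. -/
theorem MemPDG.ae_le_supBound {Ω : Set (Fin N → ℝ)} {T C : ℝ} {u u' : SpaceTime N → ℝ}
    (hd : d.Admissible) (hC : 0 < C) (hLM : d.calL < d.calM) (hu : MemPDG d C Ω T u)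
    (hΩ : IsOpen Ω) (hu' : u' =ᵐ[volume.restrict (Ω ×ˢ Ioo 0 T)] u) (hu'm : Measurable u')
    (hu'0 : ∀ z, 0 ≤ u' z) {θ : ℝ} {ρ : Fin N → ℝ} {y : Fin N → ℝ} {τ : ℝ}
    (hρ : ∀ i, 0 < ρ i) (hθ : 0 < θ) (hsub : cyl (fun i => 8 * ρ i) (8 * θ) y τ ⊆ parCyl Ω T)
    (hint : IntegrableOn (fun z => u' z ^ (d.mMin + d.calL)) (cyl ρ θ y τ)) :
    ∀ᵐ z ∂(volume.restrict (cyl (fun i => ρ i / 2) (θ / 2) y τ)),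
      u' z ≤ supConst d C * (d.calH θ ρ ^ (((N : ℝ) + d.pMean) / d.pMean) *
        ∫ z' in cyl ρ θ y τ, u' z' ^ (d.mMin + d.calL)) ^
          (d.pMean / ((d.calM - d.calL) * N)) + d.calR θ ρ := by
  have hN := hd.cast_pos
  have hP := hd.pMean_pos
  have hs : 0 < d.calM - d.calL := by linarith
  have hH := Exponents.calH_pos hd hθ hρ
  have hR := Exponents.calR_nonneg hd hθ hρ
  have hγ := supConst_pos d C
  have hnn : ∀ z, 0 ≤ u' z ^ (d.mMin + d.calL) := fun z => Real.rpow_nonneg (hu'0 z) _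
  have hexp : 0 < d.mMin + d.calL := by
    have := hd.mMin_pos
    have := Exponents.one_le_calL (d := d)
    linarith
  set I := ∫ z in cyl ρ θ y τ, u' z ^ (d.mMin + d.calL) with hI
  have hI0 : 0 ≤ I := integral_nonneg hnn
  have hIof : ∫⁻ z in cyl ρ θ y τ, ENNReal.ofReal (u' z ^ (d.mMin + d.calL))
      = ENNReal.ofReal I :=
    (ofReal_integral_eq_lintegral_ofReal hint (ae_of_all _ hnn)).symm
  have hhalf : cyl (fun i => ρ i / 2) (θ / 2) y τ ⊆ cyl ρ θ y τ :=
    cyl_mono (fun i => by linarith [hρ i]) (by linarith)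
  -- A vanishing integral is treated separately: then `u = 0` almost everywhere, while `K` could be
  -- zero, since `𝓡` is an empty sum when all `λ_i` and `Λ_i` equal one.
  rcases hI0.eq_or_lt with hI0 | hI0
  · have hz : ∀ᵐ z ∂(volume.restrict (cyl ρ θ y τ)), u' z ^ (d.mMin + d.calL) = 0 :=
      (integral_eq_zero_iff_of_nonneg hnn hint).1 hI0.symm
    filter_upwards [ae_mono (Measure.restrict_mono hhalf le_rfl) hz] with z hz
    rw [(Real.rpow_eq_zero (hu'0 z) hexp.ne').1 hz]
    positivity
  set K := supConst d C * (d.calH θ ρ ^ (((N : ℝ) + d.pMean) / d.pMean) * I) ^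
    (d.pMean / ((d.calM - d.calL) * N)) + d.calR θ ρ with hK
  have hK0 : 0 < K := by positivity
  have hcs := coefSum_le hd hK0 hθ hρ (le_add_of_nonneg_left (by positivity))
  have hY : ∫⁻ z in cyl ρ θ y τ, ENNReal.ofReal (superPow u' (K / 2) (d.mMin + d.calL) z)
      ≤ ENNReal.ofReal I := hIof ▸ lintegral_mono fun z =>
    ENNReal.ofReal_le_ofReal (superPow_le_rpow hu'0 _ _ z)
  refine hu.ae_le_of_small hd hC hLM.le hΩ hu' hu'm hu'0 hK0 hρ hθ hsub
    (ne_top_of_le_ne_top ENNReal.ofReal_ne_top hY) ?_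
  -- The added `1` makes the constant positive; only an upper bound for `iterConst` is needed.
  have hreal := mul_rpow_le_one_of_level (a := (iterConst d C).toReal + 1) (c := 1 + 2 * N)
    (n := N) (P := d.pMean) (by positivity) (by positivity) hH hI0 hs hN hP rfl hK0
    (le_add_of_nonneg_right hR)
  have hit : iterConst d C ≤ ENNReal.ofReal ((iterConst d C).toReal + 1) := by
    rw [ENNReal.le_ofReal_iff_toReal_le (iterConst_ne_top hd C) (by positivity)]
    linarith
  rw [neg_sub] at hreal
  calc iterConst d C * ENNReal.ofReal (K ^ (d.calL - d.calM)) *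
        ENNReal.ofReal (coefSum d K θ ρ) ^ (1 + d.pMean / N) *
        (∫⁻ z in cyl ρ θ y τ, ENNReal.ofReal (superPow u' (K / 2) (d.mMin + d.calL) z)) ^
          (d.pMean / N)
      ≤ ENNReal.ofReal ((iterConst d C).toReal + 1) * ENNReal.ofReal (K ^ (d.calL - d.calM)) *
        ENNReal.ofReal ((1 + 2 * N) * d.calH θ ρ) ^ (1 + d.pMean / N) *
        ENNReal.ofReal I ^ (d.pMean / N) := by gcongr
    _ = ENNReal.ofReal (((iterConst d C).toReal + 1) * K ^ (d.calL - d.calM) *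
          ((1 + 2 * N) * d.calH θ ρ) ^ (1 + d.pMean / N) * I ^ (d.pMean / N)) := by
        rw [ENNReal.ofReal_rpow_of_nonneg (by positivity) (by positivity),
          ENNReal.ofReal_rpow_of_nonneg hI0.le (by positivity),
          ← ENNReal.ofReal_mul (by positivity), ← ENNReal.ofReal_mul (by positivity),
          ← ENNReal.ofReal_mul (by positivity)]
    _ ≤ 1 := ENNReal.ofReal_le_one.2 hreal

end QuantitativeBound

end PDG

end

/-! ### The main theorem -/

theorem theorem1p1 {N : ℕ} (d : PDG.Exponents N) (hd : d.Admissible) (C : ℝ) (hC : 0 < C)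
    (hLM : d.calL ≤ d.calM) :
    (∀ (Ω : Set (Fin N → ℝ)) (T : ℝ) (u : PDG.SpaceTime N → ℝ),
      IsOpen Ω → Bornology.IsBounded Ω → 0 < T → PDG.MemPDG d C Ω T u →
      PDG.LocallyBounded Ω T u) ∧
    (d.calL < d.calM →
      ∃ γ : ℝ, 0 < γ ∧
        ∀ (Ω : Set (Fin N → ℝ)) (T : ℝ) (u : PDG.SpaceTime N → ℝ),
          IsOpen Ω → Bornology.IsBounded Ω → 0 < T → PDG.MemPDG d C Ω T u →
          ∀ (ρ : Fin N → ℝ) (θ : ℝ) (x₀ : Fin N → ℝ) (t₀ : ℝ), (∀ i, 0 < ρ i) → 0 < θ →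
            PDG.cyl (fun i => 8 * ρ i) (8 * θ) x₀ t₀ ⊆ PDG.parCyl Ω T →
            IntegrableOn (fun z => u z ^ (d.mMin + d.calL)) (PDG.cyl ρ θ x₀ t₀) ∧
            ∀ᵐ z ∂(volume.restrict (PDG.cyl (fun i => ρ i / 2) (θ / 2) x₀ t₀)),
              u z ≤ γ * (d.calH θ ρ ^ (((N : ℝ) + d.pMean) / d.pMean) *
                  ∫ z' in PDG.cyl ρ θ x₀ t₀, u z' ^ (d.mMin + d.calL)) ^
                    (d.pMean / ((d.calM - d.calL) * N)) + d.calR θ ρ) := by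
  refine ⟨fun Ω T u hΩ _ _ hu => hu.locallyBounded hd hC hLM hΩ, fun hlt =>
    ⟨PDG.supConst d C, PDG.supConst_pos d C, fun Ω T u hΩ _ _ hu ρ θ x₀ t₀ hρ hθ hsub => ?_⟩⟩
  have hexp : 0 ≤ d.mMin + d.calL :=
    add_nonneg hd.mMin_pos.le (zero_le_one.trans PDG.Exponents.one_le_calL)
  -- Local boundedness, already available for `𝓛 ≤ 𝓜`, gives the integrability on the whole cylinder
  -- for which the quantitative bound is stated.
  have hint := hu.integrableOn_rpow hd hC hLM hΩ hρ hθ hsub hexp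
  refine ⟨hint, ?_⟩
  obtain ⟨u', hu'm, hu'0, hu'⟩ := hu.exists_measurable hΩ
  obtain ⟨hbox, hτ0, hτT⟩ := PDG.cyl_subset_parCyl (fun i => by have := hρ i; positivity)
    (by positivity) hsub
  have hcyl : PDG.cyl ρ θ x₀ t₀ ⊆ Ω ×ˢ Ioo 0 T :=
    prod_mono ((PDG.box_mono fun i => by linarith [hρ i]).trans hbox)
      (Ioo_subset_Ioo (by linarith) hτT)
  have hae : ∀ᵐ z ∂(volume.restrict (PDG.cyl ρ θ x₀ t₀)), u' z = u z :=
    ae_mono (Measure.restrict_mono hcyl le_rfl) hu'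
  have hpow : (fun z => u' z ^ (d.mMin + d.calL)) =ᵐ[volume.restrict (PDG.cyl ρ θ x₀ t₀)]
      fun z => u z ^ (d.mMin + d.calL) := by
    filter_upwards [hae] with z hz
    rw [hz]
  have hbound := hu.ae_le_supBound hd hC hlt hΩ hu' hu'm hu'0 hρ hθ hsub (hint.congr hpow.symm)
  rw [integral_congr_ae hpow] at hbound
  have hhalf : PDG.cyl (fun i => ρ i / 2) (θ / 2) x₀ t₀ ⊆ PDG.cyl ρ θ x₀ t₀ :=
    PDG.cyl_mono (fun i => by linarith [hρ i]) (by linarith)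
  filter_upwards [hbound, ae_mono (Measure.restrict_mono hhalf le_rfl) hae] with z h1 h2
  rwa [← h2]
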